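/- **Theorem (fully empirical DNN bound under subspace isomorphism).** *Setting.* Let $L\ge 1$, $n\ge 2$, widths $d_0,\dots,d_L\ge 1$, $R>0$, $\beta>0$, and let $\sigma_l:\mathbb R^{d_l}\to\mathbb R^{d_l}$ ($1\le l\le L$) be $1$-Lipschitz. For $W=(W_1,\dots,W_L)$, $W_l\in\mathbb R^{d_l\times d_{l-1}}$, put $f_0(W,x)=x$, $f_l(W,x)=\sigma_l(W_lf_{l-1}(W,x))$, $f=f_L$, $\|W\|_F^2=\sum_l\|W_l\|_F^2$ and $B_F(R)=\{W:\|W\|_F\le R\}$. Let $S=(z_1,\dots,z_n)$, $z_i=(x_i,y_i)$, be i.i.d. from a probability distribution $\mathbb P$, let $S'$ be an independent copy of $S$ (ghost sample), and let $\ell(u,y)\in[0,1]$ be a loss that is $\beta$-Lipschitz in $u\in\mathbb R^{d_L}$ for the Euclidean norm. For a sample $T$ of size $n$ let $F_l^T(W)=[f_l(W,x)]_{x\in T}\in\mathbb R^{d_l\times n}$, $\Gamma_l^T(W)=F_l^T(W)F_l^T(W)^\top$ and $\varrho_T(W,W')=n^{-1/2}\|F_L^T(W)-F_L^T(W')\|_F$.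 *Local Lipschitz constants.* Let $\bar M_{l\to L}(W,\varepsilon)>0$ ($1\le l\le L$, $W\in B_F(R)$, $0<\varepsilon\le1/\beta$) be outer local Lipschitz constants common to all samples: almost surely over $(S,S')$, for all such $l,W,\varepsilon$ and every $W'\in B_F(R)$ with $\varrho_S(W,W')\le\varepsilon$, both $T=S$ and $T=S'$ satisfy $$\big\|F_L^T(F_l^T(W'),\{W'_i\}_{i>l})-F_L^T(F_l^T(W),\{W'_i\}_{i>l})\big\|_F\le \bar M_{l\to L}(W,\varepsilon)\,\|F_l^T(W')-F_l^T(W)\|_F ,$$ where $F_L^T(A,\{W'_i\}_{i>l})$ is the result of propagating the columns of $A$ through the layers $l+1,\dots,L$ with weights $W'_i$. *Riemannian Dimension.* For $C_2>0$ let $R_W=C_2\max\{\|W\|_F,R/2^n\}$, let $\lambda_1\ge\lambda_2\ge\cdots$ denote ordered eigenvalues, let $r^S_l(W,\varepsilon)=\max\{k:\lambda_k(L\bar M_{l\to L}^2(W,\varepsilon)\Gamma_{l-1}^S(W))R_W^2\ge n\varepsilon^2/2\}$ ($0$ if there is no such $k$), and $$d_R^S(W,\varepsilon)=\frac12\sum_{l=1}^L\Big((d_l+d_{l-1})\sum_{k=1}^{r^S_l(W,\varepsilon)}\log\frac{8C_2^2\lambda_k(\Gamma_{l-1}^S(W))}{n\varepsilon^2}+(d_l+d_{l-1})\,r^S_l(W,\varepsilon)\log\!\big(\bar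 M_{l\to L}^2(W,\varepsilon)L\max\{\|W\|_F^2,R^2/4^n\}\big)+\log(d_{l-1}n)\Big).$$ *Subspace isomorphism.* For $0\le j\le L-1$ let $\vartheta_j(W,\varepsilon)=\dfrac{n\varepsilon^2}{2L\bar M_{j+1\to L}^2(W,\varepsilon)R_W^2}$, let $P_j^S(W,\varepsilon)$ be the orthogonal projector onto the span of the eigenvectors of $\Gamma_j^S(W)$ with eigenvalue at least $\vartheta_j(W,\varepsilon)$, and $Q_j^S=I-P_j^S$. For $\kappa,b_{\rm sub}\ge1$ and $\zeta\in[0,1]$ say that $S$ satisfies the *layer-wise finite-resolution subspace isomorphism* if, conditionally on $S$, with probability at least $1-\zeta$ over $S'$, simultaneously for all $0\le j\le L-1$, $W\in B_F(R)$ and $\varepsilon\in(0,1/\beta]$, $$P_j^S\,\Gamma_j^{S'}(W)\,P_j^S\preceq\kappa\,P_j^S\,\Gamma_j^S(W)\,P_j^S,\qquad \big\|Q_j^S\,\Gamma_j^{S'}(W)\,Q_j^S\big\|_{\rm op}\le b_{\rm sub}\,\vartheta_j(W,\varepsilon),$$ where $P_j^S=P_j^S(W,\varepsilon)$ and $Q_j^S=Q_j^S(W,\varepsilon)$.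 *Claim.* There are absolute constants $C_2,C>0$ and, for all $\kappa,b_{\rm sub}\ge1$, a constant $c_{\rm sub}>0$ depending only on $(\kappa,b_{\rm sub})$, which can be chosen the same for all $(\kappa,b_{\rm sub})$ in any given bounded range $[1,K]^2$, such that the following holds in every setting as above. Let $\delta_{\rm iso}\ge0$ and suppose that with probability at least $1-\delta_{\rm iso}$ over $S$ the subspace isomorphism holds. Then for every $\delta\in(0,1)$, with probability at least $1-\delta-\delta_{\rm iso}$ over $S$, for all $W\in B_F(R)$ simultaneously, $$\mathbb E_{(x,y)\sim\mathbb P}\,\ell(f(W,x),y)-\frac1n\sum_{i=1}^n\ell(f(W,x_i),y_i)\le C\left(\beta\inf_{\alpha\ge0}\Big\{\alpha+\frac1{\sqrt n}\int_\alpha^{1/\beta}\sqrt{d_R^S(W,c_{\rm sub}\varepsilon)}\,d\varepsilon\Big\}+\sqrt{\frac{\log(\log(2n)/\delta)}{n}}+\zeta\right),$$ where the integral is read as $0$ for $\alpha\ge1/\beta$ (and as a lower integral if the integrand is not measurable). If moreover $\zeta\le\sqrt{\log(\log(2n)/\delta)/n}$, the same holds without the term $\zeta$. -/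

import Mathlib

open MeasureTheory

namespace DNN

/-- `ℝ^k` with its Euclidean norm. -/
abbrev Vec (k : ℕ) : Type := EuclideanSpace ℝ (Fin k)

/-- Weight tuples of a depth-`L` network with widths `d 0, …, d L`.  The index `l : Fin L` is the
layer with the (one-based) number `l + 1`, whose matrix has size `d (l + 1) × d l`. -/
abbrev Weights (L : ℕ) (d : ℕ → ℕ) : Type :=
  ∀ l : Fin L, Matrix (Fin (d (l + 1))) (Fin (d l)) ℝ

/-- Activations, one map `ℝ^(d (l + 1)) → ℝ^(d (l + 1))` for each layer. -/
abbrev Activations (L : ℕ) (d : ℕ → ℕ) : Type :=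
  ∀ l : Fin L, Vec (d (l + 1)) → Vec (d (l + 1))

noncomputable section

/-- Frobenius norm of a matrix. -/
def frob {m k : ℕ} (A : Matrix (Fin m) (Fin k) ℝ) : ℝ :=
  Real.sqrt (∑ i, ∑ j, A i j ^ 2)

/-- Operator (spectral) norm of a square matrix, for Euclidean norms. -/
def opNorm {k : ℕ} (A : Matrix (Fin k) (Fin k) ℝ) : ℝ :=
  ‖Matrix.toEuclideanCLM (n := Fin k) (𝕜 := ℝ) A‖

/-- The `k`-th largest eigenvalue (`1 ≤ k ≤ m`, with multiplicity) of a symmetric matrix. -/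
def lam {m : ℕ} (A : Matrix (Fin m) (Fin m) ℝ) (k : ℕ) : ℝ :=
  open Classical in
  if h : A.IsHermitian ∧ k - 1 < Fintype.card (Fin m) then h.1.eigenvalues₀ ⟨k - 1, h.2⟩ else 0

/-- Effective rank `max {k : λ_k(A) ρ² ≥ n ε² / 2}` (zero if there is no such `k`). -/
def rEff {m : ℕ} (n : ℕ) (A : Matrix (Fin m) (Fin m) ℝ) (ρ ε : ℝ) : ℕ :=
  open Classical in
  ((Finset.Icc 1 m).filter fun k => (n : ℝ) * ε ^ 2 / 2 ≤ lam A k * ρ ^ 2).sup id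

/-- Orthogonal projector onto the span of the eigenvectors of a symmetric matrix `A` whose
eigenvalues are at least `θ`. -/
def spectralProj {m : ℕ} {A : Matrix (Fin m) (Fin m) ℝ} (hA : A.IsHermitian) (θ : ℝ) :
    Matrix (Fin m) (Fin m) ℝ :=
  open Classical in
  (hA.eigenvectorUnitary : Matrix (Fin m) (Fin m) ℝ)
    * Matrix.diagonal (fun i => if θ ≤ hA.eigenvalues i then (1 : ℝ) else 0)
    * star (hA.eigenvectorUnitary : Matrix (Fin m) (Fin m) ℝ)

variable {L : ℕ} {d : ℕ → ℕ}

/-- Frobenius norm of a weight tuple, `‖W‖² = ∑ ‖W_l‖²`. -/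
def wNorm (W : Weights L d) : ℝ := Real.sqrt (∑ l, frob (W l) ^ 2)

/-- The layer maps: `f_0(W, x) = x` and `f_{j+1}(W, x) = σ_{j+1}(W_{j+1} f_j(W, x))` for `j < L`. -/
def feat (σ : Activations L d) (W : Weights L d) (x : Vec (d 0)) : (j : ℕ) → Vec (d j)
  | 0 => x
  | j + 1 =>
    if h : j < L then
      σ ⟨j, h⟩ (WithLp.toLp 2 ((W ⟨j, h⟩).mulVec (feat σ W x j).ofLp))
    else 0

/-- The feature matrix `F_j(W, X)`, whose columns are `f_j(W, x_i)`. -/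
def featMat {n : ℕ} (σ : Activations L d) (W : Weights L d) (X : Fin n → Vec (d 0)) (j : ℕ) :
    Matrix (Fin (d j)) (Fin n) ℝ :=
  Matrix.of fun a i => feat σ W (X i) j a

/-- Feature Gram matrix `Γ_j(W) = F_j(W, X) F_j(W, X)ᵀ`. -/
def gram {n : ℕ} (σ : Activations L d) (W : Weights L d) (X : Fin n → Vec (d 0)) (j : ℕ) :
    Matrix (Fin (d j)) (Fin (d j)) ℝ :=
  featMat σ W X j * (featMat σ W X j).transpose

lemma gram_isHermitian {n : ℕ} (σ : Activations L d) (W : Weights L d) (X : Fin n → Vec (d 0))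
    (j : ℕ) : (gram σ W X j).IsHermitian := by
  have h := Matrix.isHermitian_mul_conjTranspose_self (featMat σ W X j)
  rwa [Matrix.conjTranspose_eq_transpose_of_trivial] at h

/-- Empirical `L²` distance `ϱ_n(W, W')` of the network outputs on the inputs `X`. -/
def empDist {n : ℕ} (σ : Activations L d) (X : Fin n → Vec (d 0)) (W W' : Weights L d) : ℝ :=
  Real.sqrt (frob (featMat σ W X L - featMat σ W' X L) ^ 2 / n)

/-- The weights that agree with `W` in the layers `1, …, l` and with `W'` in the layers
`l + 1, …, L`.  Thus `F_L(hybrid l W W', X)` is `F_L(F_l(W, X), {W'_i}_{i > l})`. -/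
def hybrid (l : ℕ) (W W' : Weights L d) : Weights L d :=
  fun i => if (i : ℕ) < l then W i else W' i

/-- The estimate defining an outer local Lipschitz constant `M` of layer `l + 1`, for the centre
`W`, the competitor `W'` and the inputs `X`:
`‖F_L(F_{l+1}(W'), W'_{>l+1}) - F_L(F_{l+1}(W), W'_{>l+1})‖ ≤ M ‖F_{l+1}(W') - F_{l+1}(W)‖`. -/
def OuterLipAt {n : ℕ} (σ : Activations L d) (X : Fin n → Vec (d 0)) (l : Fin L)
    (W W' : Weights L d) (M : ℝ) : Prop :=
  frob (featMat σ W' X L - featMat σ (hybrid (l + 1) W W') X L)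
    ≤ M * frob (featMat σ W' X (l + 1) - featMat σ W X (l + 1))

/-- The inputs of a labelled sample. -/
def inputs {n : ℕ} {𝒴 : Type*} (S : Fin n → Vec (d 0) × 𝒴) : Fin n → Vec (d 0) :=
  fun i => (S i).1

/-- `M l W ε` are positive outer local Lipschitz constants at every centre `W` of the weight space
`{‖W‖ ≤ R}` and every scale `0 < ε ≤ 1/β` that are common to all i.i.d. samples of size `n`: for
almost every pair of samples `(S, S')` and every `W'` of the weight space within distance `ε` of
`W` on `S`, the estimate holds on `S` and on `S'`. -/
def CommonLocalLipschitz {𝒴 : Type*} [MeasurableSpace 𝒴] (n : ℕ) (σ : Activations L d)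
    (P : Measure (Vec (d 0) × 𝒴)) (R β : ℝ) (M : Fin L → Weights L d → ℝ → ℝ) : Prop :=
  (∀ l W ε, wNorm W ≤ R → 0 < ε → ε ≤ 1 / β → 0 < M l W ε) ∧
  ∀ᵐ p ∂((Measure.pi fun _ : Fin n => P).prod (Measure.pi fun _ : Fin n => P)),
    ∀ (l : Fin L) (W W' : Weights L d) (ε : ℝ), wNorm W ≤ R → wNorm W' ≤ R →
      0 < ε → ε ≤ 1 / β → empDist σ (inputs p.1) W W' ≤ ε →
      OuterLipAt σ (inputs p.1) l W W' (M l W ε) ∧ OuterLipAt σ (inputs p.2) l W W' (M l W ε)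

/-- `R_W = C₂ max {‖W‖, R / 2^n}`. -/
def radius (C₂ R : ℝ) (n : ℕ) (W : Weights L d) : ℝ := C₂ * max (wNorm W) (R / 2 ^ n)

/-- Effective rank of `L M² Γ_l(W)` at radius `R_W`. -/
def layerRank {n : ℕ} (σ : Activations L d) (M : Fin L → Weights L d → ℝ → ℝ) (C₂ R : ℝ)
    (X : Fin n → Vec (d 0)) (W : Weights L d) (ε : ℝ) (l : Fin L) : ℕ :=
  rEff n (((L : ℝ) * M l W ε ^ 2) • gram σ W X l) (radius C₂ R n W) ε

/-- The observed-sample Riemannian Dimension `d_R^S(W, ε)`. -/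
def riemDim {n : ℕ} (σ : Activations L d) (M : Fin L → Weights L d → ℝ → ℝ) (C₂ R : ℝ)
    (X : Fin n → Vec (d 0)) (W : Weights L d) (ε : ℝ) : ℝ :=
  1 / 2 * ∑ l : Fin L,
    (((d (l + 1) : ℝ) + d l) *
        (∑ k ∈ Finset.Icc 1 (layerRank σ M C₂ R X W ε l),
          Real.log (8 * C₂ ^ 2 * lam (gram σ W X l) k / (n * ε ^ 2)))
      + ((d (l + 1) : ℝ) + d l) * (layerRank σ M C₂ R X W ε l : ℝ) *
          Real.log (M l W ε ^ 2 * L * max (wNorm W ^ 2) (R ^ 2 / 4 ^ n))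
      + Real.log ((d l : ℝ) * n))

/-- Finite spectral resolution `ϑ_j(W, ε)` of the feature layer `j = 0, …, L - 1`. -/
def resolution (n : ℕ) (M : Fin L → Weights L d → ℝ → ℝ) (C₂ R : ℝ)
    (W : Weights L d) (ε : ℝ) (j : Fin L) : ℝ :=
  n * ε ^ 2 / (2 * L * M j W ε ^ 2 * radius C₂ R n W ^ 2)

/-- Projector `P_j^S(W, ε)` onto the observed active subspace of the feature layer `j`. -/
def activeProj {n : ℕ} (σ : Activations L d) (M : Fin L → Weights L d → ℝ → ℝ) (C₂ R : ℝ)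
    (X : Fin n → Vec (d 0)) (W : Weights L d) (ε : ℝ) (j : Fin L) :
    Matrix (Fin (d j)) (Fin (d j)) ℝ :=
  spectralProj (gram_isHermitian σ W X j) (resolution n M C₂ R W ε j)

/-- The two subspace-isomorphism estimates for the observed inputs `X` and the ghost inputs `X'`,
simultaneously for all feature layers, all centres and all scales. -/
def SubspaceIsoPair {n : ℕ} (σ : Activations L d) (M : Fin L → Weights L d → ℝ → ℝ)
    (C₂ R β κ b : ℝ) (X X' : Fin n → Vec (d 0)) : Prop :=
  ∀ (j : Fin L) (W : Weights L d) (ε : ℝ), wNorm W ≤ R → 0 < ε → ε ≤ 1 / β →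
    (κ • (activeProj σ M C₂ R X W ε j * gram σ W X j * activeProj σ M C₂ R X W ε j)
      - activeProj σ M C₂ R X W ε j * gram σ W X' j * activeProj σ M C₂ R X W ε j).PosSemidef ∧
    opNorm ((1 - activeProj σ M C₂ R X W ε j) * gram σ W X' j
        * (1 - activeProj σ M C₂ R X W ε j))
      ≤ b * resolution n M C₂ R W ε j

/-- The observed sample `S` satisfies the conditional layer-wise finite-resolution subspace
isomorphism: with probability at least `1 - ζ` over an independent ghost sample `S'`, the pair
satisfies the two estimates. -/
def SubspaceIso {𝒴 : Type*} [MeasurableSpace 𝒴] {n : ℕ} (σ : Activations L d)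
    (P : Measure (Vec (d 0) × 𝒴)) (M : Fin L → Weights L d → ℝ → ℝ) (C₂ R β κ b ζ : ℝ)
    (S : Fin n → Vec (d 0) × 𝒴) : Prop :=
  (Measure.pi fun _ : Fin n => P)
    {S' | ¬ SubspaceIsoPair σ M C₂ R β κ b (inputs S) (inputs S')} ≤ ENNReal.ofReal ζ

/-- The chaining functional
`inf_{α ≥ 0} (α + n^{-1/2} ∫_α^{1/β} √(d_R^S(W, c ε)) dε)`, with values in `[0, ∞]`; the integral
is zero if `α ≥ 1/β`. -/
def chaining {n : ℕ} (σ : Activations L d) (M : Fin L → Weights L d → ℝ → ℝ) (C₂ R β c : ℝ)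
    (X : Fin n → Vec (d 0)) (W : Weights L d) : ENNReal :=
  ⨅ (α : ℝ) (_ : 0 ≤ α),
    (ENNReal.ofReal α + ENNReal.ofReal (1 / Real.sqrt n) *
      ∫⁻ ε in Set.Ioc α (1 / β), ENNReal.ofReal (Real.sqrt (riemDim σ M C₂ R X W (c * ε))))

/-- The generalization gap `(ℙ - ℙ_n) ℓ(f(W, x), y)`. -/
def genGap {𝒴 : Type*} [MeasurableSpace 𝒴] {n : ℕ} (σ : Activations L d)
    (P : Measure (Vec (d 0) × 𝒴)) (loss : Vec (d L) → 𝒴 → ℝ) (S : Fin n → Vec (d 0) × 𝒴)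
    (W : Weights L d) : ℝ :=
  (∫ z, loss (feat σ W z.1 L) z.2 ∂P)
    - (1 / (n : ℝ)) * ∑ i, loss (feat σ W (S i).1 L) (S i).2

/-- The concentration term `√(log (log (2n) / δ) / n)`. -/
def concTerm (n : ℕ) (δ : ℝ) : ℝ := Real.sqrt (Real.log (Real.log (2 * n) / δ) / n)

end

end DNN

namespace DNN

/-! The proof is chaining with pointwise code lengths. Weight tuples receive codes from one
countable alphabet, fixed before any sample is seen, whose lengths satisfy Kraft's inequality. For
each `W` and each scale, the code is then chosen to fit the eigenstructure of the observed Gram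
matrices. Its length is at most ten times the observed Riemannian Dimension (`exists_netCode`).
Since the alphabet does not depend on the data, a union bound weighted by `exp (-cost)` covers all
these adaptive choices at once.

A layer is coded by a dyadic bound on its norm, a rank, dyadic resolutions of the leading
eigendirections, an element of a net of orthonormal frames, and integer coordinates of the rows in
that frame. The frame net is built in an anisotropic operator norm, so a direction with eigenvalue
`λ` costs about `(p + q) log (4 λ / θ)`, where `θ` is the spectral resolution (`exists_frame_net`,
`exists_layerCode`, `exists_layer_approx`). Subspace isomorphism transfers the resulting
quadratic-form error from the observed to the ghost Gram matrix (`quad_ghost_le`). The local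
Lipschitz constants turn layer errors into output errors. They apply only near `W`, and a continuity
argument along a segment shows that the decoded weights are indeed near (`empDist_le_of_outerLip`).

For the fluctuations, exchanging `S` and `S'` makes each increment symmetric, which gives a
self-normalized exponential inequality (`measure_selfNormalized_le`). The variance it involves is
the empirical one on the pair, and the codes control exactly that. Hence, outside one bad set of
pairs, the chain bounds the difference of the two empirical means for every `W` (`chain_le`,
`chaining_le`).

The ghost sample is then removed separately for each `W`. For most `S` the bad section has
conditional probability below `1/2`; failure of isomorphism and Chebyshev's inequality contribute at
most `1/4` each, so some good ghost sample exists (`measure_genGap_le`). The remaining cases `ζ >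
1/4` and `L > 4 n` are trivial, because the gap is at most one. -/

/-! ### Code lengths and Kraft's inequality. -/

/-- A cost function satisfies Kraft's inequality. -/
def Kraft {I : Type*} (c : I → ℝ) : Prop :=
  ∑' i, ENNReal.ofReal (Real.exp (-c i)) ≤ 1

/-- Every finite set of tuples lies in the box spanned by its coordinate projections, and over a
finite box the sum of products factors. -/
lemma Kraft.pi {J : Type*} [Fintype J] {I : J → Type*} {c : ∀ j, I j → ℝ}
    (h : ∀ j, Kraft (c j)) : Kraft fun f : ∀ j, I j => ∑ j, c j (f j) := by
  classical
  unfold Kraft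
  have key : ∀ f : ∀ j, I j, ENNReal.ofReal (Real.exp (-∑ j, c j (f j)))
      = ∏ j, ENNReal.ofReal (Real.exp (-c j (f j))) := fun f => by
    rw [← Finset.sum_neg_distrib, Real.exp_sum,
      ENNReal.ofReal_prod_of_nonneg fun _ _ => (Real.exp_pos _).le]
  simp_rw [key]
  rw [ENNReal.tsum_eq_iSup_sum]
  refine iSup_le fun s => ?_
  calc ∑ f ∈ s, ∏ j, ENNReal.ofReal (Real.exp (-c j (f j)))
      ≤ ∑ f ∈ Fintype.piFinset fun j => s.image fun f => f j,
          ∏ j, ENNReal.ofReal (Real.exp (-c j (f j))) := by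
        refine Finset.sum_le_sum_of_subset fun f hf => ?_
        exact Fintype.mem_piFinset.2 fun j => Finset.mem_image_of_mem _ hf
    _ = ∏ j, ∑ x ∈ s.image fun f => f j, ENNReal.ofReal (Real.exp (-c j x)) :=
        (Finset.prod_univ_sum (fun j => s.image fun f => f j)
          fun j x => ENNReal.ofReal (Real.exp (-c j x))).symm
    _ ≤ ∏ _j : J, 1 := by
        refine Finset.prod_le_prod' fun j _ => ?_
        exact (ENNReal.sum_le_tsum (f := fun x => ENNReal.ofReal (Real.exp (-c j x))) _).trans (h j)
    _ = 1 := by simp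

/-- This is a prefix code whose second alphabet may depend on the first symbol: the rank and the
resolutions of a layer determine the type of the rest of its code. -/
lemma Kraft.sigma {I : Type*} {A : I → Type*} {c : I → ℝ} {e : ∀ i, A i → ℝ}
    (hc : Kraft c) (he : ∀ i, Kraft (e i)) :
    Kraft fun x : Σ i, A i => c x.1 + e x.1 x.2 := by
  unfold Kraft at *
  rw [ENNReal.tsum_sigma']
  refine le_trans (ENNReal.tsum_le_tsum fun i => ?_) hc
  have : ∀ a, ENNReal.ofReal (Real.exp (-(c i + e i a)))
      = ENNReal.ofReal (Real.exp (-c i)) * ENNReal.ofReal (Real.exp (-e i a)) := fun a => by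
    rw [neg_add, Real.exp_add, ENNReal.ofReal_mul (Real.exp_pos _).le]
  simp_rw [this, ENNReal.tsum_mul_left]
  exact mul_le_of_le_one_right' (he i)

lemma Kraft.prod {I A : Type*} {c : I → ℝ} {e : A → ℝ} (hc : Kraft c) (he : Kraft e) :
    Kraft fun x : I × A => c x.1 + e x.2 := by
  have h := Kraft.sigma (A := fun _ : I => A) hc fun _ => he
  unfold Kraft at *
  rw [← (Equiv.sigmaEquivProd I A).tsum_eq]
  exact h

lemma Kraft.const {I : Type*} [Fintype I] {a : ℝ} (h : (Fintype.card I : ℝ) ≤ Real.exp a) :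
    Kraft fun _ : I => a := by
  unfold Kraft
  rw [tsum_fintype, Finset.sum_const, nsmul_eq_mul, Finset.card_univ,
    ← ENNReal.ofReal_natCast, ← ENNReal.ofReal_mul (Nat.cast_nonneg _), ENNReal.ofReal_le_one,
    Real.exp_neg, ← div_eq_mul_inv]
  exact (div_le_one (Real.exp_pos _)).2 h

/-- The chain starts at the zero function, which has to be available as a code; one bit pays for it.
-/
lemma Kraft.option {I : Type*} {c : I → ℝ} (h : Kraft c) :
    Kraft fun o : Option I => o.elim (Real.log 2) fun i => c i + Real.log 2 := by
  unfold Kraft at *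
  have e : (ENNReal.ofReal (Real.exp (-Real.log 2))) = 2⁻¹ := by
    rw [Real.exp_neg, Real.exp_log two_pos, ENNReal.ofReal_inv_of_pos two_pos]; simp
  rw [← (Equiv.optionEquivSumPUnit.{0} I).symm.tsum_eq, Summable.tsum_sum ENNReal.summable
    ENNReal.summable]
  simp only [Equiv.optionEquivSumPUnit_symm_inl, Option.elim_some,
    Equiv.optionEquivSumPUnit_symm_inr, Option.elim_none, tsum_fintype, Finset.univ_unique,
    Finset.sum_singleton, e]
  have : ∀ i, ENNReal.ofReal (Real.exp (-(c i + Real.log 2)))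
      = ENNReal.ofReal (Real.exp (-c i)) * 2⁻¹ := fun i => by
    rw [neg_add, Real.exp_add, ENNReal.ofReal_mul (Real.exp_pos _).le, e]
  simp_rw [this, ENNReal.tsum_mul_right]
  calc _ ≤ 1 * 2⁻¹ + (2⁻¹ : ENNReal) := by gcongr
    _ = 1 := by rw [one_mul, ENNReal.inv_two_add_inv_two]

lemma Kraft.of_hasSum {I : Type*} {c : I → ℝ} (h : HasSum (fun i => Real.exp (-c i)) 1) :
    Kraft c := by
  unfold Kraft
  rw [← ENNReal.ofReal_tsum_of_nonneg (fun _ => (Real.exp_pos _).le) h.summable, h.tsum_eq]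
  simp

lemma kraft_geometric : Kraft fun b : ℕ => ((b : ℝ) + 1) * Real.log 2 := by
  refine Kraft.of_hasSum ?_
  have h := hasSum_geometric_two' 1
  convert h using 2 with b
  rw [Real.exp_neg, ← Nat.cast_succ, ← Real.log_pow, Real.exp_log (by positivity), pow_succ]
  field_simp

/-- The weights `1 / ((m + 1) (m + 2))` telescope to one. An integer thus costs only logarithmically
in its size, with no a priori bound on it. -/
lemma kraft_nat : Kraft fun m : ℕ => Real.log (((m : ℝ) + 1) * (m + 2)) := by
  refine Kraft.of_hasSum ?_
  have e : ∀ m : ℕ, Real.exp (-Real.log (((m : ℝ) + 1) * (m + 2)))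
      = 1 / ((m : ℝ) + 1) - 1 / ((m + 1 : ℕ) + 1) := fun m => by
    rw [Real.exp_neg, Real.exp_log (by positivity)]
    push_cast
    field_simp
    ring
  refine (hasSum_iff_tendsto_nat_of_nonneg (fun _ => (Real.exp_pos _).le) _).2 ?_
  simp_rw [e, Finset.sum_range_sub' (fun m : ℕ => 1 / ((m : ℝ) + 1))]
  have := (tendsto_one_div_add_atTop_nhds_zero_nat (𝕜 := ℝ)).const_sub 1
  simpa using this

/-! ### Volumetric nets of orthonormal frames in an anisotropic norm. -/

section Net
open scoped Matrix.Norms.L2Operator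

/-- Scaling of the rows of a matrix. -/
def rowScale {r q : ℕ} (D : Fin r → ℝ) :
    Matrix (Fin r) (Fin q) ℝ →ₗ[ℝ] Matrix (Fin r) (Fin q) ℝ :=
  LinearMap.pi fun k => (D k • (LinearMap.id : (Fin q → ℝ) →ₗ[ℝ] _)).comp (LinearMap.proj k)

lemma rowScale_apply {r q : ℕ} (D : Fin r → ℝ) (E : Matrix (Fin r) (Fin q) ℝ) (k : Fin r)
    (i : Fin q) : rowScale D E k i = D k * E k i := rfl

lemma det_rowScale {r q : ℕ} (D : Fin r → ℝ) :
    LinearMap.det (rowScale (q := q) D) = ∏ k, D k ^ q := by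
  have := LinearMap.det_pi (R := ℝ) (M := Fin q → ℝ)
    fun k => D k • (LinearMap.id : (Fin q → ℝ) →ₗ[ℝ] _)
  refine Eq.trans this ?_
  simp [LinearMap.det_smul]

lemma l2norm_le_of_mulVec {r q : ℕ} (A : Matrix (Fin r) (Fin q) ℝ) {c : ℝ} (hc : 0 ≤ c)
    (h : ∀ y : Fin q → ℝ, ∑ k, (A.mulVec y) k ^ 2 ≤ c ^ 2 * ∑ i, y i ^ 2) : ‖A‖ ≤ c := by
  rw [Matrix.l2_opNorm_def]
  refine ContinuousLinearMap.opNorm_le_bound _ hc fun x => ?_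
  refine abs_le_of_sq_le_sq' ?_ (by positivity) |>.2
  rw [mul_pow, EuclideanSpace.norm_sq_eq, EuclideanSpace.norm_sq_eq]
  simpa using h x.ofLp

lemma sum_mulVec_sq_le {r q : ℕ} (A : Matrix (Fin r) (Fin q) ℝ) (y : Fin q → ℝ) :
    ∑ k, (A.mulVec y) k ^ 2 ≤ ‖A‖ ^ 2 * ∑ i, y i ^ 2 := by
  have h := Matrix.l2_opNorm_mulVec A (WithLp.toLp 2 y)
  have h2 := pow_le_pow_left₀ (norm_nonneg _) h 2
  rw [mul_pow, EuclideanSpace.norm_sq_eq, EuclideanSpace.norm_sq_eq] at h2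
  simpa using h2

lemma norm_le_norm_rowScale {r q : ℕ} {D : Fin r → ℝ} (hD : ∀ k, 1 ≤ D k)
    (E : Matrix (Fin r) (Fin q) ℝ) : ‖E‖ ≤ ‖rowScale D E‖ := by
  refine l2norm_le_of_mulVec E (norm_nonneg _) fun y => ?_
  refine le_trans (Finset.sum_le_sum fun k _ => ?_) (sum_mulVec_sq_le (rowScale D E) y)
  have : (rowScale D E).mulVec y k = D k * E.mulVec y k := by
    simp [Matrix.mulVec, dotProduct, rowScale_apply, Finset.mul_sum, mul_assoc]
  rw [this, mul_pow]
  nlinarith [sq_nonneg (E.mulVec y k), hD k, one_le_pow₀ (hD k) (n := 2)]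

/-- Volume bound for separated subsets of the unit ball in a rescaled norm. -/
lemma card_le_of_separated {r q : ℕ} {D : Fin r → ℝ} (hD : ∀ k, 1 ≤ D k)
    (N : Finset (Matrix (Fin r) (Fin q) ℝ)) (hN : ∀ x ∈ N, ‖x‖ ≤ 1)
    (hs : ∀ x ∈ N, ∀ y ∈ N, x ≠ y → 1 ≤ ‖rowScale D (x - y)‖) :
    (N.card : ℝ) ≤ 3 ^ (r * q) * ∏ k, D k ^ q := by
  let X := Matrix (Fin r) (Fin q) ℝ
  let _ : MeasurableSpace X := borel X
  have : BorelSpace X := ⟨rfl⟩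
  let μ : Measure X := Measure.addHaar
  set T := rowScale (q := q) D
  have hdet : 0 < LinearMap.det T := by
    rw [det_rowScale]
    exact Finset.prod_pos fun k _ => pow_pos (by linarith [hD k]) _
  have hT : Continuous T := LinearMap.continuous_of_finiteDimensional T
  -- These are half-unit balls in the rescaled norm. Separation makes them disjoint, and `D ≥ 1`
  -- keeps them in the ordinary ball of radius `3/2`; each loses a factor `det T = ∏ k, D k ^ q` of
  -- volume.
  let B : X → Set X := fun x => (fun z => z - x) ⁻¹' (T ⁻¹' Metric.ball 0 (1 / 2))
  have hBm : ∀ x, MeasurableSet (B x) := fun x =>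
    ((Metric.isOpen_ball.preimage hT).preimage (by fun_prop)).measurableSet
  have hBμ : ∀ x, μ (B x) = ENNReal.ofReal (LinearMap.det T)⁻¹ * μ (Metric.ball 0 (1 / 2)) := by
    intro x
    have h1 : μ (B x) = μ (T ⁻¹' Metric.ball 0 (1 / 2)) := by
      simp only [B, sub_eq_add_neg]
      exact measure_preimage_add_right μ (-x) _
    rw [h1, Measure.addHaar_preimage_linearMap μ hdet.ne', abs_of_pos (inv_pos.2 hdet)]
  have hdisj : (N : Set X).PairwiseDisjoint B := by
    intro x hx y hy hxy
    refine Set.disjoint_left.2 fun z hz hz' => ?_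
    simp only [B, Set.mem_preimage, mem_ball_zero_iff] at hz hz'
    have := hs x hx y hy hxy
    have e : T (x - y) = T (z - y) - T (z - x) := by rw [← map_sub]; congr 1; abel
    rw [e] at this
    linarith [norm_sub_le (T (z - y)) (T (z - x))]
  have hsub : ⋃ x ∈ N, B x ⊆ Metric.ball 0 (3 / 2) := by
    intro z hz
    simp only [Set.mem_iUnion] at hz
    obtain ⟨x, hx, hz⟩ := hz
    simp only [B, Set.mem_preimage, mem_ball_zero_iff] at hz ⊢
    have h1 := norm_le_norm_rowScale hD (z - x)
    have h2 : ‖z‖ ≤ ‖z - x‖ + ‖x‖ := by simpa using norm_add_le (z - x) x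
    linarith [hN x hx]
  have hle := measure_mono (μ := μ) hsub
  rw [measure_biUnion_finset hdisj fun x _ => hBm x] at hle
  simp only [hBμ, Finset.sum_const, nsmul_eq_mul] at hle
  have hfin : Module.finrank ℝ X = r * q := by simp [X, Module.finrank_matrix]
  rw [Measure.addHaar_ball_of_pos μ 0 (by norm_num : (0 : ℝ) < 1 / 2),
    Measure.addHaar_ball_of_pos μ 0 (by norm_num : (0 : ℝ) < 3 / 2), hfin,
    ← mul_assoc, ← mul_assoc] at hle
  have h1 : μ (Metric.ball 0 1) ≠ 0 := (Metric.measure_ball_pos μ 0 one_pos).ne'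
  have h2 : μ (Metric.ball 0 1) ≠ ⊤ := measure_ball_lt_top.ne
  rw [ENNReal.mul_le_mul_iff_left h1 h2, ← ENNReal.ofReal_natCast,
    ← ENNReal.ofReal_mul (Nat.cast_nonneg _), ← ENNReal.ofReal_mul (by positivity),
    ENNReal.ofReal_le_ofReal_iff (by positivity)] at hle
  rw [← det_rowScale]
  have h3 : (3 / 2 : ℝ) ^ (r * q) = 3 ^ (r * q) * (1 / 2) ^ (r * q) := by
    rw [← mul_pow]; norm_num
  rw [h3] at hle
  have h4 : (N.card : ℝ) * (LinearMap.det T)⁻¹ ≤ 3 ^ (r * q) :=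
    le_of_mul_le_mul_right hle (by positivity)
  rwa [← div_eq_mul_inv, div_le_iff₀ hdet] at h4

/-- An internal net of the orthonormal frames, for an anisotropic operator norm. -/
lemma exists_frame_net (r q : ℕ) {D : Fin r → ℝ} (hD : ∀ k, 1 ≤ D k) :
    ∃ N : Finset (Matrix (Fin r) (Fin q) ℝ),
      (N.card : ℝ) ≤ 3 ^ (r * q) * ∏ k, D k ^ q ∧
      (∀ U ∈ N, U * U.transpose = 1) ∧
      ∀ U : Matrix (Fin r) (Fin q) ℝ, U * U.transpose = 1 → ∃ V ∈ N,
        ∀ y : Fin q → ℝ, ∑ k, (D k * (U - V).mulVec y k) ^ 2 ≤ ∑ i, y i ^ 2 := by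
  classical
  set St : Set (Matrix (Fin r) (Fin q) ℝ) := {U | U * U.transpose = 1}
  have hball : ∀ U ∈ St, ‖U‖ ≤ 1 := by
    intro U hU
    have h : ‖U * U.conjTranspose‖ = ‖U‖ * ‖U‖ := by
      have := Matrix.l2_opNorm_conjTranspose_mul_self U.conjTranspose
      rwa [Matrix.conjTranspose_conjTranspose, Matrix.l2_opNorm_conjTranspose] at this
    rw [Matrix.conjTranspose_eq_transpose_of_trivial, hU.out] at h
    have h1 : ‖(1 : Matrix (Fin r) (Fin r) ℝ)‖ ≤ 1 :=
      l2norm_le_of_mulVec _ zero_le_one fun y => by simp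
    nlinarith [norm_nonneg U]
  let S : Set (Finset (Matrix (Fin r) (Fin q) ℝ)) :=
    {N | (∀ x ∈ N, x ∈ St) ∧ ∀ x ∈ N, ∀ y ∈ N, x ≠ y → 1 ≤ ‖rowScale D (x - y)‖}
  have hcard : ∀ N ∈ S, (N.card : ℝ) ≤ 3 ^ (r * q) * ∏ k, D k ^ q := fun N hN =>
    card_le_of_separated hD N (fun x hx => hball x (hN.1 x hx)) hN.2
  -- The volume bound limits the size of separated families of frames, so one of maximal size
  -- exists. Maximality makes it a net, and its members are themselves frames.
  obtain ⟨m, hm⟩ : ∃ m, IsGreatest (Finset.card '' S) m := by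
    refine ⟨_, Nat.sSup_mem ⟨0, ∅, by simp [S], rfl⟩
      ⟨⌊(3 : ℝ) ^ (r * q) * ∏ k, D k ^ q⌋₊, ?_⟩, ?_⟩
    · rintro _ ⟨N, hN, rfl⟩
      exact Nat.le_floor (hcard N hN)
    · rintro _ ⟨N, hN, rfl⟩
      refine le_csSup ⟨⌊(3 : ℝ) ^ (r * q) * ∏ k, D k ^ q⌋₊, ?_⟩ ⟨N, hN, rfl⟩
      rintro _ ⟨N, hN, rfl⟩
      exact Nat.le_floor (hcard N hN)
  obtain ⟨⟨N, hN, rfl⟩, hmax⟩ := hm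
  refine ⟨N, hcard N hN, fun U hU => hN.1 U hU, fun U hU => ?_⟩
  have hclose : ∃ V ∈ N, ‖rowScale D (U - V)‖ ≤ 1 := by
    by_contra! hcon
    have hUN : U ∉ N := fun h => by
      have := hcon U h
      simp at this
      linarith
    have hins : insert U N ∈ S := by
      constructor
      · intro x hx
        rcases Finset.mem_insert.1 hx with rfl | hx
        · exact hU
        · exact hN.1 x hx
      · intro x hx y hy hxy
        rcases Finset.mem_insert.1 hx with hx | hx <;> rcases Finset.mem_insert.1 hy with hy | hy
        · exact absurd (hx.trans hy.symm) hxy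
        · rw [hx]
          exact (hcon y hy).le
        · rw [hy, ← neg_sub, map_neg, norm_neg]
          exact (hcon x hx).le
        · exact hN.2 x hx y hy hxy
    have := hmax ⟨_, hins, rfl⟩
    rw [Finset.card_insert_of_notMem hUN] at this
    omega
  obtain ⟨V, hV, hUV⟩ := hclose
  refine ⟨V, hV, fun y => ?_⟩
  have h := sum_mulVec_sq_le (rowScale D (U - V)) y
  have e : ∀ k, (rowScale D (U - V)).mulVec y k = D k * (U - V).mulVec y k := fun k => by
    simp [Matrix.mulVec, dotProduct, rowScale_apply, Finset.mul_sum, mul_assoc]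
  simp only [e] at h
  refine h.trans ?_
  have : ‖rowScale D (U - V)‖ ^ 2 ≤ 1 := pow_le_one₀ (norm_nonneg _) hUV
  nlinarith [Finset.sum_nonneg fun i (_ : i ∈ Finset.univ) => sq_nonneg (y i)]

end Net

/-! ### Rounding, and coordinates in an approximate frame. -/

lemma frob_sq {m k : ℕ} (A : Matrix (Fin m) (Fin k) ℝ) : frob A ^ 2 = ∑ i, ∑ j, A i j ^ 2 :=
  Real.sq_sqrt (Finset.sum_nonneg fun _ _ => Finset.sum_nonneg fun _ _ => sq_nonneg _)

lemma frob_nonneg {m k : ℕ} (A : Matrix (Fin m) (Fin k) ℝ) : 0 ≤ frob A := Real.sqrt_nonneg _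

/-- Rounding of a real number towards zero on a grid. -/
lemma exists_trunc (z : ℝ) {h : ℝ} (hh : 0 < h) :
    ∃ x : Bool × ℕ, |(if x.1 then (1 : ℝ) else -1) * x.2 * h| ≤ |z| ∧
      |z - (if x.1 then (1 : ℝ) else -1) * x.2 * h| ≤ h ∧ (x.2 : ℝ) * h ≤ |z| := by
  have hm : ((⌊|z| / h⌋₊ : ℕ) : ℝ) * h ≤ |z| := by
    rw [← le_div_iff₀ hh]
    exact Nat.floor_le (by positivity)
  have hm2 : |z| < (((⌊|z| / h⌋₊ : ℕ) : ℝ) + 1) * h := by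
    rw [← div_lt_iff₀ hh]
    exact Nat.lt_floor_add_one _
  have hm0 : 0 ≤ ((⌊|z| / h⌋₊ : ℕ) : ℝ) * h := by positivity
  refine ⟨(decide (0 ≤ z), ⌊|z| / h⌋₊), ?_, ?_, hm⟩
  · by_cases hz : 0 ≤ z
    · simp only [hz, decide_true, if_true, one_mul]
      rwa [abs_of_nonneg hm0]
    · simp only [hz, decide_false, Bool.false_eq_true, if_false, neg_mul, one_mul, abs_neg]
      rwa [abs_of_nonneg hm0]
  · by_cases hz : 0 ≤ z
    · simp only [hz, decide_true, if_true, one_mul]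
      rw [abs_of_nonneg hz] at *
      rw [abs_le]
      constructor <;> nlinarith
    · simp only [hz, decide_false, Bool.false_eq_true, if_false, neg_mul, one_mul]
      rw [abs_of_neg (not_le.1 hz)] at *
      rw [abs_le]
      constructor <;> nlinarith

section Rows
variable {r q : ℕ}

lemma sum_sq_eq_dotProduct {k : ℕ} (x : Fin k → ℝ) : ∑ i, x i ^ 2 = x ⬝ᵥ x := by
  simp [dotProduct, sq]

lemma frame_transpose_sq {U : Matrix (Fin r) (Fin q) ℝ} (hU : U * U.transpose = 1)
    (b : Fin r → ℝ) : ∑ a, (U.transpose.mulVec b) a ^ 2 = ∑ k, b k ^ 2 := by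
  rw [sum_sq_eq_dotProduct, sum_sq_eq_dotProduct, Matrix.dotProduct_mulVec, Matrix.vecMul_transpose,
    Matrix.mulVec_mulVec, hU, Matrix.one_mulVec]

/-- Expanding the square of the residual `w - Uᵀ U w` gives Bessel's inequality. -/
lemma frame_sq_le {U : Matrix (Fin r) (Fin q) ℝ} (hU : U * U.transpose = 1)
    (w : Fin q → ℝ) : ∑ k, (U.mulVec w) k ^ 2 ≤ ∑ a, w a ^ 2 := by
  have h0 : 0 ≤ ∑ a, (w - U.transpose.mulVec (U.mulVec w)) a ^ 2 :=
    Finset.sum_nonneg fun _ _ => sq_nonneg _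
  have h1 : w ⬝ᵥ U.transpose.mulVec (U.mulVec w) = ∑ k, (U.mulVec w) k ^ 2 := by
    rw [Matrix.dotProduct_mulVec, Matrix.vecMul_transpose, sum_sq_eq_dotProduct]
  have h2 := frame_transpose_sq hU (U.mulVec w)
  rw [sum_sq_eq_dotProduct] at h0 h2
  rw [sub_dotProduct, dotProduct_sub, dotProduct_sub, h1, h2,
    dotProduct_comm (U.transpose.mulVec (U.mulVec w)) w, h1,
    ← sum_sq_eq_dotProduct w] at h0
  linarith

/-- Error of the truncated coordinates in an approximate frame, for one row. -/
lemma frame_row_error {U V : Matrix (Fin r) (Fin q) ℝ} (hV : V * V.transpose = 1) (D : Fin r → ℝ)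
    (hUV : ∀ y : Fin q → ℝ, ∑ k, (D k * (U - V).mulVec y k) ^ 2 ≤ ∑ i, y i ^ 2)
    (w : Fin q → ℝ) (b : Fin r → ℝ) (hb : ∀ k, |b k| ≤ |V.mulVec w k|) :
    ∑ a, (V.transpose.mulVec b) a ^ 2 ≤ ∑ a, w a ^ 2 ∧
    ∑ k, (D k * U.mulVec (w - V.transpose.mulVec b) k) ^ 2
      ≤ 8 * ∑ a, w a ^ 2 + 2 * ∑ k, (D k * (V.mulVec w k - b k)) ^ 2 := by
  have h1 : ∑ a, (V.transpose.mulVec b) a ^ 2 ≤ ∑ a, w a ^ 2 := by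
    rw [frame_transpose_sq hV]
    exact (Finset.sum_le_sum fun k _ => sq_le_sq.2 (hb k)).trans (frame_sq_le hV w)
  refine ⟨h1, ?_⟩
  set δ := w - V.transpose.mulVec b with hδ
  have h2 : ∑ a, δ a ^ 2 ≤ 4 * ∑ a, w a ^ 2 := by
    calc ∑ a, δ a ^ 2 ≤ ∑ a, (2 * w a ^ 2 + 2 * (V.transpose.mulVec b) a ^ 2) := by
          refine Finset.sum_le_sum fun a _ => ?_
          simp only [hδ, Pi.sub_apply]
          nlinarith [sq_nonneg (w a + V.transpose.mulVec b a)]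
      _ ≤ _ := by
          rw [Finset.sum_add_distrib, ← Finset.mul_sum, ← Finset.mul_sum]
          linarith
  -- In the net frame `V` the error `δ` has coordinates equal to the pure rounding error, because `V
  -- Vᵀ = 1`. Passing to the true frame `U` adds only `(U - V) δ`, which the net controls.
  have h3 : ∀ k, U.mulVec δ k = (U - V).mulVec δ k + (V.mulVec w k - b k) := by
    intro k
    have : V.mulVec δ = V.mulVec w - b := by
      rw [hδ, Matrix.mulVec_sub, Matrix.mulVec_mulVec, hV, Matrix.one_mulVec]
    rw [Matrix.sub_mulVec, this]
    simp
  calc ∑ k, (D k * U.mulVec δ k) ^ 2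
      ≤ ∑ k, (2 * (D k * (U - V).mulVec δ k) ^ 2 + 2 * (D k * (V.mulVec w k - b k)) ^ 2) := by
        refine Finset.sum_le_sum fun k _ => ?_
        rw [h3 k, mul_add]
        nlinarith [sq_nonneg (D k * (U - V).mulVec δ k - D k * (V.mulVec w k - b k))]
    _ ≤ _ := by
        rw [Finset.sum_add_distrib, ← Finset.mul_sum, ← Finset.mul_sum]
        linarith [hUV δ]
end Rows

/-! ### Codes for the weight matrix of one layer. -/

/-- A finite net of the orthonormal frames with dyadic resolutions `2 ^ (-b k)`. -/
noncomputable def frameNet (r q : ℕ) (b : Fin r → ℕ) : Finset (Matrix (Fin r) (Fin q) ℝ) :=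
  (exists_frame_net r q (D := fun k => 2 ^ b k) fun _ => one_le_pow₀ one_le_two).choose

lemma frameNet_spec (r q : ℕ) (b : Fin r → ℕ) :
    ((frameNet r q b).card : ℝ) ≤ 3 ^ (r * q) * ∏ k, ((2 : ℝ) ^ b k) ^ q ∧
      (∀ U ∈ frameNet r q b, U * U.transpose = 1) ∧
      ∀ U : Matrix (Fin r) (Fin q) ℝ, U * U.transpose = 1 → ∃ V ∈ frameNet r q b,
        ∀ y : Fin q → ℝ, ∑ k, (2 ^ b k * (U - V).mulVec y k) ^ 2 ≤ ∑ i, y i ^ 2 :=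
  (exists_frame_net r q (D := fun k => 2 ^ b k) fun _ => one_le_pow₀ one_le_two).choose_spec

/-- Codes of the weight matrices of one layer: a dyadic scale, a rank, the resolutions of the
singular directions, an element of the frame net and the signed integer coordinates. -/
abbrev LayerCode (p q J : ℕ) : Type :=
  Fin (J + 1) × Σ r : Fin (q + 1), Σ b : Fin r → ℕ,
    {U // U ∈ frameNet r q b} × (Fin p × Fin r → Bool × ℕ)

/-- Code length. -/
noncomputable def layerCost {p q J : ℕ} (x : LayerCode p q J) : ℝ :=
  Real.log (J + 1) + (Real.log (q + 1) + (∑ k, ((x.2.2.1 k : ℝ) + 1) * Real.log 2 +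
    (∑ k, (q : ℝ) * (Real.log 3 + x.2.2.1 k * Real.log 2) +
      ∑ e, (Real.log 2 + Real.log ((((x.2.2.2.2 e).2 : ℝ) + 1) * ((x.2.2.2.2 e).2 + 2))))))

/-- The weight matrix with a given code. -/
noncomputable def layerDecode {p q J : ℕ} (R : ℝ) (x : LayerCode p q J) :
    Matrix (Fin p) (Fin q) ℝ :=
  Matrix.of fun i => x.2.2.2.1.1.transpose.mulVec fun k =>
    (if (x.2.2.2.2 (i, k)).1 then (1 : ℝ) else -1) * (x.2.2.2.2 (i, k)).2 *
      (R / 2 ^ (x.1 : ℕ) / (2 ^ x.2.2.1 k * Real.sqrt (p * (x.2.1 : ℕ))))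

lemma kraft_layerCost (p q J : ℕ) : Kraft (layerCost (p := p) (q := q) (J := J)) := by
  have h4 : ∀ r : ℕ, Kraft fun m : Fin p × Fin r → Bool × ℕ =>
      ∑ e, (Real.log 2 + Real.log ((((m e).2 : ℝ) + 1) * ((m e).2 + 2))) := fun r => by
    refine Kraft.pi (I := fun _ : Fin p × Fin r => Bool × ℕ)
      (c := fun _ x => Real.log 2 + Real.log (((x.2 : ℝ) + 1) * (x.2 + 2))) fun _ => ?_
    refine Kraft.prod (c := fun _ : Bool => Real.log 2)
      (e := fun m : ℕ => Real.log (((m : ℝ) + 1) * (m + 2))) (Kraft.const ?_) kraft_nat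
    rw [Real.exp_log two_pos]; simp
  have h3 : ∀ (r : ℕ) (b : Fin r → ℕ), Kraft fun _ : {U // U ∈ frameNet r q b} =>
      ∑ k, (q : ℝ) * (Real.log 3 + b k * Real.log 2) := fun r b => by
    refine Kraft.const ?_
    rw [Fintype.card_coe]
    refine (frameNet_spec r q b).1.trans (le_of_eq ?_)
    rw [Real.exp_sum]
    have : ∀ k, Real.exp ((q : ℝ) * (Real.log 3 + b k * Real.log 2)) = 3 ^ q * (2 ^ b k) ^ q :=
      fun k => by
        rw [← Real.log_pow, ← Real.log_mul (by norm_num) (by positivity), ← Real.log_pow,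
          Real.exp_log (by positivity), mul_pow]
    simp_rw [this]
    rw [Finset.prod_mul_distrib, Finset.prod_const, Finset.card_univ, Fintype.card_fin,
      ← pow_mul, mul_comm q]
  have h2 := fun r : Fin (q + 1) => Kraft.sigma (I := Fin r → ℕ)
    (c := fun b => ∑ k, ((b k : ℝ) + 1) * Real.log 2)
    (Kraft.pi fun _ => kraft_geometric) fun b => (h3 r b).prod (h4 r)
  have h1 := Kraft.sigma (c := fun _ : Fin (q + 1) => Real.log (q + 1))
    (Kraft.const (by rw [Real.exp_log (by positivity)]; simp)) h2
  exact Kraft.prod (c := fun _ : Fin (J + 1) => Real.log (J + 1))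
    (Kraft.const (by rw [Real.exp_log (by positivity)]; simp)) h1

/-- Code the frame by its nearest net element and truncate the coordinates of the rows towards zero.
Truncation, unlike nearest rounding, cannot increase the Frobenius norm, which keeps decoded weights
inside the parameter ball. The error `10` is `8` from replacing the frame and `2` from truncation.
The integer costs are bounded in total rather than entry by entry, using the Frobenius norm of `W`.
-/
lemma exists_layerCode {p q J j : ℕ} (hj : j ≤ J) {R : ℝ} (hR : 0 < R)
    (W : Matrix (Fin p) (Fin q) ℝ) (hW : frob W ≤ R / 2 ^ j) {r : ℕ} (hr : r ≤ q)
    (U : Matrix (Fin r) (Fin q) ℝ) (hU : U * U.transpose = 1) (b : Fin r → ℕ) :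
    ∃ x : LayerCode p q J, frob (layerDecode R x) ≤ frob W ∧
      ∑ i, ∑ k, (2 ^ b k * U.mulVec (W i - layerDecode R x i) k) ^ 2 ≤ 10 * (R / 2 ^ j) ^ 2 ∧
      layerCost x ≤ Real.log (J + 1) + Real.log (q + 1) +
        ∑ k, (((b k : ℝ) + 1) * Real.log 2 + q * (Real.log 3 + b k * Real.log 2)
          + p * (Real.log 8 + Real.log (1 + 4 ^ b k) + 1)) := by
  set s := R / 2 ^ j with hs_def
  have hs : 0 < s := by positivity
  obtain ⟨V, hVmem, hUV⟩ := (frameNet_spec r q b).2.2 U hU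
  have hV := (frameNet_spec r q b).2.1 V hVmem
  -- With this step, each of the `p r` rounding errors contributes at most `s ^ 2 / (p r)` after
  -- weighting by `2 ^ b k`, hence `s ^ 2` in total.
  set h : Fin r → ℝ := fun k => s / (2 ^ b k * Real.sqrt (p * r)) with hh_def
  have hpos : ∀ e : Fin p × Fin r, 0 < h e.2 := fun e => by
    have h1 : 0 < p := e.1.pos
    have h2 : 0 < r := e.2.pos
    have : (0 : ℝ) < p * r := by positivity
    positivity
  choose m hm1 hm2 hm3 using fun e : Fin p × Fin r =>
    exists_trunc (V.mulVec (W e.1) e.2) (hpos e)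
  let x : LayerCode p q J := (⟨j, by omega⟩, ⟨⟨r, by omega⟩, b, ⟨V, hVmem⟩, m⟩)
  set B : Fin p → Fin r → ℝ := fun i k => (if (m (i, k)).1 then (1 : ℝ) else -1) * (m (i, k)).2 * h k
  have hdec : ∀ i, layerDecode R x i = V.transpose.mulVec (B i) := fun i => rfl
  have hrow := fun i => frame_row_error (U := U) hV (fun k => 2 ^ b k) hUV (W i) (B i)
    fun k => hm1 (i, k)
  have hWs : ∑ i, ∑ a, W i a ^ 2 ≤ s ^ 2 := by
    rw [← frob_sq]
    exact pow_le_pow_left₀ (frob_nonneg _) hW 2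
  have hh2 : ∀ e : Fin p × Fin r, (2 ^ b e.2 * h e.2) ^ 2 = s ^ 2 / (p * r) := fun e => by
    have h1 : 0 < p := e.1.pos
    have h2 : 0 < r := e.2.pos
    have h3 : (0 : ℝ) < p * r := by positivity
    have h4 : (2 : ℝ) ^ b e.2 * h e.2 = s / Real.sqrt (p * r) := by
      simp only [hh_def]
      field_simp
    rw [h4, div_pow, Real.sq_sqrt h3.le]
  refine ⟨x, ?_, ?_, ?_⟩
  · refine Real.sqrt_le_sqrt (Finset.sum_le_sum fun i _ => ?_)
    rw [hdec]
    exact (hrow i).1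
  · simp_rw [hdec]
    refine (Finset.sum_le_sum fun i _ => (hrow i).2).trans ?_
    rw [Finset.sum_add_distrib, ← Finset.mul_sum, ← Finset.mul_sum]
    have : ∑ i, ∑ k, (2 ^ b k * (V.mulVec (W i) k - B i k)) ^ 2 ≤ s ^ 2 := by
      calc _ ≤ ∑ _i : Fin p, ∑ _k : Fin r, s ^ 2 / (p * r) := by
            refine Finset.sum_le_sum fun i _ => Finset.sum_le_sum fun k _ => ?_
            rw [← hh2 (i, k), mul_pow, mul_pow]
            refine mul_le_mul_of_nonneg_left ?_ (by positivity)
            exact sq_le_sq.2 ((hm2 (i, k)).trans (le_abs_self _))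
        _ ≤ s ^ 2 := by
            simp only [Finset.sum_const, Finset.card_univ, Fintype.card_fin, nsmul_eq_mul]
            rw [← mul_assoc, mul_div_assoc']
            exact div_le_of_le_mul₀ (by positivity) (by positivity) (by rw [mul_comm])
    linarith
  · have hentry : ∀ e : Fin p × Fin r,
        Real.log 2 + Real.log ((((m e).2 : ℝ) + 1) * ((m e).2 + 2))
          ≤ Real.log 8 + Real.log (1 + 4 ^ b e.2)
            + (p * r / s ^ 2) * V.mulVec (W e.1) e.2 ^ 2 := by
      intro e
      have h1 : 0 < p := e.1.pos
      have h2 : 0 < r := e.2.pos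
      have h3 : (0 : ℝ) < p * r := by positivity
      set z := V.mulVec (W e.1) e.2
      set M : ℝ := ((m e).2 : ℝ)
      have hM : M ^ 2 ≤ 4 ^ b e.2 * ((p * r / s ^ 2) * z ^ 2) := by
        have h5 : (M * h e.2) ^ 2 ≤ z ^ 2 := by
          rw [← sq_abs z]
          exact pow_le_pow_left₀ (by have := hpos e; positivity) (hm3 e) 2
        have h6 := hh2 e
        have h7 : ((2 : ℝ) ^ b e.2) ^ 2 = 4 ^ b e.2 := by rw [← pow_mul, mul_comm, pow_mul]; norm_num
        rw [mul_pow, h7] at h6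
        have h8 : h e.2 ^ 2 = s ^ 2 / (p * r) / 4 ^ b e.2 := by
          rw [eq_div_iff (by positivity), mul_comm]; exact h6
        rw [mul_pow, h8] at h5
        have h9 : (0 : ℝ) < 4 ^ b e.2 * (p * r / s ^ 2) := by positivity
        calc M ^ 2 = (4 ^ b e.2 * (p * r / s ^ 2)) * (M ^ 2 * (s ^ 2 / (p * r) / 4 ^ b e.2)) := by
              field_simp
          _ ≤ _ := by
              rw [← mul_assoc (4 ^ b e.2 : ℝ)]
              exact mul_le_mul_of_nonneg_left h5 h9.le
      have hM0 : 0 ≤ M := Nat.cast_nonneg _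
      set Y := (p * r / s ^ 2) * z ^ 2
      have hY : 0 ≤ Y := by positivity
      have hX : (0 : ℝ) < 4 ^ b e.2 := by positivity
      have : Real.log 2 + Real.log ((M + 1) * (M + 2)) ≤ Real.log (8 * (1 + 4 ^ b e.2) * (1 + Y)) := by
        rw [← Real.log_mul (by norm_num) (by positivity)]
        refine Real.log_le_log (by positivity) ?_
        nlinarith [mul_nonneg hX.le hY, sq_nonneg (M - 1)]
      rw [Real.log_mul (x := 8 * (1 + 4 ^ b e.2)) (by positivity) (by positivity),
        Real.log_mul (x := 8) (by norm_num) (by positivity)] at this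
      have h10 := Real.log_le_sub_one_of_pos (show 0 < 1 + Y by linarith)
      linarith
    -- The excess `log (1 + Y) ≤ Y` averages to at most one per coordinate, since the sum of the
    -- squared frame coordinates is at most `s ^ 2`.
    have hsum : ∑ e : Fin p × Fin r, (p * r / s ^ 2) * V.mulVec (W e.1) e.2 ^ 2 ≤ p * r := by
      rw [← Finset.mul_sum, Fintype.sum_prod_type]
      have : ∑ i, ∑ k, V.mulVec (W i) k ^ 2 ≤ s ^ 2 :=
        (Finset.sum_le_sum fun i _ => frame_sq_le hV (W i)).trans hWs
      calc _ ≤ (p * r / s ^ 2) * s ^ 2 := mul_le_mul_of_nonneg_left this (by positivity)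
        _ = p * r := by field_simp
    have htot := Finset.sum_le_sum fun e (_ : e ∈ (Finset.univ : Finset (Fin p × Fin r))) => hentry e
    rw [Finset.sum_add_distrib (g := fun e : Fin p × Fin r =>
      (p * r / s ^ 2) * V.mulVec (W e.1) e.2 ^ 2), Fintype.sum_prod_type
      (f := fun e : Fin p × Fin r => Real.log 8 + Real.log (1 + 4 ^ b e.2))] at htot
    simp only [Finset.sum_const (s := (Finset.univ : Finset (Fin p))), Finset.card_univ,
      Fintype.card_fin, nsmul_eq_mul] at htot
    have hc : layerCost x = Real.log (J + 1) + (Real.log (q + 1) +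
        (∑ k, ((b k : ℝ) + 1) * Real.log 2 +
        (∑ k, (q : ℝ) * (Real.log 3 + b k * Real.log 2) +
        ∑ e, (Real.log 2 + Real.log ((((m e).2 : ℝ) + 1) * ((m e).2 + 2)))))) := rfl
    have h11 : ∑ k, (p : ℝ) * (Real.log 8 + Real.log (1 + 4 ^ b k) + 1)
        = p * ∑ k, (Real.log 8 + Real.log (1 + 4 ^ b k)) + p * r := by
      rw [← Finset.mul_sum, Finset.sum_add_distrib, Finset.sum_const, Finset.card_univ,
        Fintype.card_fin, nsmul_eq_mul]
      ring
    have h12 := Finset.sum_add_distrib (s := Finset.univ)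
      (f := fun k => ((b k : ℝ) + 1) * Real.log 2 + q * (Real.log 3 + b k * Real.log 2))
      (g := fun k => (p : ℝ) * (Real.log 8 + Real.log (1 + 4 ^ b k) + 1))
    have h13 := Finset.sum_add_distrib (s := Finset.univ)
      (f := fun k => ((b k : ℝ) + 1) * Real.log 2)
      (g := fun k => (q : ℝ) * (Real.log 3 + b k * Real.log 2))
    rw [hc, h12, h13, h11]
    linarith

/-! ### Spectral calculus: ordered eigenvalues, leading frames and ghost transfer. -/

section Spectral
variable {m : ℕ} {A : Matrix (Fin m) (Fin m) ℝ}

lemma spectral_eq (hA : A.IsHermitian) :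
    A = (hA.eigenvectorUnitary : Matrix (Fin m) (Fin m) ℝ) * Matrix.diagonal hA.eigenvalues
      * star (hA.eigenvectorUnitary : Matrix (Fin m) (Fin m) ℝ) := by
  have h := hA.spectral_theorem
  rwa [Unitary.conjStarAlgAut_apply] at h

lemma star_mulVec_eq (hA : A.IsHermitian) (x : Fin m → ℝ) (i : Fin m) :
    (star (hA.eigenvectorUnitary : Matrix (Fin m) (Fin m) ℝ)).mulVec x i
      = (hA.eigenvectorBasis i).ofLp ⬝ᵥ x := by
  simp [Matrix.mulVec, dotProduct, Matrix.star_apply]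

lemma quad_conj_diagonal (hA : A.IsHermitian) (w x : Fin m → ℝ) :
    x ⬝ᵥ ((hA.eigenvectorUnitary : Matrix (Fin m) (Fin m) ℝ) * Matrix.diagonal w
      * star (hA.eigenvectorUnitary : Matrix (Fin m) (Fin m) ℝ)).mulVec x
      = ∑ i, w i * ((hA.eigenvectorBasis i).ofLp ⬝ᵥ x) ^ 2 := by
  rw [← Matrix.mulVec_mulVec, ← Matrix.mulVec_mulVec, Matrix.dotProduct_mulVec]
  have h : Matrix.vecMul x (hA.eigenvectorUnitary : Matrix (Fin m) (Fin m) ℝ)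
      = (star (hA.eigenvectorUnitary : Matrix (Fin m) (Fin m) ℝ)).mulVec x := by
    rw [Matrix.star_eq_conjTranspose, Matrix.conjTranspose_eq_transpose_of_trivial,
      Matrix.mulVec_transpose]
  rw [h]
  simp only [dotProduct, Matrix.mulVec_diagonal]
  refine Finset.sum_congr rfl fun i _ => ?_
  rw [star_mulVec_eq]
  simp only [dotProduct]
  ring

lemma quad_eq (hA : A.IsHermitian) (x : Fin m → ℝ) :
    x ⬝ᵥ A.mulVec x = ∑ i, hA.eigenvalues i * ((hA.eigenvectorBasis i).ofLp ⬝ᵥ x) ^ 2 := by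
  conv_lhs => rw [spectral_eq hA]
  exact quad_conj_diagonal hA _ x

lemma sum_eigenvectorBasis_sq (hA : A.IsHermitian) (x : Fin m → ℝ) :
    ∑ i, ((hA.eigenvectorBasis i).ofLp ⬝ᵥ x) ^ 2 = ∑ a, x a ^ 2 := by
  have h := quad_conj_diagonal hA 1 x
  simp only [Pi.one_apply, one_mul] at h
  rw [← h, show Matrix.diagonal (1 : Fin m → ℝ) = 1 from Matrix.diagonal_one, mul_one,
    Unitary.mul_star_self_of_mem hA.eigenvectorUnitary.2, Matrix.one_mulVec, sum_sq_eq_dotProduct]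

lemma spectralProj_transpose (hA : A.IsHermitian) (θ : ℝ) :
    (spectralProj hA θ).transpose = spectralProj hA θ := by
  classical
  unfold spectralProj
  simp only [Matrix.star_eq_conjTranspose, Matrix.conjTranspose_eq_transpose_of_trivial,
    Matrix.transpose_mul, Matrix.transpose_transpose, Matrix.diagonal_transpose, mul_assoc]

/-- The projector commutes with `A`, so compression only deletes nonnegative terms of the spectral
sum. -/
lemma quad_spectralProj_le (hA : A.IsHermitian) (hpos : ∀ x, 0 ≤ x ⬝ᵥ A.mulVec x) (θ : ℝ)
    (x : Fin m → ℝ) :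
    x ⬝ᵥ (spectralProj hA θ * A * spectralProj hA θ).mulVec x ≤ x ⬝ᵥ A.mulVec x := by
  classical
  set U := (hA.eigenvectorUnitary : Matrix (Fin m) (Fin m) ℝ) with hU
  have hUU : star U * U = 1 := Unitary.coe_star_mul_self _
  have hconj : ∀ v w : Fin m → ℝ, (U * Matrix.diagonal v * star U) * (U * Matrix.diagonal w * star U)
      = U * Matrix.diagonal (fun i => v i * w i) * star U := fun v w => by
    rw [← Matrix.diagonal_mul_diagonal]
    calc _ = U * Matrix.diagonal v * (star U * U) * Matrix.diagonal w * star U := by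
          simp only [mul_assoc]
      _ = _ := by rw [hUU, mul_one]; simp only [mul_assoc]
  have hlam : ∀ i, 0 ≤ hA.eigenvalues i := fun i => by
    have h := hpos (hA.eigenvectorBasis i).ofLp
    have h2 := hA.eigenvalues_eq i
    simp only [star_trivial, RCLike.re_to_real] at h2
    rwa [← h2] at h
  have e : spectralProj hA θ * A * spectralProj hA θ = U * Matrix.diagonal (fun i =>
      (if θ ≤ hA.eigenvalues i then (1 : ℝ) else 0) * hA.eigenvalues i *
        (if θ ≤ hA.eigenvalues i then (1 : ℝ) else 0)) * star U := by
    conv_lhs => rw [show spectralProj hA θ * A * spectralProj hA θ = spectralProj hA θ *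
      (U * Matrix.diagonal hA.eigenvalues * star U) * spectralProj hA θ from by
        rw [hU, ← spectral_eq hA]]
    unfold spectralProj
    rw [← hU, hconj, hconj]
  rw [e, hU, quad_conj_diagonal, quad_eq hA]
  refine Finset.sum_le_sum fun i _ => mul_le_mul_of_nonneg_right ?_ (sq_nonneg _)
  split_ifs <;> simp [hlam i]

lemma lam_eq (hA : A.IsHermitian) (k : Fin m) :
    lam A (k + 1) = hA.eigenvalues₀ (Fin.cast (Fintype.card_fin m).symm k) := by
  have : A.IsHermitian ∧ (k : ℕ) + 1 - 1 < Fintype.card (Fin m) := ⟨hA, by simp⟩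
  rw [lam, dif_pos this]
  rfl

lemma lam_antitone (hA : A.IsHermitian) {k l : Fin m} (h : k ≤ l) :
    lam A (l + 1) ≤ lam A (k + 1) := by
  rw [lam_eq hA, lam_eq hA]
  exact hA.eigenvalues₀_antitone (by simpa using h)

/-- The ordered list is determined by the characteristic polynomial: its roots scale by `c`, and `c
≥ 0` preserves their order. -/
lemma eigenvalues₀_smul (hA : A.IsHermitian) {c : ℝ} (hc : 0 ≤ c) (hcA : (c • A).IsHermitian) :
    hcA.eigenvalues₀ = fun i => c * hA.eigenvalues₀ i := by
  have hchar : (c • A).charpoly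
      = ∏ i, (Polynomial.X - Polynomial.C (c * hA.eigenvalues i)) := by
    have e : c • A = (hA.eigenvectorUnitary : Matrix (Fin m) (Fin m) ℝ)
        * Matrix.diagonal (fun i => c * hA.eigenvalues i)
        * star (hA.eigenvectorUnitary : Matrix (Fin m) (Fin m) ℝ) := by
      conv_lhs => rw [spectral_eq hA]
      rw [← Matrix.smul_mul, ← Matrix.mul_smul, ← Matrix.diagonal_smul]
      rfl
    rw [e, Matrix.charpoly_mul_comm, ← mul_assoc, Unitary.coe_star_mul_self, one_mul,
      Matrix.charpoly_diagonal]
  have hroots : (c • A).charpoly.roots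
      = Multiset.map (fun i => c * hA.eigenvalues₀ i) Finset.univ.val := by
    have h1 : (c • A).charpoly.roots = Multiset.map (fun i => c * hA.eigenvalues i)
        Finset.univ.val := by
      rw [hchar, Polynomial.roots_prod]
      · simp only [Polynomial.roots_X_sub_C, Multiset.bind_singleton]
      · exact Finset.prod_ne_zero_iff.2 fun _ _ => Polynomial.X_sub_C_ne_zero _
    have h2 := hA.roots_charpoly_eq_eigenvalues
    rw [hA.roots_charpoly_eq_eigenvalues₀] at h2
    have h3 := congrArg (Multiset.map fun t : ℝ => c * t) h2
    simp only [Multiset.map_map, Function.comp_def, RCLike.ofReal_real_eq_id, id] at h3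
    rw [h1, h3]
  have h := hcA.sort_roots_charpoly_eq_eigenvalues₀
  rw [hroots] at h
  have h4 : List.ofFn hcA.eigenvalues₀ = List.ofFn fun i => c * hA.eigenvalues₀ i := by
    rw [← h]
    simp_rw [Fin.univ_val_map, Multiset.map_coe, List.map_ofFn, Function.comp_def,
      RCLike.re_to_real, Multiset.coe_sort]
    apply List.mergeSort_of_pairwise
    simp_rw [decide_eq_true_eq, ← List.sortedGE_iff_pairwise]
    have : Antitone fun i => c * hA.eigenvalues₀ i := fun i j hij =>
      mul_le_mul_of_nonneg_left (hA.eigenvalues₀_antitone hij) hc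
    exact this.sortedGE_ofFn
  exact List.ofFn_inj.1 h4

lemma lam_smul (hA : A.IsHermitian) {c : ℝ} (hc : 0 ≤ c) (k : Fin m) :
    lam (c • A) (k + 1) = c * lam A (k + 1) := by
  have hcA : (c • A).IsHermitian := by
    unfold Matrix.IsHermitian
    rw [Matrix.conjTranspose_smul, hA.eq, star_trivial]
  rw [lam_eq hA, lam_eq hcA, eigenvalues₀_smul hA hc hcA]

lemma rEff_le (n : ℕ) (A : Matrix (Fin m) (Fin m) ℝ) (ρ ε : ℝ) : rEff n A ρ ε ≤ m := by
  classical
  refine Finset.sup_le fun k hk => ?_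
  exact (Finset.mem_Icc.1 (Finset.mem_filter.1 hk).1).2

/-- Since the eigenvalues decrease, the indices that satisfy the threshold form an initial segment,
and its maximum is its length. The shift reconciles zero-based `Fin` indices with the one-based
numbering of `lam`. -/
lemma lt_rEff_iff (hA : A.IsHermitian) (n : ℕ) (ρ ε : ℝ) (k : Fin m) :
    (k : ℕ) < rEff n A ρ ε ↔ (n : ℝ) * ε ^ 2 / 2 ≤ lam A (k + 1) * ρ ^ 2 := by
  classical
  constructor
  · intro h
    obtain ⟨l, hl, hkl⟩ := Finset.lt_sup_iff.1 h
    obtain ⟨hl1, hl2⟩ := Finset.mem_filter.1 hl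
    obtain ⟨hl3, hl4⟩ := Finset.mem_Icc.1 hl1
    simp only [id] at hkl
    have := lam_antitone hA (k := k) (l := ⟨l - 1, by omega⟩) (Fin.le_def.2 (by simp; omega))
    simp only [Nat.sub_add_cancel hl3] at this
    exact hl2.trans (mul_le_mul_of_nonneg_right this (sq_nonneg _))
  · intro h
    have : (k : ℕ) + 1 ∈ (Finset.Icc 1 m).filter
        fun k => (n : ℝ) * ε ^ 2 / 2 ≤ lam A k * ρ ^ 2 := by
      refine Finset.mem_filter.2 ⟨Finset.mem_Icc.2 ⟨by omega, by omega⟩, h⟩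
    have h2 := Finset.le_sup (f := id) this
    exact h2

/-- The quadratic form of a symmetric matrix is controlled by its top eigenvectors, up to the
first eigenvalue that is left out. -/
lemma exists_topFrame (hA : A.IsHermitian) {θ : ℝ} {r : ℕ} (hr : r ≤ m)
    (hθ : ∀ k : Fin m, (k : ℕ) < r ∨ lam A (k + 1) ≤ θ) (hθ0 : 0 ≤ θ) :
    ∃ U : Matrix (Fin r) (Fin m) ℝ, U * U.transpose = 1 ∧ ∀ x : Fin m → ℝ,
      x ⬝ᵥ A.mulVec x ≤ ∑ k : Fin r, lam A (k + 1) * U.mulVec x k ^ 2 + θ * ∑ a, x a ^ 2 := by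
  classical
  -- `eigenvalues` and `eigenvectorBasis` are indexed through an arbitrary equivalence; `e` restores
  -- the decreasing order used by `lam`.
  let e : Fin m ≃ Fin m :=
    (finCongr (Fintype.card_fin m).symm).trans (Fintype.equivOfCardEq (Fintype.card_fin _))
  have hev : ∀ k, hA.eigenvalues (e k) = lam A (k + 1) := fun k => by
    rw [lam_eq hA]
    simp [e, Matrix.IsHermitian.eigenvalues]
  let u : Fin m → Fin m → ℝ := fun k => (hA.eigenvectorBasis (e k)).ofLp
  refine ⟨Matrix.of fun k => u (Fin.castLE hr k), ?_, fun x => ?_⟩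
  · ext k l
    have h := orthonormal_iff_ite.1 hA.eigenvectorBasis.orthonormal (e (Fin.castLE hr k))
      (e (Fin.castLE hr l))
    rw [Matrix.mul_apply, Matrix.one_apply]
    simp only [EmbeddingLike.apply_eq_iff_eq, Fin.castLE_inj] at h
    rw [← h, PiLp.inner_apply]
    refine Finset.sum_congr rfl fun a _ => ?_
    simp [u, mul_comm]
  · rw [quad_eq hA, ← e.sum_comp, ← sum_eigenvectorBasis_sq hA x, ← e.sum_comp (fun i =>
      ((hA.eigenvectorBasis i).ofLp ⬝ᵥ x) ^ 2)]
    have h1 : ∑ k : Fin r, lam A (k + 1) *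
          (Matrix.of fun k => u (Fin.castLE hr k)).mulVec x k ^ 2
        = ∑ k : Fin m, if (k : ℕ) < r then lam A (k + 1) * (u k ⬝ᵥ x) ^ 2 else 0 := by
      rw [← Finset.sum_filter]
      have : (Finset.univ.filter fun k : Fin m => (k : ℕ) < r)
          = Finset.univ.map (Fin.castLEEmb hr) := by
        ext k
        simp only [Finset.mem_filter, Finset.mem_univ, true_and, Finset.mem_map]
        exact ⟨fun h => ⟨⟨k, h⟩, rfl⟩, by rintro ⟨l, rfl⟩; exact l.2⟩
      rw [this, Finset.sum_map]
      rfl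
    rw [h1, Finset.mul_sum, ← Finset.sum_add_distrib]
    refine Finset.sum_le_sum fun k _ => ?_
    rw [hev]
    rcases hθ k with h | h
    · rw [if_pos h]
      have := mul_nonneg hθ0 (sq_nonneg ((hA.eigenvectorBasis (e k)).ofLp ⬝ᵥ x))
      simp only [u]
      linarith
    · have h2 := mul_le_mul_of_nonneg_right h (sq_nonneg ((hA.eigenvectorBasis (e k)).ofLp ⬝ᵥ x))
      split_ifs with h3
      · have := mul_nonneg hθ0 (sq_nonneg ((hA.eigenvectorBasis (e k)).ofLp ⬝ᵥ x))
        simp only [u]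
        linarith
      · linarith

lemma quad_le_opNorm (A : Matrix (Fin m) (Fin m) ℝ) (x : Fin m → ℝ) :
    x ⬝ᵥ A.mulVec x ≤ opNorm A * ∑ a, x a ^ 2 := by
  have h1 := ContinuousLinearMap.le_opNorm (Matrix.toEuclideanCLM (n := Fin m) (𝕜 := ℝ) A)
    (WithLp.toLp 2 x)
  have h2 := real_inner_le_norm (WithLp.toLp 2 x)
    (Matrix.toEuclideanCLM (n := Fin m) (𝕜 := ℝ) A (WithLp.toLp 2 x))
  have h3 : inner ℝ (WithLp.toLp 2 x)
      (Matrix.toEuclideanCLM (n := Fin m) (𝕜 := ℝ) A (WithLp.toLp 2 x)) = x ⬝ᵥ A.mulVec x := by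
    rw [PiLp.inner_apply]
    simp [dotProduct, mul_comm]
  have h4 : ‖(WithLp.toLp 2 x : EuclideanSpace ℝ (Fin m))‖ ^ 2 = ∑ a, x a ^ 2 := by
    rw [EuclideanSpace.norm_sq_eq]; simp
  rw [h3] at h2
  rw [← h4]
  unfold opNorm
  nlinarith [norm_nonneg (WithLp.toLp 2 x : EuclideanSpace ℝ (Fin m))]

lemma quad_mul_self {k : ℕ} (F : Matrix (Fin m) (Fin k) ℝ) (x : Fin m → ℝ) :
    x ⬝ᵥ (F * F.transpose).mulVec x = ∑ i, (F.transpose.mulVec x) i ^ 2 := by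
  rw [← Matrix.mulVec_mulVec, Matrix.dotProduct_mulVec, ← Matrix.mulVec_transpose,
    sum_sq_eq_dotProduct]

lemma quad_conj_symm {P : Matrix (Fin m) (Fin m) ℝ} (hP : P.transpose = P)
    (B : Matrix (Fin m) (Fin m) ℝ) (x : Fin m → ℝ) :
    x ⬝ᵥ (P * B * P).mulVec x = (P.mulVec x) ⬝ᵥ B.mulVec (P.mulVec x) := by
  rw [← Matrix.mulVec_mulVec, ← Matrix.mulVec_mulVec, Matrix.dotProduct_mulVec,
    ← Matrix.mulVec_transpose, hP]

/-- Transfer of a quadratic form through a subspace isomorphism. -/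
lemma quad_ghost_le (hA : A.IsHermitian) (hpos : ∀ x, 0 ≤ x ⬝ᵥ A.mulVec x) {k : ℕ}
    (F : Matrix (Fin m) (Fin k) ℝ) {θ κ B : ℝ} (hκ : 0 ≤ κ)
    (h1 : (κ • (spectralProj hA θ * A * spectralProj hA θ)
      - spectralProj hA θ * (F * F.transpose) * spectralProj hA θ).PosSemidef)
    (h2 : opNorm ((1 - spectralProj hA θ) * (F * F.transpose) * (1 - spectralProj hA θ)) ≤ B)
    (x : Fin m → ℝ) :
    x ⬝ᵥ (F * F.transpose).mulVec x ≤ 2 * κ * (x ⬝ᵥ A.mulVec x) + 2 * B * ∑ a, x a ^ 2 := by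
  set P := spectralProj hA θ
  have hP : P.transpose = P := spectralProj_transpose hA θ
  have hQ : (1 - P).transpose = 1 - P := by rw [Matrix.transpose_sub, hP, Matrix.transpose_one]
  have h3 := h1.dotProduct_mulVec_nonneg x
  rw [star_trivial, Matrix.sub_mulVec, dotProduct_sub, Matrix.smul_mulVec, dotProduct_smul,
    smul_eq_mul, quad_conj_symm hP (F * F.transpose), quad_mul_self] at h3
  have h4 := mul_le_mul_of_nonneg_left (quad_spectralProj_le hA hpos θ x) hκ
  have h5 := (quad_le_opNorm ((1 - P) * (F * F.transpose) * (1 - P)) x).trans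
    (mul_le_mul_of_nonneg_right h2 (Finset.sum_nonneg fun a _ => sq_nonneg (x a)))
  rw [quad_conj_symm hQ, quad_mul_self] at h5
  rw [quad_mul_self]
  -- Splitting `x` into its active and residual parts at the cost of a factor two removes the cross
  -- terms, so no hypothesis on the off-diagonal blocks of the ghost Gram matrix is needed.
  have h6 : ∀ i, (F.transpose.mulVec x) i ^ 2 ≤ 2 * (F.transpose.mulVec (P.mulVec x)) i ^ 2
      + 2 * (F.transpose.mulVec ((1 - P).mulVec x)) i ^ 2 := fun i => by
    have : (F.transpose.mulVec x) i = (F.transpose.mulVec (P.mulVec x)) i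
        + (F.transpose.mulVec ((1 - P).mulVec x)) i := by
      rw [← Pi.add_apply, ← Matrix.mulVec_add, ← Matrix.add_mulVec]
      simp
    rw [this]
    nlinarith [sq_nonneg ((F.transpose.mulVec (P.mulVec x)) i
        - (F.transpose.mulVec ((1 - P).mulVec x)) i)]
  have h7 := Finset.sum_le_sum fun i (_ : i ∈ (Finset.univ : Finset (Fin k))) => h6 i
  rw [Finset.sum_add_distrib, ← Finset.mul_sum, ← Finset.mul_sum] at h7
  linarith

end Spectral

/-! ### Approximation of one layer adapted to a Gram matrix. -/

lemma exists_four_pow {a : ℝ} (ha : 1 ≤ a) : ∃ b : ℕ, a ≤ 4 ^ b ∧ (4 : ℝ) ^ b ≤ 4 * a := by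
  obtain ⟨k, hk1, hk2⟩ := exists_nat_pow_near ha (by norm_num : (1 : ℝ) < 4)
  exact ⟨k + 1, hk2.le, by rw [pow_succ]; linarith⟩

lemma one_le_log_four : 1 ≤ Real.log 4 := by
  rw [show (4 : ℝ) = 2 ^ 2 by norm_num, Real.log_pow]
  have := Real.log_two_gt_d9
  push_cast
  linarith

lemma direction_cost_le {p q b : ℕ} (hq : 1 ≤ q) {a : ℝ} (ha : 1 ≤ a) (hb : (4 : ℝ) ^ b ≤ 4 * a) :
    ((b : ℝ) + 1) * Real.log 2 + q * (Real.log 3 + b * Real.log 2)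
      + p * (Real.log 8 + Real.log (1 + 4 ^ b) + 1) ≤ 5 * ((p : ℝ) + q) * Real.log (4 * a) := by
  set x := Real.log (4 * a)
  have h4 : Real.log 4 = 2 * Real.log 2 := by
    rw [show (4 : ℝ) = 2 ^ 2 by norm_num, Real.log_pow]; norm_num
  have hx : Real.log 4 ≤ x := Real.log_le_log (by norm_num) (by linarith)
  have hx1 : 1 ≤ x := one_le_log_four.trans hx
  have hbx : b * Real.log 4 ≤ x := by
    rw [← Real.log_pow]
    exact Real.log_le_log (by positivity) hb
  rw [h4] at hbx
  have h3 : Real.log 3 ≤ x := (Real.log_le_log (by norm_num) (by norm_num)).trans hx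
  have h8 : Real.log 8 = 3 * Real.log 2 := by
    rw [show (8 : ℝ) = 2 ^ 3 by norm_num, Real.log_pow]; norm_num
  have h1 : Real.log (1 + 4 ^ b) ≤ Real.log 2 + x := by
    rw [← Real.log_mul (by norm_num) (by positivity)]
    exact Real.log_le_log (by positivity) (by linarith)
  have hq' : (1 : ℝ) ≤ q := by exact_mod_cast hq
  have hp' : (0 : ℝ) ≤ p := Nat.cast_nonneg _
  have e1 : ((b : ℝ) + 1) * Real.log 2 ≤ x := by linarith
  have e2 : (q : ℝ) * (Real.log 3 + b * Real.log 2) ≤ q * (3 / 2 * x) :=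
    mul_le_mul_of_nonneg_left (by linarith) (by linarith)
  have e3 : (p : ℝ) * (Real.log 8 + Real.log (1 + 4 ^ b) + 1) ≤ p * (4 * x) :=
    mul_le_mul_of_nonneg_left (by linarith) hp'
  nlinarith

/-- Give the `k`-th leading eigendirection the resolution `4 ^ b k ≈ λ_k / θ`: its squared error
then weighs about `θ` in the quadratic form, like the directions left out. The constant `14` is `10`
from the coded directions plus `4` from the residual term. -/
lemma exists_layer_approx {p q J j : ℕ} (hq : 1 ≤ q) (hj : j ≤ J) {R : ℝ} (hR : 0 < R)
    (W : Matrix (Fin p) (Fin q) ℝ) (hW : frob W ≤ R / 2 ^ j)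
    {A : Matrix (Fin q) (Fin q) ℝ} (hA : A.IsHermitian) {θ : ℝ} (hθ : 0 < θ) {r : ℕ} (hr : r ≤ q)
    (hrθ : ∀ k : Fin q, (k : ℕ) < r ↔ θ ≤ lam A (k + 1)) :
    ∃ x : LayerCode p q J, frob (layerDecode R x) ≤ frob W ∧
      frob (W - layerDecode R x) ^ 2 ≤ 4 * (R / 2 ^ j) ^ 2 ∧
      ∑ i, (W i - layerDecode R x i) ⬝ᵥ A.mulVec (W i - layerDecode R x i)
        ≤ 14 * θ * (R / 2 ^ j) ^ 2 ∧
      layerCost x ≤ Real.log (J + 1) + Real.log (q + 1)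
        + 5 * ((p : ℝ) + q) * ∑ k : Fin r, Real.log (4 * (lam A (k + 1) / θ)) := by
  obtain ⟨U, hU, hUA⟩ := exists_topFrame hA hr (θ := θ)
    (fun k => (lt_or_ge (k : ℕ) r).imp id fun h =>
      (not_le.1 fun h' => not_lt.2 h ((hrθ k).2 h')).le) hθ.le
  have ha : ∀ k : Fin r, 1 ≤ lam A (k + 1) / θ := fun k => by
    rw [one_le_div hθ]
    exact (hrθ (Fin.castLE hr k)).1 k.2
  choose b hb1 hb2 using fun k : Fin r => exists_four_pow (ha k)
  obtain ⟨x, hx1, hx2, hx3⟩ := exists_layerCode hj hR W hW hr U hU b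
  set V := layerDecode R x
  set s := R / 2 ^ j
  have hW2 : frob W ^ 2 ≤ s ^ 2 := pow_le_pow_left₀ (frob_nonneg _) hW 2
  have hV2 : frob V ^ 2 ≤ s ^ 2 := pow_le_pow_left₀ (frob_nonneg _) (hx1.trans hW) 2
  have hΔ : frob (W - V) ^ 2 ≤ 4 * s ^ 2 := by
    rw [frob_sq] at *
    calc ∑ i, ∑ a, (W - V) i a ^ 2 ≤ ∑ i, ∑ a, (2 * W i a ^ 2 + 2 * V i a ^ 2) := by
          refine Finset.sum_le_sum fun i _ => Finset.sum_le_sum fun a _ => ?_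
          rw [Matrix.sub_apply]
          nlinarith [sq_nonneg (W i a + V i a)]
      _ ≤ 4 * s ^ 2 := by
          simp_rw [Finset.sum_add_distrib, ← Finset.mul_sum]
          linarith
  refine ⟨x, hx1, hΔ, ?_, hx3.trans ?_⟩
  · calc ∑ i, (W i - V i) ⬝ᵥ A.mulVec (W i - V i)
        ≤ ∑ i, (θ * ∑ k, (2 ^ b k * U.mulVec (W i - V i) k) ^ 2
            + θ * ∑ a, (W i - V i) a ^ 2) := by
          refine Finset.sum_le_sum fun i _ => (hUA _).trans ?_
          refine add_le_add_left ?_ _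
          rw [Finset.mul_sum]
          refine Finset.sum_le_sum fun k _ => ?_
          have h1 : lam A (k + 1) ≤ θ * 4 ^ b k := by
            rw [mul_comm]
            exact (div_le_iff₀ hθ).1 (hb1 k)
          have h2 : ((2 : ℝ) ^ b k) ^ 2 = 4 ^ b k := by
            rw [← pow_mul, mul_comm, pow_mul]; norm_num
          rw [mul_pow, h2, ← mul_assoc]
          exact mul_le_mul_of_nonneg_right h1 (sq_nonneg _)
      _ ≤ 14 * θ * s ^ 2 := by
          rw [Finset.sum_add_distrib, ← Finset.mul_sum, ← Finset.mul_sum]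
          rw [frob_sq] at hΔ
          have h3 := mul_le_mul_of_nonneg_left hx2 hθ.le
          have h4 := mul_le_mul_of_nonneg_left hΔ hθ.le
          simp only [Matrix.sub_apply] at h4
          simp only [Pi.sub_apply]
          linarith
  · rw [Finset.mul_sum]
    refine add_le_add_right (Finset.sum_le_sum fun k _ => ?_) _
    exact direction_cost_le hq (ha k) (hb2 k)

/-! ### Frobenius norm and quadratic forms. -/

section Frobenius
variable {m k : ℕ}

lemma frob_eq_norm (A : Matrix (Fin m) (Fin k) ℝ) :
    frob A = ‖(WithLp.toLp 2 fun e : Fin m × Fin k => A e.1 e.2 :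
      EuclideanSpace ℝ (Fin m × Fin k))‖ := by
  rw [EuclideanSpace.norm_eq, Fintype.sum_prod_type]
  simp [frob]

lemma frob_add_le (A B : Matrix (Fin m) (Fin k) ℝ) : frob (A + B) ≤ frob A + frob B := by
  simp only [frob_eq_norm]
  exact norm_add_le (WithLp.toLp 2 fun e : Fin m × Fin k => A e.1 e.2 :
    EuclideanSpace ℝ (Fin m × Fin k)) (WithLp.toLp 2 fun e => B e.1 e.2)

lemma frob_smul (c : ℝ) (A : Matrix (Fin m) (Fin k) ℝ) : frob (c • A) = |c| * frob A := by
  simp only [frob_eq_norm]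
  rw [← Real.norm_eq_abs, ← norm_smul]
  rfl

lemma frob_sub_comm (A B : Matrix (Fin m) (Fin k) ℝ) : frob (A - B) = frob (B - A) := by
  rw [← neg_sub, ← neg_one_smul ℝ, frob_smul]
  simp

lemma frob_sub_le (A B C : Matrix (Fin m) (Fin k) ℝ) :
    frob (A - C) ≤ frob (A - B) + frob (B - C) := by
  simpa using frob_add_le (A - B) (B - C)

lemma frob_mul_sq {p : ℕ} (D : Matrix (Fin p) (Fin m) ℝ) (F : Matrix (Fin m) (Fin k) ℝ) :
    frob (D * F) ^ 2 = ∑ i, D i ⬝ᵥ (F * F.transpose).mulVec (D i) := by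
  rw [frob_sq]
  refine Finset.sum_congr rfl fun i _ => ?_
  rw [quad_mul_self]
  refine Finset.sum_congr rfl fun j _ => ?_
  rw [Matrix.mul_apply, Matrix.mulVec, dotProduct]
  simp [mul_comm]

end Frobenius

/-! ### Propagation of layer errors to the output. -/

section Network
variable {L : ℕ} {d : ℕ → ℕ} {n : ℕ} {σ : Activations L d}

lemma feat_succ (W : Weights L d) (x : Vec (d 0)) (l : Fin L) :
    feat σ W x (l + 1) = σ l (WithLp.toLp 2 ((W l).mulVec (feat σ W x l).ofLp)) := by
  rw [feat, dif_pos l.2]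

lemma feat_congr {W W' : Weights L d} (x : Vec (d 0)) {j : ℕ}
    (h : ∀ i : Fin L, (i : ℕ) < j → W i = W' i) : feat σ W x j = feat σ W' x j := by
  induction j with
  | zero => rfl
  | succ j ih =>
    have ih' := ih fun i hi => h i (by omega)
    simp only [feat]
    split_ifs with hj
    · rw [ih', h ⟨j, hj⟩ (by simp)]
    · rfl

lemma hybrid_hybrid (i : ℕ) (W V : Weights L d) :
    hybrid (i + 1) W (hybrid i W V) = hybrid (i + 1) W V := by
  funext k
  unfold hybrid
  by_cases h : (k : ℕ) < i + 1
  · simp [h]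
  · simp [h, show ¬ (k : ℕ) < i by omega]

lemma hybrid_top (W V : Weights L d) : hybrid L W V = W := by
  funext k; simp [hybrid]

lemma hybrid_zero (W V : Weights L d) : hybrid 0 W V = V := by
  funext k; simp [hybrid]

lemma wNorm_le_of_forall {W V : Weights L d} (h : ∀ l, frob (V l) ≤ frob (W l)) :
    wNorm V ≤ wNorm W :=
  Real.sqrt_le_sqrt (Finset.sum_le_sum fun l _ => pow_le_pow_left₀ (frob_nonneg _) (h l) 2)

lemma wNorm_hybrid_le {W V : Weights L d} (h : ∀ l, frob (V l) ≤ frob (W l)) (i : ℕ) :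
    wNorm (hybrid i W V) ≤ wNorm W :=
  wNorm_le_of_forall fun l => by
    unfold hybrid
    split_ifs
    · exact le_rfl
    · exact h l

lemma frob_layer_le (hσ : ∀ l, LipschitzWith 1 (σ l)) (X : Fin n → Vec (d 0))
    (W V : Weights L d) (i : Fin L) :
    frob (featMat σ (hybrid i W V) X (i + 1) - featMat σ W X (i + 1))
      ≤ frob ((V i - W i) * featMat σ W X i) := by
  refine Real.sqrt_le_sqrt ?_
  rw [Finset.sum_comm, Finset.sum_comm (f := fun a b => ((V i - W i) * featMat σ W X i) a b ^ 2)]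
  refine Finset.sum_le_sum fun k _ => ?_
  have h1 : feat σ (hybrid i W V) (X k) i = feat σ W (X k) i :=
    feat_congr _ fun l hl => by simp [hybrid, hl]
  have h2 := (hσ i).dist_le_mul (WithLp.toLp 2 ((V i).mulVec (feat σ W (X k) i).ofLp))
    (WithLp.toLp 2 ((W i).mulVec (feat σ W (X k) i).ofLp))
  rw [NNReal.coe_one, one_mul, dist_eq_norm, dist_eq_norm] at h2
  have h3 := pow_le_pow_left₀ (norm_nonneg _) h2 2
  rw [EuclideanSpace.norm_sq_eq, EuclideanSpace.norm_sq_eq] at h3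
  have hVi : hybrid i W V i = V i := by simp [hybrid]
  convert h3 using 2 with a _ a _
  · rw [Matrix.sub_apply, featMat, featMat, Matrix.of_apply, Matrix.of_apply, feat_succ,
      feat_succ, h1, hVi]
    simp
  · rw [← WithLp.toLp_sub, ← Matrix.sub_mulVec]
    simp [Matrix.mul_apply, Matrix.mulVec, dotProduct, featMat]

/-- Telescoping of the output difference over the layers. -/
lemma frob_output_le (hσ : ∀ l, LipschitzWith 1 (σ l)) (X : Fin n → Vec (d 0))
    (W V : Weights L d) {M : Fin L → ℝ} (hM : ∀ l, 0 ≤ M l) {l : ℕ} (hl : l ≤ L)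
    (h : ∀ i : Fin L, l ≤ i → OuterLipAt σ X i W (hybrid i W V) (M i)) :
    frob (featMat σ W X L - featMat σ (hybrid l W V) X L)
      ≤ ∑ i, M i * frob ((V i - W i) * featMat σ W X i) := by
  have hnn : ∀ i, 0 ≤ M i * frob ((V i - W i) * featMat σ W X i) := fun i =>
    mul_nonneg (hM i) (frob_nonneg _)
  have key : ∀ k, l + k ≤ L → frob (featMat σ (hybrid (l + k) W V) X L
      - featMat σ (hybrid l W V) X L) ≤ ∑ i : Fin L, if l ≤ i ∧ (i : ℕ) < l + k then
        M i * frob ((V i - W i) * featMat σ W X i) else 0 := by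
    intro k
    induction k with
    | zero =>
      intro _
      rw [add_zero, sub_self]
      refine le_trans (le_of_eq (by simp [frob])) (Finset.sum_nonneg fun i _ => ?_)
      split_ifs
      exacts [hnn i, le_rfl]
    | succ k ih =>
      intro hk
      let i₀ : Fin L := ⟨l + k, by omega⟩
      have h1 := h i₀ (by simp [i₀])
      unfold OuterLipAt at h1
      -- Consecutive hybrids differ in one layer only. The outer Lipschitz estimate, applied with
      -- the lower hybrid as competitor, bounds exactly this link of the telescope.
      rw [hybrid_hybrid] at h1
      have h2 := h1.trans (mul_le_mul_of_nonneg_left (frob_layer_le hσ X W V i₀) (hM i₀))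
      rw [frob_sub_comm] at h2
      have h3 := (frob_sub_le _ _ _).trans (add_le_add h2 (ih (by omega)))
      refine h3.trans (le_of_eq ?_)
      rw [← Finset.sum_erase_add _ _ (Finset.mem_univ i₀),
        ← Finset.sum_erase_add (a := i₀) (f := fun i : Fin L =>
          if l ≤ (i : ℕ) ∧ (i : ℕ) < l + (k + 1) then
          M i * frob ((V i - W i) * featMat σ W X i) else 0) _ (Finset.mem_univ i₀),
        if_neg (by simp [i₀]), if_pos (by simp [i₀]), add_zero, add_comm]
      congr 1
      refine Finset.sum_congr rfl fun i hi => ?_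
      have hi' : (i : ℕ) ≠ l + k := fun h => (Finset.mem_erase.1 hi).1 (Fin.ext h)
      have : (l ≤ (i : ℕ) ∧ (i : ℕ) < l + k) ↔ (l ≤ (i : ℕ) ∧ (i : ℕ) < l + (k + 1)) := by omega
      simp only [this]
  have h4 := key (L - l) (by omega)
  rw [Nat.add_sub_cancel' hl, hybrid_top] at h4
  refine h4.trans (Finset.sum_le_sum fun i _ => ?_)
  split_ifs
  exacts [le_rfl, hnn i]

lemma continuous_feat_path (hσ : ∀ l, LipschitzWith 1 (σ l)) (H : ℝ → Weights L d)
    (hH : ∀ l, Continuous fun t => H t l) (x : Vec (d 0)) (j : ℕ) :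
    Continuous fun t => feat σ (H t) x j := by
  induction j with
  | zero => exact continuous_const
  | succ j ih =>
    by_cases hj : j < L
    · simp only [feat, dif_pos hj]
      refine (hσ ⟨j, hj⟩).continuous.comp ((PiLp.continuous_toLp 2 _).comp ?_)
      exact (hH ⟨j, hj⟩).matrix_mulVec ((PiLp.continuous_ofLp 2 _).comp ih)
    · simp only [feat, dif_neg hj]
      exact continuous_const

lemma empDist_eq (X : Fin n → Vec (d 0)) (W W' : Weights L d) :
    empDist σ X W W' = frob (featMat σ W X L - featMat σ W' X L) / Real.sqrt n := by
  rw [empDist, Real.sqrt_div (sq_nonneg _), Real.sqrt_sq (frob_nonneg _)]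

/-- Local Lipschitz estimates propagate along segments, without an a priori bound on the
distance of the end points. -/
lemma empDist_le_of_outerLip (hσ : ∀ l, LipschitzWith 1 (σ l)) (hn : 0 < n)
    (X X' : Fin n → Vec (d 0)) {W V : Weights L d} {R η : ℝ} (hη : 0 < η) (hW : wNorm W ≤ R)
    (hV : ∀ l, frob (V l) ≤ frob (W l)) {M : Fin L → ℝ} (hM : ∀ l, 0 ≤ M l)
    (hlip : ∀ l W', wNorm W' ≤ R → empDist σ X W W' ≤ η →
      OuterLipAt σ X l W W' (M l) ∧ OuterLipAt σ X' l W W' (M l))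
    (hsmall : ∑ i, M i * frob ((V i - W i) * featMat σ W X i) ≤ Real.sqrt n * (η / 2)) :
    empDist σ X W V ≤ η / 2 ∧
      Real.sqrt n * empDist σ X' W V ≤ ∑ i, M i * frob ((V i - W i) * featMat σ W X' i) := by
  have hsn : 0 < Real.sqrt n := Real.sqrt_pos.2 (by exact_mod_cast hn)
  let Vt : ℝ → Weights L d := fun t l => W l + t • (V l - W l)
  have hVt : ∀ t, 0 ≤ t → t ≤ 1 → ∀ l, frob (Vt t l) ≤ frob (W l) := by
    intro t h0 h1 l
    have : Vt t l = (1 - t) • W l + t • V l := by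
      simp only [Vt, smul_sub, sub_smul, one_smul]
      abel
    rw [this]
    refine (frob_add_le _ _).trans ?_
    rw [frob_smul, frob_smul, abs_of_nonneg h0, abs_of_nonneg (by linarith)]
    nlinarith [hV l]
  have hVt1 : Vt 1 = V := by funext l; simp [Vt]
  -- Induction on the number of top layers replaced. A hybrid that replaces more layers needs the
  -- estimates for all hybrids that replace fewer.
  have hstep : ∀ k, k ≤ L → ∀ t, 0 ≤ t → t ≤ 1 →
      empDist σ X W (hybrid (L - k) W (Vt t)) ≤ η / 2 := by
    intro k
    induction k using Nat.strong_induction_on with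
    | _ k ih =>
    intro hk t ht0 ht1
    set l := L - k with hl
    set g : ℝ → ℝ := fun t => empDist σ X W (hybrid l W (Vt t)) with hg
    -- This is the bootstrap: the only Lipschitz estimate not supplied by induction is the one for
    -- the current hybrid, and it needs just `g t ≤ η`. The conclusion is strictly stronger, so `g`
    -- takes no value in `(η / 2, η]`.
    have hself : ∀ t, 0 ≤ t → t ≤ 1 → g t ≤ η → g t ≤ η / 2 := by
      intro t ht0 ht1 hgt
      have h1 : ∀ i : Fin L, l ≤ i → OuterLipAt σ X i W (hybrid i W (Vt t)) (M i) := by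
        intro i hi
        refine (hlip i _ ((wNorm_hybrid_le (hVt t ht0 ht1) i).trans hW) ?_).1
        rcases eq_or_lt_of_le hi with hi | hi
        · rw [← hi]; exact hgt
        · have := ih (L - i) (by omega) (by omega) t ht0 ht1
          rw [Nat.sub_sub_self i.2.le] at this
          linarith
      have h2 := frob_output_le hσ X W (Vt t) hM (by omega) h1
      have h3 : ∑ i, M i * frob ((Vt t i - W i) * featMat σ W X i)
          ≤ ∑ i, M i * frob ((V i - W i) * featMat σ W X i) := by
        refine Finset.sum_le_sum fun i _ => mul_le_mul_of_nonneg_left ?_ (hM i)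
        have : Vt t i - W i = t • (V i - W i) := by simp [Vt]
        rw [this, Matrix.smul_mul, frob_smul, abs_of_nonneg ht0]
        exact mul_le_of_le_one_left (frob_nonneg _) ht1
      simp only [hg]
      rw [empDist_eq, div_le_iff₀ hsn, mul_comm]
      linarith
    have hcont : Continuous g := by
      simp only [hg, empDist, frob]
      have hf : ∀ a b, Continuous fun t => featMat σ (hybrid l W (Vt t)) X L a b := by
        intro a b
        have := continuous_feat_path hσ (fun t => hybrid l W (Vt t)) (fun i => by
          unfold hybrid
          split_ifs
          · exact continuous_const
          · simp only [Vt]; fun_prop) (X b) L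
        exact (PiLp.continuous_apply 2 _ a).comp this
      simp only [Matrix.sub_apply]
      refine Real.continuous_sqrt.comp (Continuous.div_const (Continuous.pow
        (Real.continuous_sqrt.comp ?_) 2) _)
      refine continuous_finsetSum _ fun a _ => continuous_finsetSum _ fun b _ => ?_
      exact (continuous_const.sub (hf a b)).pow 2
    have hg0 : g 0 = 0 := by
      have : hybrid l W (Vt 0) = W := by funext i; simp [hybrid, Vt]
      simp only [hg, this, empDist_eq, sub_self]
      simp [frob]
    by_contra hcon
    push Not at hcon
    have hivt := intermediate_value_Icc ht0 hcont.continuousOn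
    -- Starting from `g 0 = 0`, continuity would force a value in the forbidden gap; `3 / 4 * η`
    -- marks a point inside it.
    have hmin : min (g t) (3 / 4 * η) ∈ Set.Icc (g 0) (g t) := by
      refine ⟨?_, min_le_left _ _⟩
      rw [hg0]
      exact le_min (by linarith) (by linarith)
    obtain ⟨s, hs, hgs⟩ := hivt hmin
    have h1 : g s ≤ 3 / 4 * η := hgs ▸ min_le_right _ _
    have h2 := hself s hs.1 (hs.2.trans ht1) (by linarith)
    have h3 : η / 2 < min (g t) (3 / 4 * η) := lt_min hcon (by linarith)
    linarith
  have hall : ∀ i : Fin L, empDist σ X W (hybrid i W V) ≤ η / 2 := fun i => by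
    have := hstep (L - i) (by omega) 1 zero_le_one le_rfl
    rwa [Nat.sub_sub_self i.2.le, hVt1] at this
  constructor
  · have := hstep L le_rfl 1 zero_le_one le_rfl
    rwa [Nat.sub_self, hybrid_zero, hVt1] at this
  -- On the ghost inputs no distance has to be checked: the local condition is measured on the
  -- observed inputs alone, where all hybrids are already known to be close.
  · have h := frob_output_le hσ X' W V hM (Nat.zero_le L) fun i _ =>
      (hlip i _ ((wNorm_hybrid_le hV i).trans hW) ((hall i).trans (by linarith))).2
    rw [hybrid_zero] at h
    rw [empDist_eq, mul_div_cancel₀ _ hsn.ne']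
    exact h

end Network

/-! ### Self-normalized concentration on pairs of samples. -/

lemma Kraft.nonneg {I : Type*} {c : I → ℝ} (h : Kraft c) (i : I) : 0 ≤ c i := by
  have h1 := (ENNReal.le_tsum (f := fun i => ENNReal.ofReal (Real.exp (-c i))) i).trans h
  rw [ENNReal.ofReal_le_one, Real.exp_le_one_iff] at h1
  linarith

section Concentration
variable {Z : Type*} [MeasurableSpace Z] (P : Measure Z) [IsProbabilityMeasure P]

lemma integrable_exp_selfNormalized {Ω : Type*} [MeasurableSpace Ω] {ν : Measure Ω}
    [IsFiniteMeasure ν] {X : Ω → ℝ} (hX : Measurable X) (l : ℝ) :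
    Integrable (fun p => Real.exp (l * X p - l ^ 2 * X p ^ 2 / 2)) ν := by
  refine Integrable.of_bound (C := Real.exp (1 / 2)) (by fun_prop) (ae_of_all _ fun p => ?_)
  rw [Real.norm_eq_abs, Real.abs_exp, Real.exp_le_exp]
  nlinarith [sq_nonneg (l * X p - 1)]

/-- Averaging the integrand with its image under the swap of the two coordinates gives `exp (-y ^ 2
/ 2) * cosh y ≤ 1`. Symmetry replaces any bound on the range of `h`. -/
lemma integral_exp_symm_le {h : Z → ℝ} (hh : Measurable h) (l : ℝ) :
    ∫ p : Z × Z, Real.exp (l * (h p.2 - h p.1) - l ^ 2 * (h p.2 - h p.1) ^ 2 / 2) ∂(P.prod P)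
      ≤ 1 := by
  set F : Z × Z → ℝ := fun p =>
    Real.exp (l * (h p.2 - h p.1) - l ^ 2 * (h p.2 - h p.1) ^ 2 / 2) with hF
  have hX : Measurable fun p : Z × Z => h p.2 - h p.1 := by fun_prop
  have hint : Integrable F (P.prod P) := integrable_exp_selfNormalized hX l
  have hswap : ∫ p, F p.swap ∂(P.prod P) = ∫ p, F p ∂(P.prod P) := integral_prod_swap F
  have hint' : Integrable (fun p : Z × Z => F p.swap) (P.prod P) := hint.swap
  have h2 : ∫ p, (F p + F p.swap) ∂(P.prod P) ≤ ∫ _p, (2 : ℝ) ∂(P.prod P) := by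
    refine integral_mono (hint.add hint') (integrable_const _) fun p => ?_
    set y := l * (h p.2 - h p.1) with hy
    have e1 : F p = Real.exp (-(y ^ 2 / 2)) * Real.exp y := by
      rw [← Real.exp_add]
      exact congrArg Real.exp (by rw [hy]; ring)
    have e2 : F p.swap = Real.exp (-(y ^ 2 / 2)) * Real.exp (-y) := by
      rw [← Real.exp_add]
      exact congrArg Real.exp (by rw [hy]; simp only [Prod.fst_swap, Prod.snd_swap]; ring)
    have h3 := Real.cosh_le_exp_half_sq y
    rw [Real.cosh_eq] at h3
    have h4 : Real.exp (-(y ^ 2 / 2)) * Real.exp (y ^ 2 / 2) = 1 := by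
      rw [← Real.exp_add]; simp
    change F p + F p.swap ≤ 2
    rw [e1, e2, ← mul_add]
    nlinarith [Real.exp_pos (-(y ^ 2 / 2))]
  rw [integral_add hint hint', hswap] at h2
  simp only [integral_const, probReal_univ, smul_eq_mul, one_mul] at h2
  linarith

variable {n : ℕ}

/-- Markov's inequality for the product of the self-normalized exponentials. The empirical second
moment belongs to the event, so the scale `D` may later be certified from the data. -/
lemma measure_selfNormalized_le (hn : 0 < n) {h : Z → ℝ} (hh : Measurable h) {D u : ℝ}
    (hD : 0 < D) (hu : 0 ≤ u) :
    ((Measure.pi fun _ : Fin n => P).prod (Measure.pi fun _ : Fin n => P))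
      {p | ∑ i, (h (p.2 i) - h (p.1 i)) ^ 2 ≤ n * D ^ 2 ∧
        n * D * Real.sqrt (2 * u / n) < ∑ i, (h (p.2 i) - h (p.1 i))}
      ≤ ENNReal.ofReal (Real.exp (-u)) := by
  set μ := Measure.pi fun _ : Fin n => P
  have hn' : (0 : ℝ) < n := by exact_mod_cast hn
  -- This choice makes the linear term exceed `2 u` on the event and the quadratic correction at
  -- most `u`.
  set l := Real.sqrt (2 * u / n) / D with hl
  have hl0 : 0 ≤ l := by positivity
  have hlsq : l ^ 2 * (n * D ^ 2) = 2 * u := by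
    rw [hl, div_pow, Real.sq_sqrt (by positivity)]
    field_simp
  set G : (Fin n → Z) × (Fin n → Z) → ℝ := fun p =>
    ∏ i, Real.exp (l * (h (p.2 i) - h (p.1 i)) - l ^ 2 * (h (p.2 i) - h (p.1 i)) ^ 2 / 2) with hG
  have hmp := measurePreserving_arrowProdEquivProdArrow Z Z (Fin n) (fun _ => P) (fun _ => P)
  have hGint : ∫ p, G p ∂(μ.prod μ) ≤ 1 := by
    rw [← hmp.integral_comp']
    have := integral_fintype_prod_eq_prod (𝕜 := ℝ) (fun (_ : Fin n) (p : Z × Z) =>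
      Real.exp (l * (h p.2 - h p.1) - l ^ 2 * (h p.2 - h p.1) ^ 2 / 2))
      (μ := fun _ => P.prod P)
    refine (le_of_eq this).trans (Finset.prod_le_one (fun _ _ => integral_nonneg fun _ =>
      (Real.exp_pos _).le) fun _ _ => integral_exp_symm_le P hh l)
  have hGmeas : Measurable G := by fun_prop
  have hGi : Integrable G (μ.prod μ) := by
    refine Integrable.of_bound (C := Real.exp (1 / 2) ^ n) hGmeas.aestronglyMeasurable
      (ae_of_all _ fun p => ?_)
    rw [Real.norm_eq_abs, abs_of_nonneg (Finset.prod_nonneg fun _ _ => (Real.exp_pos _).le)]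
    calc G p ≤ ∏ _i : Fin n, Real.exp (1 / 2) := by
          refine Finset.prod_le_prod (fun _ _ => (Real.exp_pos _).le) fun i _ => ?_
          rw [Real.exp_le_exp]
          nlinarith [sq_nonneg (l * (h (p.2 i) - h (p.1 i)) - 1)]
      _ = _ := by simp
  have hM := mul_meas_ge_le_integral_of_nonneg (μ := μ.prod μ)
    (ae_of_all _ fun p => Finset.prod_nonneg fun _ _ => (Real.exp_pos _).le) hGi (Real.exp u)
  have hreal : (μ.prod μ).real {p | Real.exp u ≤ G p} ≤ Real.exp (-u) := by
    rw [Real.exp_neg, ← one_div, le_div_iff₀ (Real.exp_pos u), mul_comm]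
    exact hM.trans hGint
  refine (measure_mono fun p hp => ?_).trans
    ((ENNReal.le_ofReal_iff_toReal_le (measure_ne_top _ _) (Real.exp_pos _).le).2 hreal)
  obtain ⟨hp1, hp2⟩ := hp
  simp only [Set.mem_ofPred_eq, hG]
  rw [← Real.exp_sum, Real.exp_le_exp, Finset.sum_sub_distrib, ← Finset.mul_sum,
    ← Finset.sum_div, ← Finset.mul_sum]
  have h1 := mul_le_mul_of_nonneg_left hp2.le hl0
  have h2 : l * (n * D * Real.sqrt (2 * u / n)) = 2 * u := by
    have h4 : l * D = Real.sqrt (2 * u / n) := by rw [hl]; field_simp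
    rw [← h4, ← hlsq]
    ring
  have h3 := mul_le_mul_of_nonneg_left hp1 (sq_nonneg l)
  linarith

/-- The functions of a family, together with the zero function. -/
def withZero {I : Type*} (g : I → Z → ℝ) (o : Option I) : Z → ℝ := o.elim (fun _ => 0) g

/-- Code lengths of a family, together with the zero function. -/
noncomputable def withZeroCost {I : Type*} (c : I → ℝ) (o : Option I) : ℝ :=
  o.elim (Real.log 2) fun i => c i + Real.log 2

/-- The pairs of samples for which some link of the chain has a large increment. -/
def badPairs {I : Type*} (n : ℕ) (g : I → Z → ℝ) (c : I → ℝ) (t : ℝ) :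
    Set ((Fin n → Z) × (Fin n → Z)) :=
  ⋃ a : ℕ × Option I × Option I, {p |
    ∑ i, ((withZero g a.2.1 - withZero g a.2.2) (p.2 i)
        - (withZero g a.2.1 - withZero g a.2.2) (p.1 i)) ^ 2 ≤ n * (8 / 2 ^ a.1) ^ 2 ∧
      n * (8 / 2 ^ a.1) * Real.sqrt (2 * ((((a.1 : ℝ) + 1) * Real.log 2 +
        (withZeroCost c a.2.1 + withZeroCost c a.2.2)) + t) / n)
        < ∑ i, ((withZero g a.2.1 - withZero g a.2.2) (p.2 i)
          - (withZero g a.2.1 - withZero g a.2.2) (p.1 i))}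

lemma measurable_withZero {I : Type*} {g : I → Z → ℝ} (hg : ∀ i, Measurable (g i))
    (o : Option I) : Measurable (withZero g o) := by
  cases o with
  | none => exact measurable_const
  | some i => exact hg i

lemma measurableSet_badPairs {I : Type*} [Countable I] {g : I → Z → ℝ}
    (hg : ∀ i, Measurable (g i)) (c : I → ℝ) (t : ℝ) : MeasurableSet (badPairs n g c t) := by
  refine MeasurableSet.iUnion fun a => ?_
  have h : Measurable (withZero g a.2.1 - withZero g a.2.2) :=
    (measurable_withZero hg _).sub (measurable_withZero hg _)
  have hi : ∀ i, Measurable fun p : (Fin n → Z) × (Fin n → Z) =>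
      (withZero g a.2.1 - withZero g a.2.2) (p.2 i)
        - (withZero g a.2.1 - withZero g a.2.2) (p.1 i) := fun i =>
    (h.comp ((measurable_pi_apply i).comp measurable_snd)).sub
      (h.comp ((measurable_pi_apply i).comp measurable_fst))
  refine MeasurableSet.inter ?_ ?_
  · exact measurableSet_le (Finset.measurable_sum _ fun i _ => (hi i).pow_const 2) measurable_const
  · exact measurableSet_lt measurable_const (Finset.measurable_sum _ fun i _ => hi i)

/-- Union bound over the level and both end points of a link: the joint code length in the deviation
threshold is exactly what makes the sum at most one. -/
lemma measure_badPairs_le (hn : 0 < n) {I : Type*} [Countable I] {g : I → Z → ℝ}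
    (hg : ∀ i, Measurable (g i)) {c : I → ℝ} (hc : Kraft c) {t : ℝ} (ht : 0 ≤ t) :
    ((Measure.pi fun _ : Fin n => P).prod (Measure.pi fun _ : Fin n => P)) (badPairs n g c t)
      ≤ ENNReal.ofReal (Real.exp (-t)) := by
  have hK : Kraft fun a : ℕ × Option I × Option I => ((a.1 : ℝ) + 1) * Real.log 2 +
      (withZeroCost c a.2.1 + withZeroCost c a.2.2) :=
    kraft_geometric.prod ((hc.option).prod hc.option)
  refine (measure_iUnion_le _).trans ?_
  calc _ ≤ ∑' a : ℕ × Option I × Option I, ENNReal.ofReal (Real.exp (-(((a.1 : ℝ) + 1) * Real.log 2 +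
        (withZeroCost c a.2.1 + withZeroCost c a.2.2)))) * ENNReal.ofReal (Real.exp (-t)) := by
        refine ENNReal.tsum_le_tsum fun a => ?_
        rw [← ENNReal.ofReal_mul (Real.exp_pos _).le, ← Real.exp_add, ← neg_add]
        exact measure_selfNormalized_le P hn
          ((measurable_withZero hg _).sub (measurable_withZero hg _)) (by positivity)
          (add_nonneg (hK.nonneg a) ht)
    _ ≤ _ := by
        rw [ENNReal.tsum_mul_right]
        exact mul_le_of_le_one_left' hK

/-- Chebyshev's inequality for the mean of a `[0, 1]`-valued function. -/
lemma measure_mean_lt_le (hn : 0 < n) {f : Z → ℝ} (hf : Measurable f)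
    (hf01 : ∀ z, f z ∈ Set.Icc (0 : ℝ) 1) :
    (Measure.pi fun _ : Fin n => P)
      {S | (1 / (n : ℝ)) * ∑ i, f (S i) + 1 / Real.sqrt n ≤ ∫ z, f z ∂P} ≤ ENNReal.ofReal (1 / 4) := by
  set μ := Measure.pi fun _ : Fin n => P
  have hn' : (0 : ℝ) < n := by exact_mod_cast hn
  have hmem : MemLp f 2 P := MemLp.of_bound hf.aestronglyMeasurable 1 (ae_of_all _ fun z => by
    rw [Real.norm_eq_abs, abs_of_nonneg (hf01 z).1]; exact (hf01 z).2)
  have hint : Integrable f P := hmem.integrable (by norm_num)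
  set X : (Fin n → Z) → ℝ := ∑ i : Fin n, fun S : Fin n → Z => f (S i) with hX
  have hcomp : ∀ i : Fin n, MemLp (fun S : Fin n → Z => f (S i)) 2 μ := fun i =>
    hmem.comp_measurePreserving (measurePreserving_eval (fun _ : Fin n => P) i)
  have hXm : MemLp X 2 μ := memLp_finsetSum' _ fun i _ => hcomp i
  have hvar : ProbabilityTheory.variance X μ ≤ n / 4 := by
    rw [hX, ProbabilityTheory.variance_sum_pi (X := fun _ => f) fun _ => hmem]
    have := ProbabilityTheory.variance_le_sq_of_bounded (μ := P) (ae_of_all _ hf01) hf.aemeasurable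
    calc _ ≤ ∑ _i : Fin n, (((1 : ℝ) - 0) / 2) ^ 2 := Finset.sum_le_sum fun i _ => this
      _ = n / 4 := by simp; ring
  have hmean : ∫ S, X S ∂μ = n * ∫ z, f z ∂P := by
    simp only [hX, Finset.sum_apply]
    rw [integral_finsetSum _ fun i _ => (hcomp i).integrable (by norm_num)]
    have : ∀ i : Fin n, ∫ S : Fin n → Z, f (S i) ∂μ = ∫ z, f z ∂P := fun i =>
      integral_comp_eval (μ := fun _ : Fin n => P) hf.aestronglyMeasurable
    simp [this]
  have hc := ProbabilityTheory.meas_ge_le_variance_div_sq hXm (Real.sqrt_pos.2 hn')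
  refine (measure_mono fun S hS => ?_).trans (hc.trans (ENNReal.ofReal_le_ofReal ?_))
  · simp only [Set.mem_ofPred_eq] at hS ⊢
    rw [hmean]
    have h1 := mul_le_mul_of_nonneg_left hS hn'.le
    have h2 : (n : ℝ) * ((1 / (n : ℝ)) * ∑ i, f (S i) + 1 / Real.sqrt n)
        = ∑ i, f (S i) + Real.sqrt n := by
      have : Real.sqrt n * Real.sqrt n = n := Real.mul_self_sqrt hn'.le
      have hs : Real.sqrt n ≠ 0 := (Real.sqrt_pos.2 hn').ne'
      field_simp
      linarith [this, Real.sq_sqrt hn'.le]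
    rw [h2] at h1
    rw [abs_sub_comm]
    refine le_trans ?_ (le_abs_self _)
    simp only [hX, Finset.sum_apply]
    linarith
  · rw [Real.sq_sqrt hn'.le, div_le_iff₀ hn']
    linarith

end Concentration

/-! ### The Riemannian Dimension relative to the spectral resolution. -/

section Dimension
variable {L : ℕ} {d : ℕ → ℕ} {n : ℕ} {σ : Activations L d} {M : Fin L → Weights L d → ℝ → ℝ}

lemma radius_pos {C₂ R : ℝ} (hC : 0 < C₂) (hR : 0 < R) (W : Weights L d) :
    0 < radius C₂ R n W :=
  mul_pos hC (lt_max_of_lt_right (by positivity))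

lemma radius_sq {C₂ R : ℝ} (hR : 0 < R) (W : Weights L d) :
    radius C₂ R n W ^ 2 = C₂ ^ 2 * max (wNorm W ^ 2) (R ^ 2 / 4 ^ n) := by
  have h0 : 0 ≤ wNorm W := Real.sqrt_nonneg _
  have h1 : 0 ≤ R / 2 ^ n := by positivity
  have h4 : (4 : ℝ) ^ n = (2 ^ n) ^ 2 := by rw [← pow_mul, mul_comm, pow_mul]; norm_num
  rw [radius, mul_pow, h4, ← div_pow]
  congr 1
  rcases le_total (wNorm W) (R / 2 ^ n) with h | h
  · rw [max_eq_right h, max_eq_right (pow_le_pow_left₀ h0 h 2)]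
  · rw [max_eq_left h, max_eq_left (pow_le_pow_left₀ h1 h 2)]

lemma resolution_pos {C₂ R : ℝ} (hC : 0 < C₂) (hR : 0 < R) (hn : 0 < n) {W : Weights L d} {η : ℝ}
    (hη : 0 < η) {l : Fin L} (hM : 0 < M l W η) : 0 < resolution n M C₂ R W η l := by
  have hL : (0 : ℝ) < L := by exact_mod_cast l.pos
  have hn' : (0 : ℝ) < n := by exact_mod_cast hn
  have := radius_pos (n := n) hC hR W
  unfold resolution
  positivity

lemma lt_layerRank_iff {C₂ R : ℝ} (hC : 0 < C₂) (hR : 0 < R) (X : Fin n → Vec (d 0))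
    {W : Weights L d} {η : ℝ} {l : Fin L} (hM : 0 < M l W η) (k : Fin (d l)) :
    (k : ℕ) < layerRank σ M C₂ R X W η l ↔
      resolution n M C₂ R W η l ≤ lam (gram σ W X l) (k + 1) := by
  have hL : (0 : ℝ) < L := by exact_mod_cast l.pos
  have hc : 0 ≤ (L : ℝ) * M l W η ^ 2 := by positivity
  have hA := gram_isHermitian σ W X l
  have hcA : (((L : ℝ) * M l W η ^ 2) • gram σ W X l).IsHermitian := by
    unfold Matrix.IsHermitian
    rw [Matrix.conjTranspose_smul, hA.eq, star_trivial]
  have hρ := radius_pos (n := n) hC hR W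
  unfold layerRank
  rw [lt_rEff_iff hcA, lam_smul hA hc, resolution, div_le_iff₀ two_pos, div_le_iff₀ (by positivity)]
  constructor <;> intro h <;> linarith

lemma sum_Icc_one_eq (r : ℕ) (f : ℕ → ℝ) :
    ∑ k ∈ Finset.Icc 1 r, f k = ∑ k : Fin r, f (k + 1) := by
  rw [Fin.sum_univ_eq_sum_range (fun k => f (k + 1)), Finset.range_eq_Ico,
    Finset.sum_Ico_add' f 0 r 1]
  rfl

/-- The Riemannian Dimension in terms of the eigenvalues relative to the resolution. -/
lemma riemDim_eq {C₂ R : ℝ} (hC : 0 < C₂) (hR : 0 < R) (hn : 0 < n) (X : Fin n → Vec (d 0))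
    {W : Weights L d} {η : ℝ} (hη : 0 < η) (hM : ∀ l, 0 < M l W η) :
    riemDim σ M C₂ R X W η = 1 / 2 * ∑ l : Fin L, (((d (l + 1) : ℝ) + d l) *
      (∑ k : Fin (layerRank σ M C₂ R X W η l),
        Real.log (4 * (lam (gram σ W X l) (k + 1) / resolution n M C₂ R W η l)))
      + Real.log ((d l : ℝ) * n)) := by
  unfold riemDim
  congr 1
  refine Finset.sum_congr rfl fun l _ => ?_
  rw [sum_Icc_one_eq]
  have hL : (0 : ℝ) < L := by exact_mod_cast l.pos
  have hn' : (0 : ℝ) < n := by exact_mod_cast hn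
  have hmax : 0 < max (wNorm W ^ 2) (R ^ 2 / 4 ^ n) := lt_max_of_lt_right (by positivity)
  have hk : ∀ k : Fin (layerRank σ M C₂ R X W η l),
      Real.log (4 * (lam (gram σ W X l) (k + 1) / resolution n M C₂ R W η l))
        = Real.log (8 * C₂ ^ 2 * lam (gram σ W X l) (k + 1) / (n * η ^ 2))
          + Real.log (M l W η ^ 2 * L * max (wNorm W ^ 2) (R ^ 2 / 4 ^ n)) := fun k => by
    have h1 : resolution n M C₂ R W η l ≤ lam (gram σ W X l) (k + 1) :=
      (lt_layerRank_iff hC hR X (hM l)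
        (Fin.castLE (rEff_le _ _ _ _) k)).1 k.2
    have h2 := (resolution_pos hC hR hn hη (hM l)).trans_le h1
    have hMl := hM l
    rw [← Real.log_mul (by positivity) (by positivity), resolution, radius_sq hR]
    congr 1
    field_simp
    ring
  simp_rw [hk]
  rw [Finset.sum_add_distrib, Finset.sum_const, Finset.card_univ, Fintype.card_fin, nsmul_eq_mul]
  ring

lemma log_ratio_nonneg {C₂ R : ℝ} (hC : 0 < C₂) (hR : 0 < R) (hn : 0 < n) (X : Fin n → Vec (d 0))
    {W : Weights L d} {η : ℝ} (hη : 0 < η) {l : Fin L} (hM : 0 < M l W η)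
    (k : Fin (layerRank σ M C₂ R X W η l)) :
    0 ≤ Real.log (4 * (lam (gram σ W X l) (k + 1) / resolution n M C₂ R W η l)) := by
  have h1 : resolution n M C₂ R W η l ≤ lam (gram σ W X l) (k + 1) :=
    (lt_layerRank_iff hC hR X hM (Fin.castLE (rEff_le _ _ _ _) k)).1 k.2
  have h2 := (one_le_div (resolution_pos hC hR hn hη hM)).2 h1
  exact Real.log_nonneg (by linarith)

lemma log_two_le_log_mul {q n : ℕ} (hq : 1 ≤ q) (hn : 2 ≤ n) :
    Real.log 2 ≤ Real.log ((q : ℝ) * n) := by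
  refine Real.log_le_log two_pos ?_
  exact_mod_cast (by nlinarith : 2 ≤ q * n)

/-- The terms `log (d n) ≥ log 2` alone suffice. This bound excludes degenerate zero integrals in
the chaining and settles very deep networks. -/
lemma le_riemDim {C₂ R : ℝ} (hC : 0 < C₂) (hR : 0 < R) (hn : 2 ≤ n) (hd : ∀ l, l ≤ L → 1 ≤ d l)
    (X : Fin n → Vec (d 0)) {W : Weights L d} {η : ℝ} (hη : 0 < η) (hM : ∀ l, 0 < M l W η) :
    (L : ℝ) / 4 ≤ riemDim σ M C₂ R X W η := by
  rw [riemDim_eq hC hR (by omega) X hη hM]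
  have : ∑ _l : Fin L, (1 / 2 : ℝ) ≤ ∑ l : Fin L, (((d (l + 1) : ℝ) + d l) *
      (∑ k : Fin (layerRank σ M C₂ R X W η l),
        Real.log (4 * (lam (gram σ W X l) (k + 1) / resolution n M C₂ R W η l)))
      + Real.log ((d l : ℝ) * n)) := by
    refine Finset.sum_le_sum fun l _ => ?_
    have h1 := log_two_le_log_mul (hd l l.2.le) hn
    have h2 : 0 ≤ ((d (l + 1) : ℝ) + d l) * (∑ k : Fin (layerRank σ M C₂ R X W η l),
        Real.log (4 * (lam (gram σ W X l) (k + 1) / resolution n M C₂ R W η l))) :=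
      mul_nonneg (by positivity) (Finset.sum_nonneg fun k _ =>
        log_ratio_nonneg hC hR (by omega) X hη (hM l) k)
    have := Real.log_two_gt_d9
    linarith
  simp only [Finset.sum_const, Finset.card_univ, Fintype.card_fin, nsmul_eq_mul] at this
  linarith

end Dimension

/-! ### Codes of weight tuples and their errors. -/

/-- Each layer is resolved relative to its own norm, so the squared scales add up to a multiple of
`‖W‖ ^ 2`; the floor `R / 2 ^ J` handles nearly vanishing layers with finitely many scales. -/
lemma exists_dyadic_scale (J : ℕ) {w R : ℝ} (hwR : w ≤ R) (hR : 0 < R) :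
    ∃ j ≤ J, w ≤ R / 2 ^ j ∧ (R / 2 ^ j) ^ 2 ≤ 4 * w ^ 2 + (R / 2 ^ J) ^ 2 := by
  rcases le_or_gt w (R / 2 ^ J) with h | h
  · exact ⟨J, le_rfl, h, by nlinarith⟩
  · have hw0 : 0 < w := lt_of_le_of_lt (by positivity) h
    obtain ⟨j, hj1, hj2⟩ := exists_nat_pow_near ((one_le_div hw0).2 hwR) one_lt_two
    have h1 : w ≤ R / 2 ^ j := by
      rw [le_div_iff₀ (by positivity)]
      rw [le_div_iff₀ hw0] at hj1
      linarith
    have h2 : R / 2 ^ j ≤ 2 * w := by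
      rw [div_lt_iff₀ hw0, pow_succ] at hj2
      rw [div_le_iff₀ (by positivity)]
      linarith
    refine ⟨j, ?_, h1, ?_⟩
    · by_contra hcon
      have h3 : (2 : ℝ) ^ J ≤ 2 ^ j := pow_le_pow_right₀ one_le_two (by omega)
      have h4 : R / 2 ^ j ≤ R / 2 ^ J := by gcongr
      linarith
    · have := pow_le_pow_left₀ (by positivity) h2 2
      nlinarith [sq_nonneg (R / 2 ^ J)]

/-- Codes of weight tuples. -/
abbrev NetCode (L : ℕ) (d : ℕ → ℕ) (J : ℕ) : Type :=
  ∀ l : Fin L, LayerCode (d (l + 1)) (d l) J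

/-- The weight tuple with a given code. -/
noncomputable def netDecode {L : ℕ} {d : ℕ → ℕ} {J : ℕ} (R : ℝ) (x : NetCode L d J) :
    Weights L d := fun l => layerDecode R (x l)

/-- Code length of a weight tuple. -/
noncomputable def netCost {L : ℕ} {d : ℕ → ℕ} {J : ℕ} (x : NetCode L d J) : ℝ :=
  ∑ l, layerCost (x l)

lemma kraft_netCost (L : ℕ) (d : ℕ → ℕ) (J : ℕ) : Kraft (netCost (L := L) (d := d) (J := J)) :=
  Kraft.pi fun l => kraft_layerCost (d (l + 1)) (d l) J

section Coding
variable {L : ℕ} {d : ℕ → ℕ} {n : ℕ} {σ : Activations L d} {M : Fin L → Weights L d → ℝ → ℝ}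

/-- Cauchy–Schwarz over the layers; this is the source of the factor `L` in the effective rank and
the resolution. -/
lemma sum_mul_le_of_sq {a : Fin L → ℝ} {B : ℝ} (hB : 0 ≤ B)
    (h : ∑ l, (L : ℝ) * a l ^ 2 ≤ B ^ 2) : ∑ l, a l ≤ B := by
  refine abs_le_of_sq_le_sq' ?_ hB |>.2
  have := sq_sum_le_card_mul_sum_sq (s := (Finset.univ : Finset (Fin L))) (f := a)
  rw [Finset.card_univ, Fintype.card_fin, Finset.mul_sum] at this
  exact this.trans h

lemma log_overhead_le {q : ℕ} (hq : 1 ≤ q) (hn : 2 ≤ n) :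
    Real.log ((5 * n : ℕ) + 1) + Real.log (q + 1) ≤ 5 * Real.log ((q : ℝ) * n) := by
  have hq' : (1 : ℝ) ≤ q := by exact_mod_cast hq
  have hn' : (2 : ℝ) ≤ n := by exact_mod_cast hn
  rw [← Real.log_mul (by positivity) (by positivity)]
  have h := log_two_le_log_mul hq hn
  have h16 : Real.log 16 = 4 * Real.log 2 := by
    rw [show (16 : ℝ) = 2 ^ 4 by norm_num, Real.log_pow]; norm_num
  have : Real.log ((((5 * n : ℕ) : ℝ) + 1) * (q + 1)) ≤ Real.log (16 * (q * n)) := by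
    refine Real.log_le_log (by positivity) ?_
    push_cast
    nlinarith
  rw [Real.log_mul (x := 16) (by norm_num) (by positivity)] at this
  linarith

/-- Every weight tuple has an approximation whose code length is controlled by the observed
Riemannian Dimension, and whose error is small on the observed inputs and on all ghost inputs
that are subspace isomorphic to them. -/
lemma exists_netCode {R : ℝ} (hR : 0 < R) (hn : 2 ≤ n) (hL : L ≤ 4 * n)
    (hd : ∀ l, l ≤ L → 1 ≤ d l) (X : Fin n → Vec (d 0)) {W : Weights L d} (hW : wNorm W ≤ R)
    {η : ℝ} (hη : 0 < η) (hM : ∀ l, 0 < M l W η) :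
    ∃ x : NetCode L d (5 * n), (∀ l, frob (netDecode R x l) ≤ frob (W l)) ∧
      netCost x ≤ 10 * riemDim σ M 12 R X W η ∧
      ∑ l, M l W η * frob ((netDecode R x l - W l) * featMat σ W X l) ≤ Real.sqrt n * (η / 2) ∧
      ∀ (X' : Fin n → Vec (d 0)) (K κ b : ℝ), 1 ≤ κ → κ ≤ K → 0 ≤ b → b ≤ K →
        (∀ j : Fin L, (κ • (activeProj σ M 12 R X W η j * gram σ W X j * activeProj σ M 12 R X W η j)
            - activeProj σ M 12 R X W η j * gram σ W X' j * activeProj σ M 12 R X W η j).PosSemidef ∧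
          opNorm ((1 - activeProj σ M 12 R X W η j) * gram σ W X' j
            * (1 - activeProj σ M 12 R X W η j)) ≤ b * resolution n M 12 R W η j) →
        ∑ l, M l W η * frob ((netDecode R x l - W l) * featMat σ W X' l)
          ≤ Real.sqrt n * (K * η) := by
  have hn' : (0 : ℝ) < n := by exact_mod_cast (by omega : 0 < n)
  have h12 : (0 : ℝ) < 12 := by norm_num
  set ρ := radius 12 R n W with hρ_def
  have hρ : 0 < ρ := radius_pos h12 hR W
  have hWl : ∀ l, frob (W l) ≤ R := fun l => by
    refine le_trans ?_ hW
    refine Real.le_sqrt_of_sq_le ?_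
    exact Finset.single_le_sum (f := fun l => frob (W l) ^ 2) (fun _ _ => sq_nonneg _)
      (Finset.mem_univ l)
  choose j hj1 hj2 hj3 using fun l => exists_dyadic_scale (5 * n) (hWl l) hR
  set s : Fin L → ℝ := fun l => R / 2 ^ j l with hs_def
  -- The depth bound `L ≤ 4 n` enters here: with `5 n` dyadic scales the floors of all layers sum to
  -- at most `R ^ 2 / 4 ^ n`. The resulting factor is `5 / C₂ ^ 2` with `C₂ = 12`.
  have hs : ∑ l, s l ^ 2 ≤ 5 / 144 * ρ ^ 2 := by
    have h1 : ∑ l, s l ^ 2 ≤ ∑ l, (4 * frob (W l) ^ 2 + (R / 2 ^ (5 * n)) ^ 2) :=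
      Finset.sum_le_sum fun l _ => hj3 l
    rw [Finset.sum_add_distrib, ← Finset.mul_sum, Finset.sum_const, Finset.card_univ,
      Fintype.card_fin, nsmul_eq_mul] at h1
    have h2 : ∑ l, frob (W l) ^ 2 = wNorm W ^ 2 :=
      (Real.sq_sqrt (Finset.sum_nonneg fun _ _ => sq_nonneg _)).symm
    have h3 : (L : ℝ) * (R / 2 ^ (5 * n)) ^ 2 ≤ R ^ 2 / 4 ^ n := by
      have h4 : ((2 : ℝ) ^ (5 * n)) ^ 2 = 4 ^ n * 4 ^ (4 * n) := by
        rw [← pow_add, ← pow_mul, show 5 * n * 2 = 2 * (n + 4 * n) by ring, pow_mul]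
        norm_num
      have h5 : (L : ℝ) ≤ 4 ^ (4 * n) := by
        have : L < 4 ^ (4 * n) := hL.trans_lt (Nat.lt_pow_self (by norm_num))
        exact_mod_cast this.le
      rw [div_pow, h4, mul_div_assoc', div_le_div_iff₀ (by positivity) (by positivity)]
      have h6 : 0 ≤ R ^ 2 * 4 ^ n := by positivity
      nlinarith [mul_le_mul_of_nonneg_left h5 h6]
    have h7 : ρ ^ 2 = 12 ^ 2 * max (wNorm W ^ 2) (R ^ 2 / 4 ^ n) := radius_sq hR W
    have h8 := le_max_left (wNorm W ^ 2) (R ^ 2 / 4 ^ n)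
    have h9 := le_max_right (wNorm W ^ 2) (R ^ 2 / 4 ^ n)
    rw [h2] at h1
    linarith
  set θ : Fin L → ℝ := resolution n M 12 R W η with hθ_def
  have hθ : ∀ l, 0 < θ l := fun l => resolution_pos h12 hR (by omega) hη (hM l)
  have hθM : ∀ l : Fin L, (L : ℝ) * M l W η ^ 2 * θ l = n * η ^ 2 / (2 * ρ ^ 2) := fun l => by
    have hL' : (0 : ℝ) < L := by exact_mod_cast l.pos
    have := hM l
    simp only [hθ_def, resolution]
    rw [← hρ_def]
    field_simp
  choose x hx1 hx2 hx3 hx4 using fun l : Fin L =>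
    exists_layer_approx (hd l l.2.le) (hj1 l) hR (W l) (hj2 l) (gram_isHermitian σ W X l) (hθ l)
      (r := layerRank σ M 12 R X W η l) (rEff_le _ _ _ _)
      (fun k => lt_layerRank_iff h12 hR X (hM l) k)
  have hneg : ∀ (Y : Fin n → Vec (d 0)) l, frob ((netDecode R x l - W l) * featMat σ W Y l) ^ 2
      = ∑ i, (W l i - layerDecode R (x l) i) ⬝ᵥ
        (gram σ W Y l).mulVec (W l i - layerDecode R (x l) i) := fun Y l => by
    rw [← neg_sub, ← neg_one_smul ℝ, Matrix.smul_mul, frob_smul, mul_pow, frob_mul_sq]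
    simp only [abs_neg, abs_one, one_pow, one_mul]
    rfl
  -- The resolution is calibrated so that `L M ^ 2 θ` is the same for all layers. An error `c θ s ^
  -- 2` per layer then totals `5 c / 288` times `n η ^ 2`. For `c = 14` this is below `1 / 4`, which
  -- is what `C₂ = 12` achieves.
  have htot : ∀ (Y : Fin n → Vec (d 0)) (c B : ℝ), 0 ≤ B → 0 ≤ c →
      5 / 288 * c * (n * η ^ 2) ≤ B ^ 2 →
      (∀ l, frob ((netDecode R x l - W l) * featMat σ W Y l) ^ 2 ≤ c * θ l * s l ^ 2) →
      ∑ l, M l W η * frob ((netDecode R x l - W l) * featMat σ W Y l) ≤ B := by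
    intro Y c B hB hc hcB h
    refine sum_mul_le_of_sq hB (le_trans ?_ hcB)
    calc _ ≤ ∑ l, c * (n * η ^ 2 / (2 * ρ ^ 2)) * s l ^ 2 := by
          refine Finset.sum_le_sum fun l _ => ?_
          rw [← hθM l, mul_pow]
          have := mul_le_mul_of_nonneg_left (h l)
            (show 0 ≤ (L : ℝ) * M l W η ^ 2 by positivity)
          linarith
      _ ≤ c * (n * η ^ 2 / (2 * ρ ^ 2)) * (5 / 144 * ρ ^ 2) := by
          rw [← Finset.mul_sum]
          exact mul_le_mul_of_nonneg_left hs (by positivity)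
      _ = _ := by field_simp; ring
  refine ⟨x, hx1, ?_, ?_, ?_⟩
  · rw [riemDim_eq h12 hR (by omega) X hη hM, ← mul_assoc, Finset.mul_sum]
    refine Finset.sum_le_sum fun l _ => (hx4 l).trans ?_
    have := log_overhead_le (hd l l.2.le) hn
    simp only [hθ_def]
    linarith
  · refine htot X 14 _ (by positivity) (by norm_num) ?_ fun l => ?_
    · rw [mul_pow, Real.sq_sqrt hn'.le]
      have : 0 ≤ n * η ^ 2 := by positivity
      linarith
    · rw [hneg]
      exact hx3 l
  · intro X' K κ b hκ hκK hb hbK hiso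
    have hK : 1 ≤ K := hκ.trans hκK
    -- Here `36 = 2 * 14 + 2 * 4`: the observed quadratic error enters with factor `2 κ`, the total
    -- Frobenius error with `2 b θ`.
    refine htot X' (36 * K) _ (by positivity) (by positivity) ?_ fun l => ?_
    · rw [mul_pow, Real.sq_sqrt hn'.le, mul_pow]
      have h1 : 0 ≤ n * η ^ 2 := by positivity
      nlinarith [mul_nonneg h1 (by linarith : 0 ≤ K),
        mul_le_mul_of_nonneg_left hK (mul_nonneg h1 (by linarith : 0 ≤ K))]
    · rw [hneg]
      have hpos : ∀ y, 0 ≤ y ⬝ᵥ (gram σ W X l).mulVec y := fun y => by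
        rw [gram, quad_mul_self]
        exact Finset.sum_nonneg fun _ _ => sq_nonneg _
      have h1 := fun i => quad_ghost_le (gram_isHermitian σ W X l) hpos (featMat σ W X' l)
        (by linarith : 0 ≤ κ) (hiso l).1 (hiso l).2 (W l i - layerDecode R (x l) i)
      have h2 := Finset.sum_le_sum fun i (_ : i ∈ Finset.univ) => h1 i
      rw [Finset.sum_add_distrib, ← Finset.mul_sum, ← Finset.mul_sum] at h2
      have h3 : ∑ i, ∑ a, (W l i - layerDecode R (x l) i) a ^ 2 ≤ 4 * s l ^ 2 := by
        have := hx2 l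
        rwa [frob_sq] at this
      have h4 := hx3 l
      refine h2.trans ?_
      have hθl := (hθ l).le
      have hθs : 0 ≤ θ l * s l ^ 2 := by positivity
      calc _ ≤ 2 * κ * (14 * θ l * s l ^ 2) + 2 * (b * θ l) * (4 * s l ^ 2) := by
            refine add_le_add (mul_le_mul_of_nonneg_left h4 (by linarith))
              (mul_le_mul_of_nonneg_left h3 (by positivity))
        _ ≤ 36 * K * θ l * s l ^ 2 := by nlinarith

end Coding

/-! ### Chaining along codes at dyadic scales. -/

section Chaining
variable {Z : Type*} {I : Type*} {n : ℕ}

lemma sum_abs_le_of_sum_sq_le {a : Fin n → ℝ} {D : ℝ} (hD : 0 ≤ D)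
    (h : ∑ i, a i ^ 2 ≤ n * D ^ 2) : ∑ i, |a i| ≤ n * D := by
  refine abs_le_of_sq_le_sq' ?_ (by positivity) |>.2
  have h1 := sq_sum_le_card_mul_sum_sq (s := (Finset.univ : Finset (Fin n))) (f := fun i => |a i|)
  simp only [sq_abs, Finset.card_univ, Fintype.card_fin] at h1
  have := mul_le_mul_of_nonneg_left h (Nat.cast_nonneg (α := ℝ) n)
  nlinarith

lemma sqrt_link_le {j : ℕ} {t q q' cs : ℝ} (ht : 0 ≤ t) (hq : 0 ≤ q) (hq' : 0 ≤ q')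
    (hcs : cs ≤ 2 * Real.log 2 + 10 * q ^ 2 + 10 * q' ^ 2) :
    Real.sqrt (2 * (((j : ℝ) + 1) * Real.log 2 + cs + t))
      ≤ (j + 1) * Real.sqrt (6 * Real.log 2 + 2 * t) + 5 * q + 5 * q' := by
  have hl := Real.log_pos one_lt_two
  set E := Real.sqrt (6 * Real.log 2 + 2 * t)
  have hE : E ^ 2 = 6 * Real.log 2 + 2 * t := Real.sq_sqrt (by positivity)
  have hE0 : 0 ≤ E := Real.sqrt_nonneg _
  have hj : (0 : ℝ) ≤ j := Nat.cast_nonneg j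
  refine Real.sqrt_le_iff.2 ⟨by positivity, ?_⟩
  have h1 : 0 ≤ ((j : ℝ) + 1) * E := by positivity
  have h2 : 2 * ((j : ℝ) + 3) * Real.log 2 + 2 * t ≤ (((j : ℝ) + 1) * E) ^ 2 := by
    rw [mul_pow, hE]
    nlinarith [mul_nonneg hj hl.le, mul_nonneg hj ht, mul_nonneg (mul_nonneg hj hj) hl.le,
      mul_nonneg (mul_nonneg hj hj) ht]
  nlinarith [mul_nonneg h1 hq, mul_nonneg h1 hq', mul_nonneg hq hq']

lemma link_le (hn : 0 < n) {g : I → Z → ℝ} {c : I → ℝ} {t : ℝ} (ht : 0 ≤ t)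
    {S S' : Fin n → Z} (hS : (S, S') ∉ badPairs n g c t) (j : ℕ) (o o' : Option I) {q q' : ℝ}
    (hq : 0 ≤ q) (hq' : 0 ≤ q')
    (ho : withZeroCost c o ≤ Real.log 2 + 10 * q ^ 2)
    (ho' : withZeroCost c o' ≤ Real.log 2 + 10 * q' ^ 2)
    (hD : ∑ i, ((withZero g o - withZero g o') (S' i) - (withZero g o - withZero g o') (S i)) ^ 2
      ≤ n * (8 / 2 ^ j) ^ 2) :
    ∑ i, ((withZero g o - withZero g o') (S' i) - (withZero g o - withZero g o') (S i))
      ≤ Real.sqrt n * (8 / 2 ^ j * ((j + 1) * Real.sqrt (6 * Real.log 2 + 2 * t)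
        + 5 * q + 5 * q')) := by
  have hn' : (0 : ℝ) < n := by exact_mod_cast hn
  have h := fun h' => hS (Set.mem_iUnion.2 ⟨(j, o, o'), hD, h'⟩)
  refine (not_lt.1 h).trans ?_
  have h1 := sqrt_link_le (j := j) (cs := withZeroCost c o + withZeroCost c o') ht hq hq'
    (by linarith)
  rw [Real.sqrt_div' _ hn'.le]
  have hs : 0 < Real.sqrt n := Real.sqrt_pos.2 hn'
  have hss : (n : ℝ) = Real.sqrt n * Real.sqrt n := (Real.mul_self_sqrt hn'.le).symm
  calc (n : ℝ) * (8 / 2 ^ j) * (Real.sqrt (2 * (((j : ℝ) + 1) * Real.log 2 +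
        (withZeroCost c o + withZeroCost c o') + t)) / Real.sqrt n)
      = Real.sqrt n * (8 / 2 ^ j * Real.sqrt (2 * (((j : ℝ) + 1) * Real.log 2 +
        (withZeroCost c o + withZeroCost c o') + t))) := by
        rw [mul_div_assoc', div_eq_iff hs.ne']
        nth_rewrite 1 [hss]
        ring
    _ ≤ _ := by
        refine mul_le_mul_of_nonneg_left (mul_le_mul_of_nonneg_left h1 (by positivity)) hs.le

lemma sum_diff_sq_le {a b : Fin n → ℝ} {A : ℝ} (ha : ∑ i, a i ^ 2 ≤ A) (hb : ∑ i, b i ^ 2 ≤ A) :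
    ∑ i, (a i - b i) ^ 2 ≤ 4 * A := by
  calc ∑ i, (a i - b i) ^ 2 ≤ ∑ i, (2 * a i ^ 2 + 2 * b i ^ 2) :=
        Finset.sum_le_sum fun i _ => by nlinarith [sq_nonneg (a i + b i)]
    _ ≤ 4 * A := by
        rw [Finset.sum_add_distrib, ← Finset.mul_sum, ← Finset.mul_sum]
        linarith

/-- The chain along codes at dyadic resolutions. -/
lemma chain_le (hn : 0 < n) {g : I → Z → ℝ} (hg : ∀ x z, g x z ∈ Set.Icc (0 : ℝ) 1) {c : I → ℝ}
    {t : ℝ} (ht : 0 ≤ t) {S S' : Fin n → Z} (hS : (S, S') ∉ badPairs n g c t) {f : Z → ℝ}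
    (x : ℕ → I) (q : ℕ → ℝ) (hq : ∀ k, 0 ≤ q k) (N : ℕ) (hc : ∀ k ≤ N, c (x k) ≤ 10 * q k ^ 2)
    (h1 : ∀ k ≤ N, ∑ i, (f (S i) - g (x k) (S i)) ^ 2 ≤ n * (1 / 2 ^ k) ^ 2)
    (h2 : ∀ k ≤ N, ∑ i, (f (S' i) - g (x k) (S' i)) ^ 2 ≤ n * (1 / 2 ^ k) ^ 2) :
    (1 / (n : ℝ)) * ∑ i, (f (S' i) - f (S i)) ≤ 2 * (1 / 2 ^ N)
      + 1 / Real.sqrt n * (32 * Real.sqrt (6 * Real.log 2 + 2 * t)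
        + 60 * ∑ k ∈ Finset.range (N + 1), 1 / 2 ^ k * q k) := by
  have hn' : (0 : ℝ) < n := by exact_mod_cast hn
  have hs : 0 < Real.sqrt n := Real.sqrt_pos.2 hn'
  have hss : (n : ℝ) = Real.sqrt n * Real.sqrt n := (Real.mul_self_sqrt hn'.le).symm
  set E := Real.sqrt (6 * Real.log 2 + 2 * t)
  have hE0 : 0 ≤ E := Real.sqrt_nonneg _
  -- The closed form uses that the sum of `(j + 1) / 2 ^ j` over `j ≤ k` is `4 - (k + 3) / 2 ^ k`.
  -- Each `q l` enters two links, with weights `40` and `20` over `2 ^ l`; the last one has so far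
  -- been used once.
  have key : ∀ k ≤ N, ∑ i, (g (x k) (S' i) - g (x k) (S i)) ≤ Real.sqrt n *
      (8 * E * (4 - (k + 3) / 2 ^ k) + 60 * ∑ l ∈ Finset.range k, 1 / 2 ^ l * q l
        + 40 * (1 / 2 ^ k * q k)) := by
    intro k
    induction k with
    | zero =>
      intro h0
      have hD : ∑ i, ((withZero g (some (x 0)) - withZero g none) (S' i)
          - (withZero g (some (x 0)) - withZero g none) (S i)) ^ 2 ≤ n * (8 / 2 ^ 0) ^ 2 := by
        calc _ ≤ ∑ _i : Fin n, (1 : ℝ) := by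
              refine Finset.sum_le_sum fun i _ => ?_
              simp only [withZero, Option.elim, Pi.sub_apply, sub_zero]
              have ha := hg (x 0) (S' i)
              have hb := hg (x 0) (S i)
              rw [sq_le_one_iff_abs_le_one, abs_le]
              constructor <;> linarith [ha.1, ha.2, hb.1, hb.2]
          _ ≤ _ := by
              simp only [Finset.sum_const, Finset.card_univ, Fintype.card_fin, nsmul_eq_mul]
              norm_num
              linarith
      have := link_le hn ht hS 0 (some (x 0)) none (hq 0) le_rfl
        (by simp only [withZeroCost, Option.elim]; linarith [hc 0 h0])
        (by simp [withZeroCost]) hD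
      simp only [withZero, Option.elim, Pi.sub_apply, sub_zero] at this
      refine this.trans (mul_le_mul_of_nonneg_left ?_ hs.le)
      norm_num
      linarith
    | succ k ih =>
      intro hk
      have ih' := ih (by omega)
      -- Two triangle inequalities, one between consecutive approximants and one between the
      -- samples, give `16 * (1 / 2 ^ k) ^ 2 = (8 / 2 ^ (k + 1)) ^ 2`; hence the `8` in `badPairs`.
      have hD : ∑ i, ((withZero g (some (x (k + 1))) - withZero g (some (x k))) (S' i)
          - (withZero g (some (x (k + 1))) - withZero g (some (x k))) (S i)) ^ 2
            ≤ n * (8 / 2 ^ (k + 1)) ^ 2 := by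
        have hmono : (n : ℝ) * (1 / 2 ^ (k + 1)) ^ 2 ≤ n * (1 / 2 ^ k) ^ 2 := by
          gcongr
          · norm_num
          · omega
        have e1 := sum_diff_sq_le (h1 k (by omega)) ((h1 (k + 1) hk).trans hmono)
        have e2 := sum_diff_sq_le (h2 k (by omega)) ((h2 (k + 1) hk).trans hmono)
        have e3 := sum_diff_sq_le e2 e1
        refine le_trans (le_of_eq ?_) (e3.trans (le_of_eq ?_))
        · refine Finset.sum_congr rfl fun i _ => ?_
          simp only [withZero, Option.elim, Pi.sub_apply]
          ring
        · rw [pow_succ]; ring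
      have := link_le hn ht hS (k + 1) (some (x (k + 1))) (some (x k)) (hq (k + 1)) (hq k)
        (by simp only [withZeroCost, Option.elim]; linarith [hc (k + 1) hk])
        (by simp only [withZeroCost, Option.elim]; linarith [hc k (by omega)]) hD
      simp only [withZero, Option.elim, Pi.sub_apply] at this
      have e : ∑ i, (g (x (k + 1)) (S' i) - g (x (k + 1)) (S i))
          = ∑ i, (g (x k) (S' i) - g (x k) (S i)) + ∑ i, (g (x (k + 1)) (S' i) - g (x k) (S' i)
            - (g (x (k + 1)) (S i) - g (x k) (S i))) := by
        rw [← Finset.sum_add_distrib]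
        exact Finset.sum_congr rfl fun i _ => by ring
      rw [e]
      refine (add_le_add ih' this).trans (le_of_eq ?_)
      rw [← mul_add, Finset.sum_range_succ, pow_succ]
      push_cast
      field_simp
      ring
  have hlast := key N le_rfl
  have e1 := sum_abs_le_of_sum_sq_le (by positivity) (h1 N le_rfl)
  have e2 := sum_abs_le_of_sum_sq_le (by positivity) (h2 N le_rfl)
  have e3 : ∑ i, (f (S' i) - f (S i)) ≤ ∑ i, |f (S' i) - g (x N) (S' i)|
      + ∑ i, |f (S i) - g (x N) (S i)| + ∑ i, (g (x N) (S' i) - g (x N) (S i)) := by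
    rw [← Finset.sum_add_distrib, ← Finset.sum_add_distrib]
    refine Finset.sum_le_sum fun i _ => ?_
    linarith [le_abs_self (f (S' i) - g (x N) (S' i)), neg_abs_le (f (S i) - g (x N) (S i))]
  have e4 : 8 * E * (4 - ((N : ℝ) + 3) / 2 ^ N) + 60 * ∑ l ∈ Finset.range N, 1 / 2 ^ l * q l
        + 40 * (1 / 2 ^ N * q N)
      ≤ 32 * E + 60 * ∑ k ∈ Finset.range (N + 1), 1 / 2 ^ k * q k := by
    rw [Finset.sum_range_succ]
    have h3 : 0 ≤ E * (((N : ℝ) + 3) / 2 ^ N) := by positivity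
    have h4 : 0 ≤ 1 / 2 ^ N * q N := mul_nonneg (by positivity) (hq N)
    linarith
  have e5 := e3.trans (add_le_add (add_le_add e2 e1)
    (hlast.trans (mul_le_mul_of_nonneg_left e4 hs.le)))
  rw [one_div, inv_mul_le_iff₀ hn']
  refine e5.trans (le_of_eq ?_)
  have h5 : (n : ℝ) * (1 / Real.sqrt n) = Real.sqrt n := by
    rw [mul_one_div, div_eq_iff hs.ne']
    exact hss
  rw [mul_add (n : ℝ), ← mul_assoc (n : ℝ) (1 / Real.sqrt n), h5]
  ring

/-- A point of an interval where a function is at most twice its mean. -/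
lemma exists_le_lower_mean {a b : ℝ} (hab : a < b) {φ : ℝ → ENNReal} {m : ENNReal} (hm : m ≠ 0)
    (hφ : ∀ x ∈ Set.Ioc a b, m ≤ φ x) :
    ∃ x ∈ Set.Ioc a b, φ x * ENNReal.ofReal (b - a) ≤ 2 * ∫⁻ y in Set.Ioc a b, φ y := by
  by_contra! hcon
  set A := ∫⁻ y in Set.Ioc a b, φ y
  have hl0 : ENNReal.ofReal (b - a) ≠ 0 := by simpa using hab
  have hA : A ≠ ⊤ := fun h => by
    have := hcon b ⟨hab, le_rfl⟩
    rw [h, ENNReal.mul_top two_ne_zero] at this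
    exact not_top_lt this
  -- Only a constant minorant of `φ` is integrated, so the argument works for the lower integral and
  -- needs neither measurability nor monotonicity of `φ`.
  have h1 : 2 * A ≤ A := by
    calc 2 * A = ∫⁻ _y in Set.Ioc a b, 2 * A / ENNReal.ofReal (b - a) := by
          rw [setLIntegral_const, Real.volume_Ioc, ENNReal.div_mul_cancel hl0 ENNReal.ofReal_ne_top]
      _ ≤ A := by
          refine setLIntegral_mono' measurableSet_Ioc fun x hx => ?_
          exact ENNReal.div_le_of_le_mul (hcon x hx).le
  have hA0 : A ≠ 0 := by
    have h2 : m * ENNReal.ofReal (b - a) ≤ A := by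
      rw [← Real.volume_Ioc, ← setLIntegral_const]
      exact setLIntegral_mono' measurableSet_Ioc hφ
    exact fun h => mul_ne_zero hm hl0 (le_zero_iff.1 (h ▸ h2))
  have : A * 1 < A * 2 := ENNReal.mul_lt_mul_right hA0 hA ENNReal.one_lt_two
  rw [mul_one, mul_comm] at this
  exact absurd h1 (not_le.2 this)

lemma sum_lintegral_dyadic (φ : ℝ → ENNReal) {B : ℝ} (hB : 0 < B) (N : ℕ) :
    ∑ k ∈ Finset.range N, ∫⁻ y in Set.Ioc (B / 2 ^ (k + 1)) (B / 2 ^ k), φ y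
      = ∫⁻ y in Set.Ioc (B / 2 ^ N) B, φ y := by
  induction N with
  | zero => simp
  | succ N ih =>
    have h1 : B / 2 ^ (N + 1) ≤ B / 2 ^ N := by
      gcongr
      · norm_num
      · omega
    have h2 : B / 2 ^ N ≤ B := div_le_self hB.le (one_le_pow₀ one_le_two)
    rw [Finset.sum_range_succ, ih, add_comm, ← Set.Ioc_union_Ioc_eq_Ioc h1 h2,
      lintegral_union measurableSet_Ioc]
    exact Set.disjoint_left.2 fun x hx hx' => not_lt.2 hx.2 hx'.1

lemma inv_sqrt_pos (hn : 0 < n) : 0 < 1 / Real.sqrt n :=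
  one_div_pos.2 (Real.sqrt_pos.2 (by exact_mod_cast hn))

/-- Chaining with pointwise code lengths. -/
lemma chaining_le (hn : 0 < n) {g : I → Z → ℝ} (hg : ∀ x z, g x z ∈ Set.Icc (0 : ℝ) 1) {c : I → ℝ}
    {t : ℝ} (ht : 0 ≤ t) {S S' : Fin n → Z} (hS : (S, S') ∉ badPairs n g c t) {f : Z → ℝ}
    (hf : ∀ z, f z ∈ Set.Icc (0 : ℝ) 1) {β : ℝ} (hβ : 0 < β) (dm : ℝ → ℝ)
    (hdm : ∀ ε, 0 < ε → ε ≤ 1 / β → 1 / 4 ≤ dm ε)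
    (hcode : ∀ ε, 0 < ε → ε ≤ 1 / β → ∃ x, c x ≤ 10 * dm ε ∧
      ∑ i, (f (S i) - g x (S i)) ^ 2 ≤ n * (β * ε) ^ 2 ∧
      ∑ i, (f (S' i) - g x (S' i)) ^ 2 ≤ n * (β * ε) ^ 2) {α : ℝ} (hα : 0 ≤ α) :
    ENNReal.ofReal ((1 / (n : ℝ)) * ∑ i, (f (S' i) - f (S i)))
      ≤ ENNReal.ofReal 240 * (ENNReal.ofReal β * (ENNReal.ofReal α + ENNReal.ofReal (1 / Real.sqrt n)
          * ∫⁻ ε in Set.Ioc α (1 / β), ENNReal.ofReal (Real.sqrt (dm ε))))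
        + ENNReal.ofReal ((8 + 32 * Real.sqrt (6 * Real.log 2 + 2 * t)) * (1 / Real.sqrt n)) := by
  have hn' : (0 : ℝ) < n := by exact_mod_cast hn
  set w := 1 / Real.sqrt n with hw
  have hw0 : 0 < w := inv_sqrt_pos hn
  set E := Real.sqrt (6 * Real.log 2 + 2 * t)
  have hE0 : 0 ≤ E := Real.sqrt_nonneg _
  set φ : ℝ → ENNReal := fun ε => ENNReal.ofReal (Real.sqrt (dm ε)) with hφ
  -- Cutting at `1 / √n` as well keeps the chain finite when `α = 0`, at a cost of the order of the
  -- concentration term.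
  set a := max (β * α) w with ha
  have ha0 : 0 < a := lt_max_of_lt_right hw0
  have ha1 : a ≤ β * α + w := max_le (by linarith) (by linarith [mul_nonneg hβ.le hα])
  have hαβ : ENNReal.ofReal (β * α) = ENNReal.ofReal β * ENNReal.ofReal α :=
    ENNReal.ofReal_mul hβ.le
  rcases le_or_gt (1 / 2) a with ha2 | ha2
  · have h1 : (1 / (n : ℝ)) * ∑ i, (f (S' i) - f (S i)) ≤ 8 * (β * α) + (8 + 32 * E) * w := by
      have h2 : ∑ i, (f (S' i) - f (S i)) ≤ ∑ _i : Fin n, (1 : ℝ) :=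
        Finset.sum_le_sum fun i _ => by linarith [(hf (S' i)).2, (hf (S i)).1]
      simp only [Finset.sum_const, Finset.card_univ, Fintype.card_fin, nsmul_eq_mul, mul_one] at h2
      have h3 : (1 / (n : ℝ)) * ∑ i, (f (S' i) - f (S i)) ≤ 1 := by
        rw [one_div, inv_mul_le_iff₀ hn']
        linarith
      nlinarith [mul_nonneg hE0 hw0.le, mul_nonneg hβ.le hα]
    refine (ENNReal.ofReal_le_ofReal h1).trans ?_
    rw [ENNReal.ofReal_add (by positivity) (by positivity), ENNReal.ofReal_mul (by norm_num), hαβ]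
    gcongr
    · norm_num
    · exact le_self_add
  -- The last scale is comparable to `a`, while all dyadic intervals up to level `N` still lie above
  -- `α`.
  · obtain ⟨N, hN1, hN2⟩ := exists_nat_pow_near (x := 1 / (2 * a))
      (by rw [le_div_iff₀ (by positivity)]; linarith) one_lt_two
    have hN3 : a ≤ 1 / 2 ^ (N + 1) := by
      rw [le_div_iff₀ (by positivity)] at hN1
      rw [le_div_iff₀ (by positivity), pow_succ]
      linarith
    have hN4 : 1 / 2 ^ N ≤ 4 * a := by
      rw [div_lt_iff₀ (by positivity), pow_succ] at hN2
      rw [div_le_iff₀ (by positivity)]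
      linarith
    have hB : 0 < 1 / β := one_div_pos.2 hβ
    -- The dimension need not be monotone in the scale, so in each dyadic interval a scale is
    -- selected where its square root is at most twice the mean.
    have hlevel : ∀ k : ℕ, ∃ ε, (0 < ε ∧ ε ≤ 1 / β / 2 ^ k) ∧
        ENNReal.ofReal (1 / 2 ^ k * Real.sqrt (dm ε)) ≤ 4 * ENNReal.ofReal β *
          ∫⁻ y in Set.Ioc (1 / β / 2 ^ (k + 1)) (1 / β / 2 ^ k), φ y := by
      intro k
      have hlt : 1 / β / 2 ^ (k + 1) < 1 / β / 2 ^ k := by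
        gcongr
        · norm_num
        · omega
      have hpos : 0 < 1 / β / 2 ^ (k + 1) := by positivity
      have hle : 1 / β / 2 ^ k ≤ 1 / β := div_le_self hB.le (one_le_pow₀ one_le_two)
      obtain ⟨ε, hε, hε2⟩ := exists_le_lower_mean hlt (φ := φ) (m := ENNReal.ofReal (1 / 2))
        (by simp) fun y hy => by
          refine ENNReal.ofReal_le_ofReal (Real.le_sqrt_of_sq_le ?_)
          have := hdm y (hpos.trans hy.1) (hy.2.trans hle)
          norm_num
          linarith
      refine ⟨ε, ⟨hpos.trans hε.1, hε.2⟩, ?_⟩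
      have e : 1 / 2 ^ k * Real.sqrt (dm ε)
          = 2 * β * (Real.sqrt (dm ε) * (1 / β / 2 ^ k - 1 / β / 2 ^ (k + 1))) := by
        rw [pow_succ]
        field_simp
        ring
      rw [e, ENNReal.ofReal_mul (by positivity), ENNReal.ofReal_mul (Real.sqrt_nonneg _),
        ENNReal.ofReal_mul two_pos.le, ENNReal.ofReal_ofNat]
      calc _ ≤ 2 * ENNReal.ofReal β * (2 *
            ∫⁻ y in Set.Ioc (1 / β / 2 ^ (k + 1)) (1 / β / 2 ^ k), φ y) := by gcongr
        _ = _ := by ring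
    choose e he hint using hlevel
    have he1 : ∀ k, e k ≤ 1 / β := fun k =>
      (he k).2.trans (div_le_self hB.le (one_le_pow₀ one_le_two))
    choose x hx1 hx2 hx3 using fun k => hcode (e k) (he k).1 (he1 k)
    have hεk : ∀ k, (n : ℝ) * (β * e k) ^ 2 ≤ n * (1 / 2 ^ k) ^ 2 := fun k => by
      have h1 : β * e k ≤ 1 / 2 ^ k := by
        have := mul_le_mul_of_nonneg_left (he k).2 hβ.le
        rwa [show β * (1 / β / 2 ^ k) = 1 / 2 ^ k by field_simp] at this
      have h2 := (he k).1
      gcongr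
    have hmain := chain_le hn hg ht hS x (fun k => Real.sqrt (dm (e k)))
      (fun _ => Real.sqrt_nonneg _) N
      (fun k _ => by
        rw [Real.sq_sqrt (by linarith [hdm _ (he k).1 (he1 k)])]
        exact hx1 k)
      (fun k _ => (hx2 k).trans (hεk k)) fun k _ => (hx3 k).trans (hεk k)
    set Q := ∑ k ∈ Finset.range (N + 1), 1 / 2 ^ k * Real.sqrt (dm (e k))
    have hQ0 : 0 ≤ Q := Finset.sum_nonneg fun k _ => by positivity
    have hQ : ENNReal.ofReal Q ≤ 4 * ENNReal.ofReal β * ∫⁻ ε in Set.Ioc α (1 / β), φ ε := by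
      rw [ENNReal.ofReal_sum_of_nonneg fun k _ => by positivity]
      refine (Finset.sum_le_sum fun k _ => hint k).trans ?_
      rw [← Finset.mul_sum, sum_lintegral_dyadic φ hB]
      refine mul_le_mul_right (lintegral_mono_set (Set.Ioc_subset_Ioc_left ?_)) _
      have h1 : β * α ≤ 1 / 2 ^ (N + 1) := (le_max_left _ _).trans hN3
      rw [div_div, le_div_iff₀ (by positivity)]
      rw [le_div_iff₀ (by positivity)] at h1
      linarith
    have h1 : (1 / (n : ℝ)) * ∑ i, (f (S' i) - f (S i))
        ≤ 8 * (β * α) + 60 * (w * Q) + (8 + 32 * E) * w := by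
      refine hmain.trans ?_
      linarith
    refine (ENNReal.ofReal_le_ofReal h1).trans ?_
    rw [ENNReal.ofReal_add (by positivity) (by positivity), ENNReal.ofReal_add (by positivity)
      (by positivity), ENNReal.ofReal_mul (by norm_num), hαβ,
      ENNReal.ofReal_mul (p := 60) (by norm_num), ENNReal.ofReal_mul hw0.le, mul_add, mul_add]
    refine add_le_add_left (add_le_add ?_ ?_) _
    · gcongr
      norm_num
    · calc _ ≤ ENNReal.ofReal 60 * (ENNReal.ofReal w *
            (4 * ENNReal.ofReal β * ∫⁻ ε in Set.Ioc α (1 / β), φ ε)) := by gcongr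
        _ = (ENNReal.ofReal 60 * 4) * (ENNReal.ofReal β * (ENNReal.ofReal w *
            ∫⁻ ε in Set.Ioc α (1 / β), φ ε)) := by ring
        _ = _ := by
            rw [← ENNReal.ofReal_ofNat 4, ← ENNReal.ofReal_mul (by norm_num)]
            norm_num

end Chaining

/-! ### From pairs of samples to the generalization gap. -/

section Generalization
variable {L : ℕ} {d : ℕ → ℕ} {n : ℕ} {σ : Activations L d} {M : Fin L → Weights L d → ℝ → ℝ}
  {𝒴 : Type*}

/-- The loss of a network, as a function of the labelled input. -/
def netLoss (σ : Activations L d) (loss : Vec (d L) → 𝒴 → ℝ) (W : Weights L d)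
    (z : Vec (d 0) × 𝒴) : ℝ := loss (feat σ W z.1 L) z.2

lemma continuous_feat (hσ : ∀ l, LipschitzWith 1 (σ l)) (W : Weights L d) (j : ℕ) :
    Continuous fun x => feat σ W x j := by
  induction j with
  | zero => exact continuous_id
  | succ j ih =>
    by_cases hj : j < L
    · simp only [feat, dif_pos hj]
      refine (hσ ⟨j, hj⟩).continuous.comp ((PiLp.continuous_toLp 2 _).comp ?_)
      exact continuous_const.matrix_mulVec ((PiLp.continuous_ofLp 2 _).comp ih)
    · simp only [feat, dif_neg hj]
      exact continuous_const

lemma measurable_netLoss [MeasurableSpace 𝒴] (hσ : ∀ l, LipschitzWith 1 (σ l))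
    {loss : Vec (d L) → 𝒴 → ℝ} (hmeas : ∀ u, Measurable (loss u)) {β : ℝ}
    (hlip : ∀ u v y, |loss u y - loss v y| ≤ β * ‖u - v‖) (W : Weights L d) :
    Measurable (netLoss σ loss W) := by
  have h1 : Measurable (Function.uncurry loss) := by
    refine measurable_uncurry_of_continuous_of_measurable (fun y => ?_) hmeas
    refine (LipschitzWith.of_dist_le' (K := β) fun u v => ?_).continuous
    rw [Real.dist_eq, dist_eq_norm]
    exact hlip u v y
  exact h1.comp (((continuous_feat hσ W L).measurable.comp measurable_fst).prodMk measurable_snd)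

lemma sum_netLoss_sq_le {loss : Vec (d L) → 𝒴 → ℝ} {β : ℝ}
    (hlip : ∀ u v y, |loss u y - loss v y| ≤ β * ‖u - v‖)
    (S : Fin n → Vec (d 0) × 𝒴) (W V : Weights L d) :
    ∑ i, (netLoss σ loss W (S i) - netLoss σ loss V (S i)) ^ 2
      ≤ β ^ 2 * frob (featMat σ W (inputs S) L - featMat σ V (inputs S) L) ^ 2 := by
  rw [frob_sq, Finset.sum_comm, Finset.mul_sum]
  refine Finset.sum_le_sum fun i _ => ?_
  have h1 := pow_le_pow_left₀ (abs_nonneg _)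
    (hlip (feat σ W (S i).1 L) (feat σ V (S i).1 L) (S i).2) 2
  rw [sq_abs, mul_pow, EuclideanSpace.norm_sq_eq] at h1
  refine h1.trans (le_of_eq ?_)
  simp [featMat, inputs]

/-- The chaining bound for a pair of samples that is subspace isomorphic and avoids the large
increments. -/
lemma pair_chaining_le {R β K κ b t : ℝ} (hR : 0 < R) (hβ : 0 < β) (hL1 : 1 ≤ L) (hn : 2 ≤ n)
    (hL : L ≤ 4 * n) (hd : ∀ l, l ≤ L → 1 ≤ d l) (hκ : 1 ≤ κ) (hκK : κ ≤ K) (hb : 1 ≤ b)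
    (hbK : b ≤ K) (hσ : ∀ l, LipschitzWith 1 (σ l)) {loss : Vec (d L) → 𝒴 → ℝ}
    (h01 : ∀ u y, loss u y ∈ Set.Icc (0 : ℝ) 1)
    (hlip : ∀ u v y, |loss u y - loss v y| ≤ β * ‖u - v‖)
    (hM : ∀ l W ε, wNorm W ≤ R → 0 < ε → ε ≤ 1 / β → 0 < M l W ε)
    {S S' : Fin n → Vec (d 0) × 𝒴}
    (hout : ∀ (l : Fin L) (W W' : Weights L d) (ε : ℝ), wNorm W ≤ R → wNorm W' ≤ R →
      0 < ε → ε ≤ 1 / β → empDist σ (inputs S) W W' ≤ ε →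
      OuterLipAt σ (inputs S) l W W' (M l W ε) ∧ OuterLipAt σ (inputs S') l W W' (M l W ε))
    (hiso : SubspaceIsoPair σ M 12 R β κ b (inputs S) (inputs S')) (ht : 0 ≤ t)
    (hbad : (S, S') ∉ badPairs n (fun x : NetCode L d (5 * n) =>
      netLoss σ loss (netDecode R x)) netCost t)
    {W : Weights L d} (hW : wNorm W ≤ R) {α : ℝ} (hα : 0 ≤ α) :
    ENNReal.ofReal ((1 / (n : ℝ)) * ∑ i, (netLoss σ loss W (S' i) - netLoss σ loss W (S i)))
      ≤ ENNReal.ofReal 240 * (ENNReal.ofReal β * (ENNReal.ofReal α + ENNReal.ofReal (1 / Real.sqrt n)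
          * ∫⁻ ε in Set.Ioc α (1 / β),
            ENNReal.ofReal (Real.sqrt (riemDim σ M 12 R (inputs S) W (1 / K * ε)))))
        + ENNReal.ofReal ((8 + 32 * Real.sqrt (6 * Real.log 2 + 2 * t)) * (1 / Real.sqrt n)) := by
  have hn' : (0 : ℝ) < n := by exact_mod_cast (by omega : 0 < n)
  have hsn : 0 < Real.sqrt n := Real.sqrt_pos.2 hn'
  have hK : 1 ≤ K := hκ.trans hκK
  have hK0 : 0 < K := by linarith
  have hη : ∀ ε, 0 < ε → 0 < 1 / K * ε ∧ 1 / K * ε ≤ ε := fun ε hε =>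
    ⟨by positivity, mul_le_of_le_one_left hε.le ((div_le_one hK0).2 hK)⟩
  refine chaining_le (by omega) (fun x z => h01 _ _) ht hbad (f := netLoss σ loss W)
    (fun z => h01 _ _) hβ
    (fun ε => riemDim σ M 12 R (inputs S) W (1 / K * ε)) (fun ε hε hε1 => ?_)
    (fun ε hε hε1 => ?_) hα
  · have h1 := le_riemDim (σ := σ) (by norm_num : (0 : ℝ) < 12) hR hn hd (inputs S) (hη ε hε).1
      fun l => hM l W _ hW (hη ε hε).1 ((hη ε hε).2.trans hε1)
    have : (1 : ℝ) ≤ L := by exact_mod_cast hL1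
    linarith
  · obtain ⟨hη0, hηε⟩ := hη ε hε
    have hηβ := hηε.trans hε1
    have hMl : ∀ l, 0 < M l W (1 / K * ε) := fun l => hM l W _ hW hη0 hηβ
    -- Coding at the finer scale `ε / K` absorbs the factor `K` lost on the ghost sample; this is
    -- why the constant inside the dimension is `1 / K`.
    obtain ⟨x, hx1, hx2, hx3, hx4⟩ :=
      exists_netCode (σ := σ) hR hn hL hd (inputs S) hW hη0 hMl
    have hghost := hx4 (inputs S') K κ b hκ hκK (by linarith) hbK
      fun j => hiso j W _ hW hη0 hηβ
    have hdist := empDist_le_of_outerLip hσ (by omega) (inputs S) (inputs S') hη0 hW hx1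
      (fun l => (hMl l).le) (fun l W' hW' hdist => hout l W W' _ hW hW' hη0 hηβ hdist) hx3
    refine ⟨x, hx2, ?_, ?_⟩
    · refine (sum_netLoss_sq_le hlip S W _).trans ?_
      have h1 := hdist.1
      rw [empDist_eq, div_le_iff₀ hsn] at h1
      have h2 := pow_le_pow_left₀ (frob_nonneg _)
        (h1.trans (mul_le_mul_of_nonneg_right (by linarith : 1 / K * ε / 2 ≤ ε) hsn.le)) 2
      rw [mul_pow, Real.sq_sqrt hn'.le] at h2
      have := mul_le_mul_of_nonneg_left h2 (sq_nonneg β)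
      linarith
    · refine (sum_netLoss_sq_le hlip S' W _).trans ?_
      have h1 := hdist.2.trans hghost
      rw [empDist_eq, mul_div_cancel₀ _ hsn.ne', ← mul_assoc K, mul_one_div_cancel hK0.ne',
        one_mul] at h1
      have h2 := pow_le_pow_left₀ (frob_nonneg _) h1 2
      rw [mul_pow, Real.sq_sqrt hn'.le] at h2
      have := mul_le_mul_of_nonneg_left h2 (sq_nonneg β)
      linarith

lemma one_quarter_le_logLog {δ : ℝ} (hn : 2 ≤ n) (hδ : 0 < δ) (hδ1 : δ < 1) :
    1 / 4 ≤ Real.log (Real.log (2 * n) / δ) ∧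
      Real.log (2 / δ) ≤ 4 * Real.log (Real.log (2 * n) / δ) := by
  have hn' : (2 : ℝ) ≤ n := by exact_mod_cast hn
  have h2 := Real.log_two_gt_d9
  have h2' := Real.log_two_lt_d9
  have h4 : Real.log 4 = 2 * Real.log 2 := by
    rw [show (4 : ℝ) = 2 ^ 2 by norm_num, Real.log_pow]; norm_num
  have h1 : 1.38 ≤ Real.log (2 * n) := by
    have : Real.log 4 ≤ Real.log (2 * n) := Real.log_le_log (by norm_num) (by linarith)
    linarith
  have hδl : 0 ≤ -Real.log δ := by linarith [Real.log_nonpos hδ.le hδ1.le]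
  have h3 : 1 / 4 ≤ Real.log (Real.log (2 * n)) := by
    have h5 := Real.one_sub_inv_le_log_of_pos (show 0 < Real.log (2 * n) by linarith)
    have h6 : (Real.log (2 * n))⁻¹ ≤ 1.38⁻¹ := inv_anti₀ (by norm_num) h1
    norm_num at h6
    linarith
  rw [Real.log_div (by linarith) hδ.ne', Real.log_div (by norm_num) hδ.ne']
  constructor <;> linarith

/-- Since `log (2 n) ≥ log 4 > 1`, the iterated logarithm is at least `1 / 4`, which lets it absorb
both `log (2 / δ)` and the absolute constants. -/
lemma remainder_le_concTerm {δ : ℝ} (hn : 2 ≤ n) (hδ : 0 < δ) (hδ1 : δ < 1) :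
    1 / Real.sqrt n + (8 + 32 * Real.sqrt (6 * Real.log 2 + 2 * Real.log (2 / δ)))
      * (1 / Real.sqrt n) ≤ 240 * concTerm n δ := by
  obtain ⟨h1, h2⟩ := one_quarter_le_logLog hn hδ hδ1
  rw [concTerm, Real.sqrt_div' _ (Nat.cast_nonneg n)]
  set T := Real.log (Real.log (2 * n) / δ)
  have hT : 1 / 2 ≤ Real.sqrt T := Real.le_sqrt_of_sq_le (by norm_num; linarith)
  have hE : Real.sqrt (6 * Real.log 2 + 2 * Real.log (2 / δ)) ≤ 5 * Real.sqrt T := by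
    refine Real.sqrt_le_iff.2 ⟨by positivity, ?_⟩
    rw [mul_pow, Real.sq_sqrt (by linarith)]
    have := Real.log_two_lt_d9
    linarith
  have hw := inv_sqrt_pos (n := n) (by omega)
  have e : 240 * (Real.sqrt T / Real.sqrt n) = 240 * Real.sqrt T * (1 / Real.sqrt n) := by ring
  rw [e, ← one_add_mul]
  exact mul_le_mul_of_nonneg_right (by linarith) hw.le

lemma le_chaining_of_forall {C₂ R β c a k D : ℝ} {X : Fin n → Vec (d 0)} {W : Weights L d}
    (hk : 0 < k) (h : ∀ α, 0 ≤ α → ENNReal.ofReal a ≤ ENNReal.ofReal k *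
      (ENNReal.ofReal α + ENNReal.ofReal (1 / Real.sqrt n) * ∫⁻ ε in Set.Ioc α (1 / β),
        ENNReal.ofReal (Real.sqrt (riemDim σ M C₂ R X W (c * ε)))) + ENNReal.ofReal D) :
    ENNReal.ofReal a ≤ ENNReal.ofReal k * chaining σ M C₂ R β c X W + ENNReal.ofReal D := by
  have hk0 : ENNReal.ofReal k ≠ 0 := by simpa using hk
  rw [← tsub_le_iff_right, mul_comm, ← ENNReal.div_le_iff hk0 ENNReal.ofReal_ne_top]
  refine le_iInf₂ fun α hα => ?_
  rw [ENNReal.div_le_iff hk0 ENNReal.ofReal_ne_top, mul_comm, tsub_le_iff_right]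
  exact h α hα

lemma genGap_le_one [MeasurableSpace 𝒴] {P : Measure (Vec (d 0) × 𝒴)} [IsProbabilityMeasure P]
    {loss : Vec (d L) → 𝒴 → ℝ} (h01 : ∀ u y, loss u y ∈ Set.Icc (0 : ℝ) 1)
    (S : Fin n → Vec (d 0) × 𝒴) (W : Weights L d) : genGap σ P loss S W ≤ 1 := by
  have h1 : ∫ z, loss (feat σ W z.1 L) z.2 ∂P ≤ ∫ _z, (1 : ℝ) ∂P :=
    integral_mono_of_nonneg (ae_of_all _ fun z => (h01 _ _).1) (integrable_const _)
      (ae_of_all _ fun z => (h01 _ _).2)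
  have h2 : 0 ≤ (1 / (n : ℝ)) * ∑ i, loss (feat σ W (S i).1 L) (S i).2 :=
    mul_nonneg (by positivity) (Finset.sum_nonneg fun i _ => (h01 _ _).1)
  simp only [integral_const, probReal_univ, smul_eq_mul, mul_one] at h1
  unfold genGap
  linarith

/-- For networks that are deeper than the sample size the chaining functional exceeds `1 / β`. -/
lemma one_le_chaining_of_deep {R β K : ℝ} (hR : 0 < R) (hβ : 0 < β) (hn : 2 ≤ n) (hK : 1 ≤ K)
    (hL : 4 * n < L) (hd : ∀ l, l ≤ L → 1 ≤ d l)
    (hM : ∀ l W ε, wNorm W ≤ R → 0 < ε → ε ≤ 1 / β → 0 < M l W ε)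
    (X : Fin n → Vec (d 0)) {W : Weights L d} (hW : wNorm W ≤ R) :
    1 ≤ ENNReal.ofReal β * chaining σ M 12 R β (1 / K) X W := by
  have hn' : (0 : ℝ) < n := by exact_mod_cast (by omega : 0 < n)
  have hsn : 0 < Real.sqrt n := Real.sqrt_pos.2 hn'
  have hK0 : 0 < K := by linarith
  have key := le_chaining_of_forall (σ := σ) (M := M) (C₂ := 12) (R := R) (β := β) (c := 1 / K)
    (a := 1) (D := 0) (X := X) (W := W) hβ fun α hα => ?_
  · simpa using key
  -- Here the dimension is at least `L / 4 ≥ n`, so the normalized integrand is at least one and the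
  -- functional cannot beat `α + (1 / β - α)`.
  have hint : ENNReal.ofReal (Real.sqrt n) * ENNReal.ofReal (1 / β - α)
      ≤ ∫⁻ ε in Set.Ioc α (1 / β),
        ENNReal.ofReal (Real.sqrt (riemDim σ M 12 R X W (1 / K * ε))) := by
    rw [← Real.volume_Ioc, ← setLIntegral_const]
    refine setLIntegral_mono' measurableSet_Ioc fun ε hε => ?_
    have hε0 : 0 < ε := hα.trans_lt hε.1
    have h1 : 1 / K * ε ≤ ε := mul_le_of_le_one_left hε0.le ((div_le_one hK0).2 hK)
    have h2 := le_riemDim (σ := σ) (by norm_num : (0 : ℝ) < 12) hR hn hd X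
      (by positivity : 0 < 1 / K * ε)
      fun l => hM l W _ hW (by positivity) (h1.trans hε.2)
    have h3 : ((4 * n : ℕ) : ℝ) ≤ L := by exact_mod_cast hL.le
    push_cast at h3
    exact ENNReal.ofReal_le_ofReal (Real.sqrt_le_sqrt (by linarith))
  have hone : ENNReal.ofReal (1 / Real.sqrt n) * ENNReal.ofReal (Real.sqrt n) = 1 := by
    rw [← ENNReal.ofReal_mul (by positivity), one_div_mul_cancel hsn.ne', ENNReal.ofReal_one]
  rw [ENNReal.ofReal_zero, add_zero]
  calc ENNReal.ofReal 1 ≤ ENNReal.ofReal (β * α + β * (1 / β - α)) := by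
        refine ENNReal.ofReal_le_ofReal (le_of_eq ?_)
        field_simp
        ring
    _ ≤ ENNReal.ofReal β * ENNReal.ofReal α + ENNReal.ofReal β * ENNReal.ofReal (1 / β - α) := by
        rw [← ENNReal.ofReal_mul hβ.le, ← ENNReal.ofReal_mul hβ.le]
        exact ENNReal.ofReal_add_le
    _ = ENNReal.ofReal β * (ENNReal.ofReal α + ENNReal.ofReal (1 / Real.sqrt n) *
          (ENNReal.ofReal (Real.sqrt n) * ENNReal.ofReal (1 / β - α))) := by
        rw [← mul_assoc (ENNReal.ofReal (1 / Real.sqrt n)), hone, one_mul, mul_add]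
    _ ≤ _ := by gcongr

/-- The generalization bound when the ghost sample is subspace isomorphic with conditional
probability more than three quarters. -/
lemma measure_genGap_le [MeasurableSpace 𝒴] {P : Measure (Vec (d 0) × 𝒴)} [IsProbabilityMeasure P]
    {R β K κ b ζ δiso δ : ℝ} (hR : 0 < R) (hβ : 0 < β) (hL1 : 1 ≤ L) (hn : 2 ≤ n)
    (hd : ∀ l, l ≤ L → 1 ≤ d l) (hκ : 1 ≤ κ) (hκK : κ ≤ K) (hb : 1 ≤ b)
    (hbK : b ≤ K) (hζ : ζ ≤ 1 / 4) (hδiso : 0 ≤ δiso) (hσ : ∀ l, LipschitzWith 1 (σ l))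
    {loss : Vec (d L) → 𝒴 → ℝ} (hmeas : ∀ u, Measurable (loss u))
    (h01 : ∀ u y, loss u y ∈ Set.Icc (0 : ℝ) 1)
    (hlip : ∀ u v y, |loss u y - loss v y| ≤ β * ‖u - v‖)
    (hM : CommonLocalLipschitz n σ P R β M)
    (hiso : (Measure.pi fun _ : Fin n => P)
      {S | ¬ SubspaceIso σ P M 12 R β κ b ζ S} ≤ ENNReal.ofReal δiso)
    (hδ : 0 < δ) (hδ1 : δ < 1) :
    (Measure.pi fun _ : Fin n => P) {S | ¬ ∀ W : Weights L d, wNorm W ≤ R →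
      ENNReal.ofReal (genGap σ P loss S W) ≤ ENNReal.ofReal 240 *
        (ENNReal.ofReal β * chaining σ M 12 R β (1 / K) (inputs S) W
          + ENNReal.ofReal (concTerm n δ))} ≤ ENNReal.ofReal (δ + δiso) := by
  have hn' : (0 : ℝ) < n := by exact_mod_cast (by omega : 0 < n)
  rcases lt_or_ge (4 * n) L with hL | hL
  · refine le_trans (le_of_eq ?_) zero_le
    convert measure_empty (μ := Measure.pi fun _ : Fin n => P)
    refine Set.eq_empty_iff_forall_notMem.2 fun S hS => hS fun W hW => ?_
    have h1 := one_le_chaining_of_deep (σ := σ) hR hβ hn (hκ.trans hκK) hL hd hM.1 (inputs S) hW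
    calc ENNReal.ofReal (genGap σ P loss S W) ≤ 1 := by
          rw [ENNReal.ofReal_le_one]; exact genGap_le_one h01 S W
      _ ≤ ENNReal.ofReal β * chaining σ M 12 R β (1 / K) (inputs S) W := h1
      _ ≤ 1 * (ENNReal.ofReal β * chaining σ M 12 R β (1 / K) (inputs S) W
          + ENNReal.ofReal (concTerm n δ)) := by rw [one_mul]; exact le_self_add
      _ ≤ _ := by
          gcongr
          rw [← ENNReal.ofReal_one]
          exact ENNReal.ofReal_le_ofReal (by norm_num)
  set μ := Measure.pi fun _ : Fin n => P with hμ
  set t := Real.log (2 / δ) with ht_def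
  have ht : 0 ≤ t := Real.log_nonneg ((one_le_div hδ).2 (by linarith))
  set g : NetCode L d (5 * n) → Vec (d 0) × 𝒴 → ℝ := fun x => netLoss σ loss (netDecode R x)
  have hg : ∀ x, Measurable (g x) := fun x => measurable_netLoss hσ hmeas hlip _
  set B := badPairs n g netCost t with hB_def
  have hBm : MeasurableSet B := measurableSet_badPairs hg _ _
  have hB : (μ.prod μ) B ≤ ENNReal.ofReal (δ / 2) := by
    refine (measure_badPairs_le P (by omega) hg (kraft_netCost L d (5 * n)) ht).trans ?_
    rw [ht_def, Real.exp_neg, Real.exp_log (by positivity), inv_div]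
  -- Markov's inequality for the measure of the sections. Measurability is needed for `B` alone; the
  -- other exceptional sets are handled by outer measure.
  have hsec : μ {S | 1 / 2 ≤ μ (Prod.mk S ⁻¹' B)} ≤ ENNReal.ofReal δ := by
    have h1 := mul_meas_ge_le_lintegral (μ := μ) (measurable_measure_prodMk_left (ν := μ) hBm)
      (1 / 2)
    rw [← Measure.prod_apply hBm] at h1
    have h2 : (2 : ENNReal) * ENNReal.ofReal (δ / 2) = ENNReal.ofReal δ := by
      rw [← ENNReal.ofReal_ofNat 2, ← ENNReal.ofReal_mul two_pos.le, mul_div_cancel₀ _ two_ne_zero]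
    calc μ {S | 1 / 2 ≤ μ (Prod.mk S ⁻¹' B)}
        = 2 * (1 / 2 * μ {S | 1 / 2 ≤ μ (Prod.mk S ⁻¹' B)}) := by
          rw [← mul_assoc, one_div, ENNReal.mul_inv_cancel two_ne_zero ENNReal.ofNat_ne_top,
            one_mul]
      _ ≤ 2 * ENNReal.ofReal (δ / 2) := by gcongr; exact h1.trans hB
      _ = ENNReal.ofReal δ := h2
  have hae := Measure.ae_ae_of_ae_prod hM.2
  have hnull : μ {S | ¬ ∀ᵐ S' ∂μ, ∀ (l : Fin L) (W W' : Weights L d) (ε : ℝ), wNorm W ≤ R →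
      wNorm W' ≤ R → 0 < ε → ε ≤ 1 / β → empDist σ (inputs S) W W' ≤ ε →
      OuterLipAt σ (inputs S) l W W' (M l W ε) ∧ OuterLipAt σ (inputs S') l W W' (M l W ε)} = 0 :=
    hae
  refine (measure_mono (t := ({S | 1 / 2 ≤ μ (Prod.mk S ⁻¹' B)} ∪ {S | ¬ ∀ᵐ S' ∂μ,
      ∀ (l : Fin L) (W W' : Weights L d) (ε : ℝ), wNorm W ≤ R →
      wNorm W' ≤ R → 0 < ε → ε ≤ 1 / β → empDist σ (inputs S) W W' ≤ ε →
      OuterLipAt σ (inputs S) l W W' (M l W ε) ∧ OuterLipAt σ (inputs S') l W W' (M l W ε)}) ∪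
      {S | ¬ SubspaceIso σ P M 12 R β κ b ζ S}) ?_).trans ?_
  swap
  · refine (measure_union_le _ _).trans ?_
    rw [ENNReal.ofReal_add hδ.le hδiso]
    refine add_le_add ((measure_union_le _ _).trans ?_) hiso
    rw [hnull, add_zero]
    exact hsec
  intro S hS
  by_contra hcon
  simp only [Set.mem_union, Set.mem_ofPred_eq, not_or, not_not, not_le] at hcon
  obtain ⟨⟨hS1, hS2⟩, hS3⟩ := hcon
  refine hS fun W hW => ?_
  set f := netLoss σ loss W
  have hfm : Measurable f := measurable_netLoss hσ hmeas hlip W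
  have hcheb := measure_mean_lt_le P (n := n) (by omega) hfm fun z => h01 _ _
  -- The ghost sample may depend on `W`, so Chebyshev's inequality for one fixed function suffices.
  -- The four exceptional probabilities are below `1/2`, at most `1/4`, at most `1/4`, and zero, so
  -- they do not cover the space.
  obtain ⟨S', hS'⟩ : ∃ S', S' ∉ (Prod.mk S ⁻¹' B ∪
      {S' | ¬ SubspaceIsoPair σ M 12 R β κ b (inputs S) (inputs S')}) ∪
      ({S' | (1 / (n : ℝ)) * ∑ i, f (S' i) + 1 / Real.sqrt n ≤ ∫ z, f z ∂P} ∪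
      {S' | ¬ ∀ (l : Fin L) (W W' : Weights L d) (ε : ℝ), wNorm W ≤ R →
        wNorm W' ≤ R → 0 < ε → ε ≤ 1 / β → empDist σ (inputs S) W W' ≤ ε →
        OuterLipAt σ (inputs S) l W W' (M l W ε) ∧
          OuterLipAt σ (inputs S') l W W' (M l W ε)}) := by
    by_contra hall
    have huniv := measure_mono (μ := μ)
      (fun S' (_ : S' ∈ Set.univ) => not_not.1 (not_exists.1 hall S'))
    rw [measure_univ] at huniv
    refine absurd huniv (not_le.2 ?_)
    refine ((measure_union_le _ _).trans (add_le_add (measure_union_le _ _)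
      (measure_union_le _ _))).trans_lt ?_
    have h0 : μ {S' | ¬ ∀ (l : Fin L) (W W' : Weights L d) (ε : ℝ), wNorm W ≤ R →
        wNorm W' ≤ R → 0 < ε → ε ≤ 1 / β → empDist σ (inputs S) W W' ≤ ε →
        OuterLipAt σ (inputs S) l W W' (M l W ε) ∧
          OuterLipAt σ (inputs S') l W W' (M l W ε)} = 0 := hS2
    rw [h0, add_zero]
    have h3 : μ {S' | ¬ SubspaceIsoPair σ M 12 R β κ b (inputs S) (inputs S')}
        ≤ ENNReal.ofReal (1 / 4) := hS3.trans (ENNReal.ofReal_le_ofReal hζ)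
    have h4 : ENNReal.ofReal (1 / 4) + ENNReal.ofReal (1 / 4) = 1 / 2 := by
      rw [← ENNReal.ofReal_add (by norm_num) (by norm_num), show (1 : ℝ) / 4 + 1 / 4 = 2⁻¹ by norm_num,
        ENNReal.ofReal_inv_of_pos two_pos, ENNReal.ofReal_ofNat, one_div]
    calc _ ≤ μ (Prod.mk S ⁻¹' B) + ENNReal.ofReal (1 / 4) + ENNReal.ofReal (1 / 4) := by gcongr
      _ = μ (Prod.mk S ⁻¹' B) + 1 / 2 := by rw [add_assoc, h4]
      _ < 1 / 2 + 1 / 2 := ENNReal.add_lt_add_right (by simp) hS1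
      _ = 1 := ENNReal.add_halves 1
  simp only [Set.mem_union, Set.mem_ofPred_eq, not_or, not_not, not_le] at hS'
  obtain ⟨⟨hbad, hpair⟩, hdev, hout⟩ := hS'
  have hgap : genGap σ P loss S W ≤ 1 / Real.sqrt n
      + (1 / (n : ℝ)) * ∑ i, (f (S' i) - f (S i)) := by
    rw [Finset.sum_sub_distrib, mul_sub]
    have : genGap σ P loss S W = ∫ z, f z ∂P - (1 / (n : ℝ)) * ∑ i, f (S i) := rfl
    linarith
  rw [mul_add, ← mul_assoc, ← ENNReal.ofReal_mul (by norm_num), ← ENNReal.ofReal_mul (by norm_num)]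
  refine le_chaining_of_forall (by positivity) fun α hα => ?_
  have h1 := pair_chaining_le hR hβ hL1 hn hL hd hκ hκK hb hbK hσ h01 hlip hM.1 hout hpair ht hbad
    hW hα
  have hw := inv_sqrt_pos (n := n) (by omega)
  calc ENNReal.ofReal (genGap σ P loss S W)
      ≤ ENNReal.ofReal (1 / Real.sqrt n)
        + ENNReal.ofReal ((1 / (n : ℝ)) * ∑ i, (f (S' i) - f (S i))) :=
        (ENNReal.ofReal_le_ofReal hgap).trans ENNReal.ofReal_add_le
    _ ≤ _ := add_le_add_right h1 _
    _ = ENNReal.ofReal (240 * β) * (ENNReal.ofReal α + ENNReal.ofReal (1 / Real.sqrt n)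
          * ∫⁻ ε in Set.Ioc α (1 / β),
            ENNReal.ofReal (Real.sqrt (riemDim σ M 12 R (inputs S) W (1 / K * ε))))
        + ENNReal.ofReal (1 / Real.sqrt n + (8 + 32 * Real.sqrt (6 * Real.log 2 + 2 * t))
          * (1 / Real.sqrt n)) := by
        rw [ENNReal.ofReal_add hw.le (by positivity), ENNReal.ofReal_mul (p := 240) (by norm_num)]
        ring
    _ ≤ _ := add_le_add_right (ENNReal.ofReal_le_ofReal (remainder_le_concTerm hn hδ hδ1)) _

end Generalization

end DNN

/-! ### Choice of constants and the trivial range of `ζ`. -/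

theorem mainTheorem4 :
    ∃ C₂ C : ℝ, 0 < C₂ ∧ 0 < C ∧
    ∀ K : ℝ, 1 ≤ K → ∃ c : ℝ, 0 < c ∧
    ∀ κ b : ℝ, 1 ≤ κ → κ ≤ K → 1 ≤ b → b ≤ K →
    ∀ (𝒴 : Type*) [MeasurableSpace 𝒴] (L : ℕ) (d : ℕ → ℕ) (n : ℕ)
      (σ : DNN.Activations L d) (P : MeasureTheory.Measure (DNN.Vec (d 0) × 𝒴))
      [MeasureTheory.IsProbabilityMeasure P]
      (loss : DNN.Vec (d L) → 𝒴 → ℝ) (R β ζ δiso : ℝ)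
      (M : Fin L → DNN.Weights L d → ℝ → ℝ),
    1 ≤ L → (∀ l, l ≤ L → 1 ≤ d l) → 2 ≤ n → 0 < R → 0 < β →
    0 ≤ ζ → ζ ≤ 1 → 0 ≤ δiso →
    (∀ l, LipschitzWith 1 (σ l)) →
    (∀ u, Measurable (loss u)) →
    (∀ u y, loss u y ∈ Set.Icc (0 : ℝ) 1) →
    (∀ u v y, |loss u y - loss v y| ≤ β * ‖u - v‖) →
    DNN.CommonLocalLipschitz n σ P R β M →
    (MeasureTheory.Measure.pi fun _ : Fin n => P)
        {S | ¬ DNN.SubspaceIso σ P M C₂ R β κ b ζ S} ≤ ENNReal.ofReal δiso →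
    ∀ δ : ℝ, 0 < δ → δ < 1 →
      (MeasureTheory.Measure.pi fun _ : Fin n => P)
          {S | ¬ ∀ W : DNN.Weights L d, DNN.wNorm W ≤ R →
            ENNReal.ofReal (DNN.genGap σ P loss S W) ≤
              ENNReal.ofReal C *
                (ENNReal.ofReal β * DNN.chaining σ M C₂ R β c (DNN.inputs S) W
                  + ENNReal.ofReal (DNN.concTerm n δ) + ENNReal.ofReal ζ)}
        ≤ ENNReal.ofReal (δ + δiso) ∧
      (ζ ≤ DNN.concTerm n δ →
        (MeasureTheory.Measure.pi fun _ : Fin n => P)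
            {S | ¬ ∀ W : DNN.Weights L d, DNN.wNorm W ≤ R →
              ENNReal.ofReal (DNN.genGap σ P loss S W) ≤
                ENNReal.ofReal C *
                  (ENNReal.ofReal β * DNN.chaining σ M C₂ R β c (DNN.inputs S) W
                    + ENNReal.ofReal (DNN.concTerm n δ))}
          ≤ ENNReal.ofReal (δ + δiso)) := by
  refine ⟨12, 240, by norm_num, by norm_num, fun K hK => ⟨1 / K, by positivity, ?_⟩⟩
  intro κ b hκ hκK hb hbK 𝒴 _ L d n σ P _ loss R β ζ δiso M hL hd hn hR hβ hζ0 _ hδiso hσ hmeas h01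
    hlip hM hiso δ hδ hδ1
  rcases le_or_gt ζ (1 / 4) with hζ | hζ
  · have key := DNN.measure_genGap_le hR hβ hL hn hd hκ hκK hb hbK hζ hδiso hσ hmeas h01 hlip hM hiso
      hδ hδ1
    -- For `ζ ≤ 1/4` the bound already holds without `ζ`, so both claims follow from it.
    refine ⟨(measure_mono (Set.compl_subset_compl.2 fun S hall W hW => ?_)).trans key, fun _ => key⟩
    exact (hall W hW).trans (mul_le_mul_right le_self_add _)
  -- For `ζ > 1/4` either `ζ` itself or the concentration term dominating it exceeds `1/4`, and `240
  -- / 4` is more than the largest possible gap.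
  · have htriv : ∀ (S : Fin n → DNN.Vec (d 0) × 𝒴) (W : DNN.Weights L d) (x : ENNReal) (r : ℝ),
        1 / 4 ≤ r → ENNReal.ofReal (DNN.genGap σ P loss S W)
          ≤ ENNReal.ofReal 240 * (x + ENNReal.ofReal r) := by
      intro S W x r hr
      calc ENNReal.ofReal (DNN.genGap σ P loss S W) ≤ ENNReal.ofReal (240 * r) :=
            ENNReal.ofReal_le_ofReal ((DNN.genGap_le_one h01 S W).trans (by linarith))
        _ = ENNReal.ofReal 240 * ENNReal.ofReal r := ENNReal.ofReal_mul (by norm_num)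
        _ ≤ _ := by
            gcongr
            exact le_add_self
    have hempty : ∀ {p : (Fin n → DNN.Vec (d 0) × 𝒴) → Prop}, (∀ S, p S) →
        (Measure.pi fun _ : Fin n => P) {S | ¬ p S} ≤ ENNReal.ofReal (δ + δiso) := fun h => by
      simp [h]
    exact ⟨hempty fun S W _ => htriv S W _ _ hζ.le,
      fun hc => hempty fun S W _ => htriv S W _ _ (hζ.le.trans hc)⟩
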